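/- Let $\mathfrak g$ be a finite-dimensional reductive complex Lie algebra, $\mathfrak h\subset\mathfrak g$ a Cartan subalgebra, $\Delta(\mathfrak g)\subset\mathfrak h^*$ the set of $\mathfrak h$-roots, $\mathfrak g^\alpha$ the root spaces, and $\mathfrak b\supset\mathfrak h$ a Borel subalgebra. Let $\mathfrak l\supset\mathfrak h$ be a subalgebra of $\mathfrak g$. For a subalgebra $\mathfrak s\supset\mathfrak h$ put $\Delta(\mathfrak s)=\{\alpha\in\Delta(\mathfrak g):\mathfrak g^\alpha\subset\mathfrak s\}$. Put $$\Delta(\mathfrak k)=\Delta(\mathfrak l)\cap-\Delta(\mathfrak l),\quad \Delta(\mathfrak n)=\Delta(\mathfrak l)\setminus\Delta(\mathfrak k),\quad \mathfrak k=\mathfrak h\oplus\bigoplus_{\alpha\in\Delta(\mathfrak k)}\mathfrak g^\alpha,\quad \mathfrak n=\bigoplus_{\alpha\in\Delta(\mathfrak n)}\mathfrak g^\alpha,$$ so that $\mathfrak l=\mathfrak k\oplus\mathfrak n$, and $\mathfrak k_{ss}=[\mathfrak k,\mathfrak k]$. Let $C(\cdot)$ and $N(\cdot)$ denote centralizer and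 normalizer in $\mathfrak g$. Two roots $\alpha,\beta$ are *strongly orthogonal* if neither $\alpha+\beta$ nor $\alpha-\beta$ is a root or zero; write $\Delta(\mathfrak k)^{\perp\!\!\!\perp}$ for the set of roots of $\mathfrak g$ strongly orthogonal to every element of $\Delta(\mathfrak k)$. Put $\mathfrak h_1=\{x\in\mathfrak h:\gamma(x)=0\ \forall\gamma\in\Delta(\mathfrak k)\}$. Let $$\mathrm{Sing}=\{\alpha\in\Delta(\mathfrak g)\setminus\Delta(\mathfrak l): \alpha+\delta\notin\Delta(\mathfrak g)\ \ \forall\delta\in\Delta(\mathfrak b)\cap\Delta(\mathfrak k)\}.$$ Suppose that $\mathfrak l$ satisfies the *cone condition*: the $\mathbb Q_{\ge0}$-spans of $\Delta(\mathfrak n)$ and of $\mathrm{Sing}$ intersect only in $0$. Then: 1. $C(\mathfrak k_{ss})\cap N(C(\mathfrak k_{ss})\cap\mathfrak n)$ is a parabolic subalgebra of $C(\mathfrak k_{ss})$, i.e. it contains a maximal solvable subalgebra of $C(\mathfrak k_{ss})$. 2. There is $h\in\mathfrak h$, on which all roots of $\mathfrak g$ take real values, such that $$C(\mathfrak k_{ss})\cap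 N(C(\mathfrak k_{ss})\cap\mathfrak n)=\mathfrak q_h:=\mathfrak h_1\oplus\bigoplus_{\alpha\in\Delta(\mathfrak k)^{\perp\!\!\!\perp},\ \alpha(h)\ge0}\mathfrak g^\alpha .$$ 3. $C(\mathfrak k_{ss})\cap N(\mathfrak n)=C(\mathfrak k_{ss})\cap N(C(\mathfrak k_{ss})\cap\mathfrak n)$. 4. As a result, the centralizer condition is combinatorial: let $Q$ be the set of all $\alpha\in\Delta(\mathfrak k)^{\perp\!\!\!\perp}$ such that for every $\beta\in\Delta(\mathfrak n)\cap\Delta(\mathfrak k)^{\perp\!\!\!\perp}$ either $\alpha+\beta\in\Delta(\mathfrak n)$ or $\alpha+\beta$ is neither a root nor zero. Then $C(\mathfrak k_{ss})\cap N(\mathfrak n)=\mathfrak h_1\oplus\bigoplus_{\alpha\in Q}\mathfrak g^\alpha$, and $\mathfrak l$ satisfies the *centralizer condition* (a Levi subalgebra of $C(\mathfrak k_{ss})\cap N(\mathfrak n)$ has simple constituents of type $A$ and $C$ only, where $C_2=B_2$ is allowed) if and only if all irreducible components of the root system $Q\cap-Q$ are of type $A$ or $C$. -/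

import Mathlib

noncomputable section

namespace RootSub

/-! ### Generalities on Lie subalgebras -/

section General

variable {L : Type*} [LieRing L] [LieAlgebra ℂ L]

/-- The centralizer `C(W)` of a subspace `W` in `L`. -/
def centralizer (W : Submodule ℂ L) : LieSubalgebra ℂ L where
  carrier := {x | ∀ y ∈ W, ⁅x, y⁆ = 0}
  zero_mem' := fun y _ => zero_lie y
  add_mem' := fun {a b} ha hb y hy => by rw [add_lie, ha y hy, hb y hy, add_zero]
  smul_mem' := fun c x hx y hy => by rw [smul_lie, hx y hy, smul_zero]
  lie_mem' := fun {a b} ha hb y hy => by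
    rw [lie_lie, hb y hy, ha y hy, lie_zero, lie_zero, sub_zero]

/-- The normalizer `N(W) = {x | [x, W] ⊆ W}` of a subspace `W` in `L`.  On Lie subalgebras it is
`LieSubalgebra.normalizer`, see `normalizer_toSubmodule`. -/
def normalizer (W : Submodule ℂ L) : LieSubalgebra ℂ L where
  carrier := {x | ∀ y ∈ W, ⁅x, y⁆ ∈ W}
  zero_mem' := fun y _ => by rw [zero_lie]; exact W.zero_mem
  add_mem' := fun {a b} ha hb y hy => by rw [add_lie]; exact W.add_mem (ha y hy) (hb y hy)
  smul_mem' := fun c x hx y hy => by rw [smul_lie]; exact W.smul_mem c (hx y hy)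
  lie_mem' := fun {a b} ha hb y hy => by
    rw [lie_lie]; exact W.sub_mem (ha _ (hb y hy)) (hb _ (ha y hy))

theorem normalizer_toSubmodule (K : LieSubalgebra ℂ L) :
    normalizer K.toSubmodule = K.normalizer := by
  ext x; exact (LieSubalgebra.mem_normalizer_iff K x).symm

/-- The derived subspace `[W, W]`, spanned by all brackets of elements of `W`. -/
def derived (W : Submodule ℂ L) : Submodule ℂ L :=
  Submodule.span ℂ {z | ∃ x ∈ W, ∃ y ∈ W, ⁅x, y⁆ = z}

/-- `𝔟` is a Borel subalgebra of `𝔠`: a maximal solvable subalgebra of `𝔠`. -/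
def IsBorelOf (𝔠 𝔟 : LieSubalgebra ℂ L) : Prop :=
  Maximal (fun s : LieSubalgebra ℂ L => s ≤ 𝔠 ∧ LieAlgebra.IsSolvable s) 𝔟

/-- `𝔮` is a parabolic subalgebra of `𝔠`: a subalgebra of `𝔠` containing a Borel subalgebra
of `𝔠`. -/
def IsParabolicOf (𝔠 𝔮 : LieSubalgebra ℂ L) : Prop :=
  𝔮 ≤ 𝔠 ∧ ∃ 𝔟 : LieSubalgebra ℂ L, IsBorelOf 𝔠 𝔟 ∧ 𝔟 ≤ 𝔮

/-- A Levi subalgebra of `L`: a subalgebra that is a vector space complement of the solvable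
radical. -/
def IsLevi (𝔪 : LieSubalgebra ℂ L) : Prop :=
  IsCompl 𝔪.toSubmodule (LieAlgebra.radical ℂ L).toSubmodule

/-- The set of roots of `L` with respect to a nilpotent (in the applications, a Cartan)
subalgebra `H`. -/
def roots (H : LieSubalgebra ℂ L) [LieRing.IsNilpotent H] : Set (Module.Dual ℂ H) :=
  {α | α ≠ 0 ∧ LieAlgebra.rootSpace H α ≠ ⊥}

end General

/-! ### Root systems of type `A` and `C`, given by their sets of roots -/

section Types

variable {V : Type*} [AddCommGroup V] [Module ℂ V]

/-- `Φ` is a root system of type `A_n` for some `n ≥ 1`: it consists of the vectors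
`ε_i - ε_j`, `i ≠ j`, for `n + 1` affinely independent points `ε_i`. -/
def IsTypeA (Φ : Set V) : Prop :=
  ∃ n : ℕ, 1 ≤ n ∧ ∃ ε : Fin (n + 1) → V, AffineIndependent ℂ ε ∧
    Φ = {v | ∃ i j, i ≠ j ∧ v = ε i - ε j}

/-- `Φ` is a root system of type `C_n` for some `n ≥ 1` (`C_1 = A_1`, `C_2 = B_2`): it consists
of the non-zero vectors among `± ε_i ± ε_j` (with `i = j` allowed), for `n` linearly independent
vectors `ε_i`. -/
def IsTypeC (Φ : Set V) : Prop :=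
  ∃ n : ℕ, 1 ≤ n ∧ ∃ ε : Fin n → V, LinearIndependent ℂ ε ∧
    Φ = {v | v ≠ 0 ∧ ∃ i j, v = ε i + ε j ∨ v = ε i - ε j ∨ v = -(ε i + ε j)}

/-- All irreducible components of the root system `Φ` are of type `A` or `C`: `Φ` is the direct
sum of finitely many (possibly no) root systems of type `A` or `C`. -/
def HasComponentsAC (Φ : Set V) : Prop :=
  ∃ (N : ℕ) (Ψ : Fin N → Set V), Φ = (⋃ i, Ψ i) ∧
    iSupIndep (fun i => Submodule.span ℂ (Ψ i)) ∧ ∀ i, IsTypeA (Ψ i) ∨ IsTypeC (Ψ i)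

end Types

/-! ### Root subalgebras.  `H` is the fixed Cartan subalgebra `𝔥`, `l` is a subalgebra with
`H ≤ l`. -/

section RootSubalgebras

variable {L : Type*} [LieRing L] [LieAlgebra ℂ L]
  (H : LieSubalgebra ℂ L) [LieRing.IsNilpotent H]

/-- The roots `Δ(l)` of a subalgebra `l` containing `H`. -/
def rootsOf (l : LieSubalgebra ℂ L) : Set (Module.Dual ℂ H) :=
  {α ∈ roots H | (LieAlgebra.rootSpace H α).toSubmodule ≤ l.toSubmodule}

/-- `Δ(𝔨)`. -/
def rootsK (l : LieSubalgebra ℂ L) : Set (Module.Dual ℂ H) :=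
  {α ∈ rootsOf H l | -α ∈ rootsOf H l}

/-- `Δ(𝔫) = Δ(l) \ Δ(𝔨)`. -/
def rootsN (l : LieSubalgebra ℂ L) : Set (Module.Dual ℂ H) :=
  rootsOf H l \ rootsK H l

/-- The sum of the root spaces of `L` for the roots in `S`. -/
def rootSum (S : Set (Module.Dual ℂ H)) : Submodule ℂ L :=
  ⨆ α ∈ S, (LieAlgebra.rootSpace H α).toSubmodule

/-- `𝔨`, the reductive part of `l` that contains `H`. -/
def partK (l : LieSubalgebra ℂ L) : Submodule ℂ L :=
  H.toSubmodule ⊔ rootSum H (rootsK H l)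

/-- `𝔫`, the nilradical of `l` (the part of `l` complementary to `𝔨`). -/
def partN (l : LieSubalgebra ℂ L) : Submodule ℂ L :=
  rootSum H (rootsN H l)

/-- `C(𝔨_ss)`, where `𝔨_ss = [𝔨, 𝔨]`. -/
def centK (l : LieSubalgebra ℂ L) : LieSubalgebra ℂ L :=
  centralizer (derived (partK H l))

/-- Two functionals (roots) are strongly orthogonal if neither their sum nor their difference is
a root or zero. -/
def StronglyOrthogonal (α β : Module.Dual ℂ H) : Prop :=
  (α + β ∉ roots H ∧ α + β ≠ 0) ∧ (α - β ∉ roots H ∧ α - β ≠ 0)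

/-- The roots of `L` strongly orthogonal to every root of `𝔨`. -/
def rootsPerp (l : LieSubalgebra ℂ L) : Set (Module.Dual ℂ H) :=
  {α ∈ roots H | ∀ γ ∈ rootsK H l, StronglyOrthogonal H α γ}

/-- `𝔥₁ = {x ∈ 𝔥 | γ(x) = 0 for all γ ∈ Δ(𝔨)}`, as a subspace of `L`. -/
def h1 (l : LieSubalgebra ℂ L) : Submodule ℂ L :=
  (⨅ γ ∈ rootsK H l, LinearMap.ker γ).map H.toSubmodule.subtype

/-- `𝔮_h`, for an element `h` of `𝔥` on which all roots take real values. -/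
def qSub (l : LieSubalgebra ℂ L) (h : H) : Submodule ℂ L :=
  h1 H l ⊔ rootSum H {α ∈ rootsPerp H l | 0 ≤ (α h).re}

/-- `Sing_{𝔟 ∩ 𝔨}(𝔤/l)`. -/
def sing (b l : LieSubalgebra ℂ L) : Set (Module.Dual ℂ H) :=
  {α ∈ roots H \ rootsOf H l | ∀ δ ∈ rootsOf H b ∩ rootsK H l, α + δ ∉ roots H}

/-- The cone condition: the cones spanned over the non-negative rationals by `Δ(𝔫)` and by
`Sing_{𝔟 ∩ 𝔨}(𝔤/l)` meet only in `0`. -/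
def ConeCondition (b l : LieSubalgebra ℂ L) : Prop :=
  Submodule.span ℚ≥0 (rootsN H l) ⊓ Submodule.span ℚ≥0 (sing H b l) = ⊥

/-- The centralizer condition: a Levi subalgebra of `C(𝔨_ss) ∩ N(𝔫)` has simple constituents
(that is, simple ideals) of type `A` and `C` only.  The type of a simple constituent is the type
of its root system with respect to a Cartan subalgebra, which we take inside the fixed Cartan
subalgebra `H` of `L`. -/
def CentralizerCondition (l : LieSubalgebra ℂ L) : Prop :=
  ∃ 𝔪 : LieSubalgebra ℂ ↥(centK H l ⊓ normalizer (partN H l)), IsLevi 𝔪 ∧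
    ∀ I : LieIdeal ℂ 𝔪, LieAlgebra.IsSimple ℂ I →
      ∃ (T : LieSubalgebra ℂ I) (_ : T.IsCartanSubalgebra),
        (∀ x ∈ T, ((((x : I) : 𝔪) : ↥(centK H l ⊓ normalizer (partN H l))) : L) ∈ H) ∧
          (IsTypeA (roots T) ∨ IsTypeC (roots T))

/-- The set `Q` of the roots `α` strongly orthogonal to `Δ(𝔨)` such that, for every
`β ∈ Δ(𝔫)` strongly orthogonal to `Δ(𝔨)`, either `α + β ∈ Δ(𝔫)` or `α + β` is neither a root
nor zero. -/
def setQ (l : LieSubalgebra ℂ L) : Set (Module.Dual ℂ H) :=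
  {α ∈ rootsPerp H l | ∀ β ∈ rootsN H l ∩ rootsPerp H l,
    α + β ∈ rootsN H l ∨ (α + β ∉ roots H ∧ α + β ≠ 0)}

/-- The set `Q ∩ -Q`. -/
def symQ (l : LieSubalgebra ℂ L) : Set (Module.Dual ℂ H) :=
  {α ∈ setQ H l | -α ∈ setQ H l}

end RootSubalgebras

end RootSub

end

open RootSub

open RootSub

namespace RootSub

open LieAlgebra LieModule

/-! ### Generalities -/

/-! Everything follows from one element `h` of `H`, at which all roots are real, roots of `𝔫` are
positive and roots in `sing` are non-positive. Since `Δ(𝔫)` is closed under addition and contains no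
pair `±α`, its cone is pointed, and Farkas' lemma turns the cone condition into such an `h`
(`exists_cone_separating`).

Given `h`, `setQ` consists exactly of the roots in `rootsPerp` that are non-negative at `h`
(`setQ_eq`). If `α` is in `setQ` with `α(h) < 0`, then `-α` lies in `Δ(l)`, as otherwise strong
orthogonality would put it in `sing` although it is positive at `h`; so `-α ∈ Δ(𝔫)`, and `α + (-α) =
0` contradicts the definition of `setQ`. Conversely, let `α(h) ≥ 0`, `β ∈ Δ(𝔫)`, and let `α + β` be
a root outside `Δ(l)`. Raising `β` by roots of `𝔟 ∩ 𝔨` as far as possible gives `β' ∈ Δ(𝔫)` with `α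
+ β'` in `sing` (`add_mem_sing_of_maximal`), although `α(h) + β'(h) > 0`. This argument uses all `β
∈ Δ(𝔫)`, not only the strongly orthogonal ones, so the two normalizers agree inside `C(𝔨_ss)`.

The subalgebra is therefore `𝔮_h`. It is parabolic because a regular perturbation of `h` singles out
a Borel subalgebra inside it. Its radical and a semisimple complement are read off from the roots
that are positive, respectively zero, at `h`; the zero ones are `Q ∩ -Q`. Any Levi subalgebra
projects isomorphically onto this complement along the radical (`exists_levi_hom`), and the simple
ideals of the complement match the irreducible components of `Q ∩ -Q`.

Reductivity enters as "the radical is the centre". Root theory is available for the Killing algebra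
`L / Z(L)` and is lifted to `L` by means of `Z(L) ∩ [L, L] = 0`. -/

theorem not_isSolvable_of_isSl2Triple {M : Type*} [LieRing M] [LieAlgebra ℂ M] {h e f : M}
    (t : IsSl2Triple h e f) : ¬ LieAlgebra.IsSolvable M := by
  intro hs
  have key : ∀ k, h ∈ derivedSeries ℂ M k ∧ e ∈ derivedSeries ℂ M k ∧ f ∈ derivedSeries ℂ M k := by
    intro k
    induction k with
    | zero => simp
    | succ k ih =>
      obtain ⟨ih1, ih2, ih3⟩ := ih
      have hstep : ∀ x y : M, x ∈ derivedSeries ℂ M k → y ∈ derivedSeries ℂ M k →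
          ⁅x, y⁆ ∈ derivedSeries ℂ M (k + 1) := by
        intro x y hx hy
        rw [derivedSeries_def, derivedSeriesOfIdeal_succ]
        exact LieSubmodule.lie_mem_lie hx hy
      refine ⟨t.lie_e_f ▸ hstep _ _ ih2 ih3, ?_, ?_⟩
      · have := hstep _ _ ih1 ih2
        rw [t.lie_h_e_smul ℂ] at this
        simpa using Submodule.smul_mem _ (2⁻¹ : ℂ) this
      · have := hstep _ _ ih1 ih3
        rw [t.lie_lie_smul_f ℂ] at this
        have := Submodule.smul_mem _ (-(2⁻¹ : ℂ)) this
        simpa using this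
  obtain ⟨k, hk⟩ := hs.solvable ℂ M
  have := (key k).1
  rw [hk, LieSubmodule.mem_bot] at this
  exact t.h_ne_zero this

/-! ### Reductive algebras: the quotient by the centre, and `Z(L) ∩ [L, L] = 0`. -/

section Reductive

variable {L : Type*} [LieRing L] [LieAlgebra ℂ L]

theorem lie_mem_derived_top (x y : L) : ⁅x, y⁆ ∈ derived (⊤ : Submodule ℂ L) :=
  Submodule.subset_span ⟨x, trivial, y, trivial, rfl⟩

/-- The projection of `L` to the quotient by its centre. -/
noncomputable def quotCenter (L : Type*) [LieRing L] [LieAlgebra ℂ L] :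
    L →ₗ⁅ℂ⁆ L ⧸ center ℂ L :=
  { (LieSubmodule.Quotient.mk' (center ℂ L) : L →ₗ[ℂ] L ⧸ center ℂ L) with
    map_lie' := fun {x y} => LieSubmodule.Quotient.mk_bracket _ x y }

theorem quotCenter_eq_zero {x : L} : quotCenter L x = 0 ↔ x ∈ center ℂ L :=
  LieSubmodule.Quotient.mk_eq_zero _

theorem quotCenter_surjective : Function.Surjective (quotCenter L) :=
  LieSubmodule.Quotient.surjective_mk' _

variable [FiniteDimensional ℂ L] [LieAlgebra.HasCentralRadical ℂ L]

/-- The preimage in `L` of an abelian ideal of the quotient is solvable in two steps, hence lies in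
the radical, which is the centre. -/
instance hasTrivialRadical_quotient_center :
    LieAlgebra.HasTrivialRadical ℂ (L ⧸ center ℂ L) := by
  rw [hasTrivialRadical_iff_no_abelian_ideals]
  intro I hI
  let p : L →ₗ⁅ℂ⁆ L ⧸ center ℂ L := quotCenter L
  have hp : ∀ x, p x = 0 ↔ x ∈ center ℂ L := fun x => quotCenter_eq_zero
  let J : LieIdeal ℂ L := I.comap p
  have hJ : LieAlgebra.IsSolvable J := by
    refine LieAlgebra.IsSolvable.mk (R := ℂ) (k := 2) ?_
    rw [LieIdeal.derivedSeries_eq_bot_iff, derivedSeriesOfIdeal_succ, derivedSeriesOfIdeal_succ,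
      derivedSeriesOfIdeal_zero]
    have h1 : ⁅J, J⁆ ≤ center ℂ L := by
      rw [LieSubmodule.lieIdeal_oper_eq_span, LieSubmodule.lieSpan_le]
      rintro _ ⟨⟨x, hx⟩, ⟨y, hy⟩, rfl⟩
      change ⁅x, y⁆ ∈ center ℂ L
      rw [← hp, LieHom.map_lie]
      have := hI.trivial ⟨p x, hx⟩ ⟨p y, hy⟩
      exact congrArg Subtype.val this
    rw [eq_bot_iff, LieSubmodule.lieIdeal_oper_eq_span, LieSubmodule.lieSpan_le]
    rintro _ ⟨⟨x, hx⟩, ⟨y, hy⟩, rfl⟩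
    change ⁅x, y⁆ ∈ (⊥ : LieIdeal ℂ L)
    rw [LieSubmodule.mem_bot]
    exact (h1 hy) x
  have hJc : J ≤ center ℂ L := by
    rw [← LieAlgebra.HasCentralRadical.radical_eq_center (R := ℂ) (L := L)]
    exact (LieIdeal.solvable_iff_le_radical ℂ L J).mp hJ
  rw [eq_bot_iff]
  intro y hy
  obtain ⟨x, rfl⟩ := quotCenter_surjective y
  rw [LieSubmodule.mem_bot, hp]
  exact hJc hy

/-- Whitehead's second lemma in disguise. For a functional `lam` on `L`, the form `(x, y) ↦ lam ⁅x,
y⁆` descends to a 2-cocycle on the semisimple quotient. The Killing form turns it into a derivation,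
which is inner, say `ad u`. Hence on `[L, L]` the functional `lam` is the Killing pairing of `u`
with the image in the quotient, and so it kills central elements. -/
theorem eq_zero_of_mem_center_of_mem_derived {z : L} (hz : z ∈ center ℂ L)
    (hd : z ∈ derived (⊤ : Submodule ℂ L)) : z = 0 := by
  classical
  rw [← Module.forall_dual_apply_eq_zero_iff ℂ z]
  intro lam
  obtain ⟨s, hs⟩ := (quotCenter L : L →ₗ[ℂ] L ⧸ center ℂ L).exists_rightInverse_of_surjective
    (LinearMap.range_eq_top.2 quotCenter_surjective)
  have hs' : ∀ y, quotCenter L (s y) = y := fun y => LinearMap.congr_fun hs y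
  have hcen : ∀ x : L, s (quotCenter L x) - x ∈ center ℂ L := fun x => by
    rw [← quotCenter_eq_zero, map_sub, hs', sub_self]
  have hzl : ∀ u ∈ center ℂ L, ∀ x : L, ⁅x, u⁆ = 0 := fun u hu x => hu x
  have hzr : ∀ u ∈ center ℂ L, ∀ x : L, ⁅u, x⁆ = 0 := fun u hu x => by
    rw [← lie_skew, hu x, neg_zero]
  have hbr : ∀ x y : L, ⁅s (quotCenter L x), s (quotCenter L y)⁆ = ⁅x, y⁆ := by
    intro x y
    have h1 : s (quotCenter L x) = x + (s (quotCenter L x) - x) := by abel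
    have h2 : s (quotCenter L y) = y + (s (quotCenter L y) - y) := by abel
    rw [h1, h2, add_lie, lie_add, lie_add, hzl _ (hcen y), hzr _ (hcen x), hzr _ (hcen x)]
    simp
  let om : L ⧸ center ℂ L →ₗ[ℂ] L ⧸ center ℂ L →ₗ[ℂ] ℂ :=
    LinearMap.mk₂ ℂ (fun x y => lam ⁅s x, s y⁆) (by simp) (by simp) (by simp) (by simp)
  have hom : ∀ x y : L, om (quotCenter L x) (quotCenter L y) = lam ⁅x, y⁆ := fun x y => by
    change lam ⁅s _, s _⁆ = _
    rw [hbr]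
  let B := killingForm ℂ (L ⧸ center ℂ L)
  have hB : B.Nondegenerate := LieAlgebra.IsKilling.killingForm_nondegenerate ℂ _
  let Dl : L ⧸ center ℂ L →ₗ[ℂ] L ⧸ center ℂ L :=
    (LinearMap.BilinForm.toDual B hB).symm.toLinearMap ∘ₗ om
  have hD : ∀ x y, B (Dl x) y = om x y := fun x y => by
    exact LinearMap.BilinForm.apply_toDual_symm_apply (hB := hB) (om x) y
  have hinv : ∀ x y z, B ⁅x, y⁆ z = B x ⁅y, z⁆ := fun x y z =>
    LieModule.traceForm_apply_lie_apply ℂ _ _ x y z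
  have hsymm : ∀ x y, B x y = B y x := fun x y => LieModule.traceForm_comm ℂ _ _ x y
  have hext : ∀ x, (∀ y, B x y = 0) → x = 0 := fun x hx => hB.1 x hx
  -- The cocycle identity, here the Jacobi identity inside `lam`, is exactly the Leibniz rule for
  -- `Dl`.
  let D : LieDerivation ℂ (L ⧸ center ℂ L) (L ⧸ center ℂ L) :=
    { Dl with
      leibniz' := fun x y => by
        change Dl ⁅x, y⁆ = ⁅x, Dl y⁆ - ⁅y, Dl x⁆
        rw [← sub_eq_zero]
        apply hext
        intro w
        obtain ⟨x, rfl⟩ := quotCenter_surjective x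
        obtain ⟨y, rfl⟩ := quotCenter_surjective y
        obtain ⟨w, rfl⟩ := quotCenter_surjective w
        have e1 : B ⁅quotCenter L x, Dl (quotCenter L y)⁆ (quotCenter L w)
            = - lam ⁅y, ⁅x, w⁆⁆ := by
          rw [← lie_skew, map_neg, LinearMap.neg_apply, hinv, hD, ← LieHom.map_lie, hom]
        have e2 : B ⁅quotCenter L y, Dl (quotCenter L x)⁆ (quotCenter L w)
            = - lam ⁅x, ⁅y, w⁆⁆ := by
          rw [← lie_skew, map_neg, LinearMap.neg_apply, hinv, hD, ← LieHom.map_lie, hom]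
        rw [map_sub, map_sub, LinearMap.sub_apply, LinearMap.sub_apply, e1, e2, hD,
          ← LieHom.map_lie, hom, lie_lie, map_sub]
        ring }
  obtain ⟨u, hu⟩ := LieDerivation.IsKilling.exists_eq_ad D
  have hu' : ∀ x, ⁅u, x⁆ = Dl x := fun x => by
    have := LieDerivation.congr_fun hu x
    rwa [LieDerivation.ad_apply_apply] at this
  have hlam : ∀ w ∈ derived (⊤ : Submodule ℂ L), lam w = B u (quotCenter L w) := by
    intro w hw
    induction hw using Submodule.span_induction with
    | mem w hw =>
      obtain ⟨x, -, y, -, rfl⟩ := hw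
      rw [← hom, ← hD, ← hu', hinv, LieHom.map_lie]
    | zero => simp
    | add a b _ _ ha hb => rw [map_add, ha, hb, map_add, map_add]
    | smul c a _ ha => rw [map_smul, ha, map_smul, map_smul]
  rw [hlam z hd, quotCenter_eq_zero.2 hz, map_zero]

end Reductive

/-! ### Lifting roots, coroots and root strings from `L / Z(L)` to `L`. -/

section Transport

variable {L : Type*} [LieRing L] [LieAlgebra ℂ L]
  (H : LieSubalgebra ℂ L)

/-- The map from a subalgebra to its image modulo the centre. -/
noncomputable def cartanMap : H →ₗ⁅ℂ⁆ H.map (quotCenter L) where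
  toFun x := ⟨quotCenter L x, x, x.2, rfl⟩
  map_add' _ _ := Subtype.ext (map_add (quotCenter L) _ _)
  map_smul' c _ := Subtype.ext (map_smul (quotCenter L) c _)
  map_lie' {_ _} := Subtype.ext (LieHom.map_lie (quotCenter L) _ _)

theorem coe_cartanMap (x : H) : (cartanMap H x : L ⧸ center ℂ L) = quotCenter L x := rfl

theorem cartanMap_surjective : Function.Surjective (cartanMap H) := by
  rintro ⟨_, x, hx, rfl⟩
  exact ⟨⟨x, hx⟩, rfl⟩

variable [H.IsCartanSubalgebra]

theorem center_le_cartan {z : L} (hz : z ∈ center ℂ L) : z ∈ H := by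
  rw [← LieSubalgebra.IsCartanSubalgebra.self_normalizing (H := H),
    LieSubalgebra.mem_normalizer_iff]
  intro y _
  rw [← lie_skew, hz y, neg_zero]
  exact H.zero_mem

instance isCartanSubalgebra_map_quotCenter :
    (H.map (quotCenter L)).IsCartanSubalgebra where
  nilpotent := Function.Surjective.lieAlgebra_isNilpotent (cartanMap_surjective H)
  self_normalizing := by
    refine le_antisymm ?_ (LieSubalgebra.le_normalizer _)
    intro y hy
    obtain ⟨x, rfl⟩ := quotCenter_surjective y
    rw [LieSubalgebra.mem_normalizer_iff] at hy
    refine ⟨x, ?_, rfl⟩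
    change x ∈ H
    rw [← LieSubalgebra.IsCartanSubalgebra.self_normalizing (H := H),
      LieSubalgebra.mem_normalizer_iff]
    intro u hu
    obtain ⟨v, hv, hvu⟩ := hy (quotCenter L u) ⟨u, hu, rfl⟩
    have : ⁅x, u⁆ - v ∈ center ℂ L := by
      rw [← quotCenter_eq_zero, map_sub, LieHom.map_lie, sub_eq_zero]
      exact hvu.symm
    have h2 := H.add_mem (center_le_cartan H this) hv
    simpa using h2

variable {H} in
theorem eq_zero_of_mem_center_of_mem_rootSpace {α : Module.Dual ℂ H} (hα : α ≠ 0) {z : L}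
    (hz : z ∈ center ℂ L) (hzr : z ∈ rootSpace H α) : z = 0 := by
  obtain ⟨h, hh⟩ : ∃ h, α h ≠ 0 := by
    by_contra! hc
    exact hα (LinearMap.ext hc)
  rw [mem_genWeightSpace] at hzr
  obtain ⟨k, hk⟩ := hzr h
  have key : ∀ n : ℕ, ((toEnd ℂ H L h - α h • 1) ^ n) z = (-α h) ^ n • z := by
    intro n
    induction n with
    | zero => simp
    | succ n ih =>
      rw [pow_succ', Module.End.mul_apply, ih, map_smul, LinearMap.sub_apply,
        LinearMap.smul_apply, Module.End.one_apply]
      have : toEnd ℂ H L h z = 0 := hz (h : L)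
      rw [this, zero_sub, pow_succ, ← neg_smul, smul_smul]
  rw [key] at hk
  exact (smul_eq_zero.1 hk).resolve_left (pow_ne_zero _ (neg_ne_zero.2 hh))

variable {H} in
theorem mem_roots_of_mem_rootSpace {α : Module.Dual ℂ H} (hα : α ≠ 0) {x : L}
    (hx : x ∈ rootSpace H α) (h0 : x ≠ 0) : α ∈ roots H :=
  ⟨hα, fun hb => h0 (by rwa [hb, LieSubmodule.mem_bot] at hx)⟩

variable [FiniteDimensional ℂ L] [LieAlgebra.HasCentralRadical ℂ L]

theorem lie_cartan_eq_zero {x y : L} (hx : x ∈ H) (hy : y ∈ H) : ⁅x, y⁆ = 0 := by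
  refine eq_zero_of_mem_center_of_mem_derived ?_ (lie_mem_derived_top x y)
  rw [← quotCenter_eq_zero, LieHom.map_lie]
  exact congrArg Subtype.val
    (trivial_lie_zero _ _ (cartanMap H ⟨x, hx⟩) (cartanMap H ⟨y, hy⟩))

variable {H}

/-- A common eigenvector for a non-zero root is not central, so its image in the quotient is
non-zero. The eigenvalue then depends only on the image of `h` in the quotient, so `α` factors
through `cartanMap`. -/
theorem exists_weight_of_mem_roots {α : Module.Dual ℂ H} (hα : α ∈ roots H) :
    ∃ χ : Weight ℂ (H.map (quotCenter L)) (L ⧸ center ℂ L), χ.IsNonZero ∧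
      ∀ h : H, χ (cartanMap H h) = α h := by
  obtain ⟨h0, hr⟩ := hα
  obtain ⟨m, hm0, hm⟩ := exists_forall_lie_eq_smul ℂ H L (⟨α, hr⟩ : Weight ℂ H L)
  replace hm : ∀ h : H, ⁅(h : L), m⁆ = α h • m := hm
  have hpm : quotCenter L m ≠ 0 := by
    rw [Ne, quotCenter_eq_zero]
    intro hc
    apply h0
    ext h
    have h1 := hm h
    rw [hc (h : L)] at h1
    simpa [hm0] using h1.symm
  obtain ⟨s, hs⟩ := (cartanMap H : H →ₗ[ℂ] H.map (quotCenter L)).exists_rightInverse_of_surjective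
    (by rw [LinearMap.range_eq_top]; exact cartanMap_surjective H)
  have hs' : ∀ y, cartanMap H (s y) = y := fun y => LinearMap.congr_fun hs y
  have hwt : ∀ h : H, ⁅cartanMap H h, quotCenter L m⁆ = α h • quotCenter L m := by
    intro h
    rw [← map_smul, ← hm h, LieHom.map_lie]
    rfl
  have hval : ∀ h : H, α (s (cartanMap H h)) = α h := by
    intro h
    have h1 := hwt (s (cartanMap H h))
    rw [hs', hwt h] at h1
    exact (smul_left_injective ℂ hpm h1).symm
  refine ⟨⟨fun y => α (s y), ?_⟩, ?_, hval⟩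
  · rw [Ne, LieSubmodule.eq_bot_iff, not_forall]
    refine ⟨quotCenter L m, ?_⟩
    rw [Classical.not_imp]
    refine ⟨weightSpace_le_genWeightSpace _ _ ?_, hpm⟩
    rw [mem_weightSpace]
    intro y
    have := hwt (s y)
    rwa [hs'] at this
  · intro hz
    apply h0
    ext h
    have := congrFun hz (cartanMap H h)
    change α (s (cartanMap H h)) = 0 at this
    rw [hval] at this
    simpa using this

theorem quotCenter_mem_rootSpace {α : H → ℂ} {χ : H.map (quotCenter L) → ℂ}
    (hχ : ∀ h : H, χ (cartanMap H h) = α h) {x : L} (hx : x ∈ rootSpace H α) :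
    quotCenter L x ∈ rootSpace (H.map (quotCenter L)) χ := by
  rw [mem_genWeightSpace] at hx ⊢
  intro y
  obtain ⟨h, rfl⟩ := cartanMap_surjective H y
  obtain ⟨k, hk⟩ := hx h
  refine ⟨k, ?_⟩
  have key : ∀ (n : ℕ) (v : L),
      ((toEnd ℂ (H.map (quotCenter L)) (L ⧸ center ℂ L) (cartanMap H h)
        - χ (cartanMap H h) • 1) ^ n) (quotCenter L v)
        = quotCenter L (((toEnd ℂ H L h - α h • 1) ^ n) v) := by
    intro n
    induction n with
    | zero => intro v; simp
    | succ n ih =>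
      intro v
      rw [pow_succ, pow_succ, Module.End.mul_apply, Module.End.mul_apply, ← ih]
      congr 1
      rw [hχ, LinearMap.sub_apply, LinearMap.sub_apply, map_sub, LinearMap.smul_apply,
        LinearMap.smul_apply, Module.End.one_apply, Module.End.one_apply, map_smul]
      congr 1
  rw [key, hk, map_zero]

/-- The Cartan subalgebra acts diagonally on the root spaces. -/
theorem lie_eq_smul_of_mem_rootSpace {α : Module.Dual ℂ H} (hα : α ≠ 0) {x : L}
    (hx : x ∈ rootSpace H α) (h : H) : ⁅(h : L), x⁆ = α h • x := by
  by_cases h0 : x = 0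
  · simp [h0]
  obtain ⟨χ, -, hχ⟩ := exists_weight_of_mem_roots (mem_roots_of_mem_rootSpace hα hx h0)
  have h1 := LieAlgebra.IsKilling.lie_eq_smul_of_mem_rootSpace
    (quotCenter_mem_rootSpace hχ hx) (cartanMap H h)
  rw [← sub_eq_zero]
  refine eq_zero_of_mem_center_of_mem_rootSpace hα ?_
    (sub_mem ((rootSpace H α).lie_mem (x := h) hx) (Submodule.smul_mem _ _ hx))
  rw [← quotCenter_eq_zero, map_sub, map_smul, LieHom.map_lie, sub_eq_zero, ← hχ, ← h1]
  rfl

/-- A preimage `v` is corrected to `(α h)⁻¹ • ⁅h, v⁆`. This is a commutator, so its failure to be an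
eigenvector, which is central, lies in `Z(L) ∩ [L, L] = 0`. -/
theorem exists_mem_rootSpace_quotCenter_eq {α : Module.Dual ℂ H} (hα : α ≠ 0)
    {χ : H.map (quotCenter L) → ℂ}
    (hχ : ∀ h : H, χ (cartanMap H h) = α h) {y : L ⧸ center ℂ L}
    (hy : y ∈ rootSpace (H.map (quotCenter L)) χ) :
    ∃ x ∈ rootSpace H α, quotCenter L x = y := by
  obtain ⟨h, hh⟩ : ∃ h, α h ≠ 0 := by
    by_contra! hc
    exact hα (LinearMap.ext hc)
  have hwt : ∀ h : H, ⁅quotCenter L (h : L), y⁆ = α h • y := fun h => by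
    rw [← hχ]
    exact LieAlgebra.IsKilling.lie_eq_smul_of_mem_rootSpace hy (cartanMap H h)
  obtain ⟨v, rfl⟩ := quotCenter_surjective y
  refine ⟨(α h)⁻¹ • ⁅(h : L), v⁆, ?_, ?_⟩
  · refine weightSpace_le_genWeightSpace _ _ ?_
    rw [mem_weightSpace]
    intro k
    change ⁅(k : L), _⁆ = _
    rw [← sub_eq_zero]
    refine eq_zero_of_mem_center_of_mem_derived ?_ ?_
    · rw [← quotCenter_eq_zero, map_sub, LieHom.map_lie, map_smul, map_smul, map_smul,
        LieHom.map_lie, hwt, lie_smul, lie_smul, hwt, sub_eq_zero, smul_comm (α k),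
        smul_comm (α k)]
    · refine sub_mem (lie_mem_derived_top _ _) (Submodule.smul_mem _ _
        (Submodule.smul_mem _ _ (lie_mem_derived_top _ _)))
  · rw [map_smul, LieHom.map_lie, hwt, smul_smul, inv_mul_cancel₀ hh, one_smul]

theorem mem_roots_of_weight {α : Module.Dual ℂ H} (hα : α ≠ 0)
    {χ : H.map (quotCenter L) → ℂ} (hχ : ∀ h : H, χ (cartanMap H h) = α h)
    (hb : rootSpace (H.map (quotCenter L)) χ ≠ ⊥) : α ∈ roots H := by
  obtain ⟨y, hy, hy0⟩ := Submodule.exists_mem_ne_zero_of_ne_bot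
    (fun h => hb (LieSubmodule.toSubmodule_injective h))
  obtain ⟨x, hx, rfl⟩ := exists_mem_rootSpace_quotCenter_eq hα hχ hy
  exact mem_roots_of_mem_rootSpace hα hx (fun h => hy0 (by rw [h, map_zero]))

theorem exists_coroot {α : Module.Dual ℂ H} (hα : α ∈ roots H) :
    ∃ (h : H) (e f : L), e ∈ rootSpace H α ∧ f ∈ rootSpace H (-α : Module.Dual ℂ H) ∧
      ⁅e, f⁆ = (h : L) ∧ α h = 2 ∧
      ∀ β ∈ roots H, ∃ n : ℤ, β h = n ∧ (n < 0 → α + β ≠ 0 → α + β ∈ roots H) := by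
  obtain ⟨χ, hχ0, hχ⟩ := exists_weight_of_mem_roots hα
  obtain ⟨h', e', f', ht, he', hf'⟩ :=
    LieAlgebra.IsKilling.exists_isSl2Triple_of_weight_isNonZero hχ0
  have hco := ht.h_eq_coroot hχ0 he' hf'
  obtain ⟨e, he, rfl⟩ := exists_mem_rootSpace_quotCenter_eq hα.1 hχ he'
  obtain ⟨f, hf, rfl⟩ := exists_mem_rootSpace_quotCenter_eq (α := -α) (neg_ne_zero.2 hα.1)
    (χ := -χ) (fun h => by simp [hχ]) hf'
  have hef : ⁅e, f⁆ ∈ H := by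
    have h1 := LieAlgebra.lie_mem_genWeightSpace_of_mem_genWeightSpace he hf
    have h2 : ((α : H → ℂ) + ((-α : Module.Dual ℂ H) : H → ℂ)) = 0 := by
      ext x; simp
    rw [h2] at h1
    change ⁅e, f⁆ ∈ rootSpace H (0 : H → ℂ) at h1
    rwa [rootSpace_zero_eq] at h1
  have hc : cartanMap H ⟨⁅e, f⁆, hef⟩ = LieAlgebra.IsKilling.coroot χ := by
    apply Subtype.ext
    rw [coe_cartanMap, ← hco, ← ht.lie_e_f, LieHom.map_lie]
  refine ⟨⟨⁅e, f⁆, hef⟩, e, f, he, hf, rfl, ?_, ?_⟩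
  · rw [← hχ, hc, LieAlgebra.IsKilling.root_apply_coroot hχ0]
  · intro β hβ
    obtain ⟨ψ, hψ0, hψ⟩ := exists_weight_of_mem_roots hβ
    refine ⟨chainBotCoeff χ ψ - chainTopCoeff χ ψ, ?_, ?_⟩
    · rw [← hψ, hc, LieAlgebra.IsKilling.apply_coroot_eq_cast]
    · intro hn h0
      refine mem_roots_of_weight h0 (χ := (1 : ℤ) • (χ : _ → ℂ) + ψ) (fun h => ?_)
        ((LieAlgebra.IsKilling.rootSpace_zsmul_add_ne_bot_iff χ ψ hχ0 1).2 ⟨by omega, by omega⟩)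
      simp [hχ, hψ]

theorem finrank_rootSpace_eq_one {α : Module.Dual ℂ H} (hα : α ∈ roots H) :
    Module.finrank ℂ (rootSpace H α) = 1 := by
  obtain ⟨χ, hχ0, hχ⟩ := exists_weight_of_mem_roots hα
  rw [← LieAlgebra.IsKilling.finrank_rootSpace_eq_one χ hχ0]
  let g : rootSpace H α →ₗ[ℂ] rootSpace (H.map (quotCenter L)) χ :=
    { toFun := fun x => ⟨quotCenter L x, quotCenter_mem_rootSpace hχ x.2⟩
      map_add' := fun x y => Subtype.ext (map_add (quotCenter L) _ _)
      map_smul' := fun c x => Subtype.ext (map_smul (quotCenter L) c _) }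
  refine LinearEquiv.finrank_eq (LinearEquiv.ofBijective g ⟨?_, ?_⟩)
  · rw [injective_iff_map_eq_zero]
    intro x hx
    apply Subtype.ext
    exact eq_zero_of_mem_center_of_mem_rootSpace hα.1
      (quotCenter_eq_zero.1 (congrArg Subtype.val hx)) x.2
  · rintro ⟨y, hy⟩
    obtain ⟨x, hx, rfl⟩ := exists_mem_rootSpace_quotCenter_eq hα.1 hχ hy
    exact ⟨⟨x, hx⟩, rfl⟩

/-- The `χ`-string through `ψ` is an irreducible `sl₂`-module with highest weight vector `v`. Up to
scalars `y` is `f ^ k v`, where `k ≥ 1` is the distance from the top, and `e` maps it to a non-zero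
multiple of `f ^ (k - 1) v`. -/
theorem _root_.LieAlgebra.IsKilling.lie_ne_zero_of_rootSpace_add_ne_bot
    {M : Type*} [LieRing M] [LieAlgebra ℂ M] [LieAlgebra.IsKilling ℂ M] [FiniteDimensional ℂ M]
    {T : LieSubalgebra ℂ M} [T.IsCartanSubalgebra] {χ ψ : Weight ℂ T M} (hχ : χ.IsNonZero)
    (hψ : ψ.IsNonZero)
    (hb : rootSpace T ((χ : T → ℂ) + ψ) ≠ ⊥) {x y : M} (hx : x ∈ rootSpace T χ)
    (hy : y ∈ rootSpace T ψ) (hx0 : x ≠ 0) (hy0 : y ≠ 0) : ⁅x, y⁆ ≠ 0 := by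
  obtain ⟨h, e, f, ht, he, hf⟩ :=
    LieAlgebra.IsKilling.exists_isSl2Triple_of_weight_isNonZero hχ
  have hco := ht.h_eq_coroot hχ he hf
  subst hco
  obtain ⟨c, rfl⟩ : ∃ c : ℂ, c • e = x := by
    simpa using (finrank_eq_one_iff_of_nonzero' (⟨e, he⟩ : rootSpace T χ)
      (by simpa using ht.e_ne_zero)).mp
      (LieAlgebra.IsKilling.finrank_rootSpace_eq_one _ hχ) ⟨x, hx⟩
  have hc0 : c ≠ 0 := fun h => hx0 (by simp [h])
  rw [smul_lie]
  refine smul_ne_zero hc0 ?_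
  obtain ⟨v, hv, hv0⟩ := (chainTop χ ψ).exists_ne_zero
  set k := chainTopCoeff χ ψ with hk
  have hk1 : 1 ≤ k := by
    have := ((LieAlgebra.IsKilling.rootSpace_zsmul_add_ne_bot_iff χ ψ hχ 1).1
      (by simpa using hb)).1
    exact_mod_cast this
  have prim : ht.HasPrimitiveVectorWith v (LieAlgebra.IsKilling.chainLength χ ψ : ℂ) :=
    have := lie_mem_genWeightSpace_of_mem_genWeightSpace he hv
    ⟨hv0, (LieAlgebra.IsKilling.chainLength_smul _ _ hv).symm, by
      rwa [genWeightSpace_add_chainTop _ _ hχ] at this⟩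
  have hlen := LieAlgebra.IsKilling.chainTopCoeff_le_chainLength χ ψ
  have hw0 := prim.pow_toEnd_f_ne_zero_of_eq_nat rfl hlen
  have hw : ((toEnd ℂ M M f) ^ k) v ∈ rootSpace T ψ := by
    have := toEnd_pow_apply_mem hf hv k
    convert this using 2
    rw [coe_chainTop']
    simp [hk]
  obtain ⟨d, hd⟩ : ∃ d : ℂ, d • ((toEnd ℂ M M f) ^ k) v = y := by
    simpa using (finrank_eq_one_iff_of_nonzero' (⟨_, hw⟩ : rootSpace T ψ)
      (by simpa using hw0)).mp
      (LieAlgebra.IsKilling.finrank_rootSpace_eq_one _ hψ) ⟨y, hy⟩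
  have hd0 : d ≠ 0 := fun h => hy0 (by rw [← hd, h, zero_smul])
  rw [← hd, lie_smul]
  refine smul_ne_zero hd0 ?_
  obtain ⟨j, hj⟩ : ∃ j, k = j + 1 := ⟨k - 1, by omega⟩
  rw [hj, prim.lie_e_pow_succ_toEnd_f]
  refine smul_ne_zero (mul_ne_zero (by exact_mod_cast Nat.succ_ne_zero j) ?_)
    (prim.pow_toEnd_f_ne_zero_of_eq_nat rfl (by omega))
  rw [sub_ne_zero]
  have : j < LieAlgebra.IsKilling.chainLength χ ψ := by omega
  exact_mod_cast this.ne'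

theorem lie_ne_zero {α β : Module.Dual ℂ H} (hα : α ∈ roots H) (hβ : β ∈ roots H)
    (hαβ : α + β ∈ roots H) {x y : L} (hx : x ∈ rootSpace H α) (hy : y ∈ rootSpace H β)
    (hx0 : x ≠ 0) (hy0 : y ≠ 0) : ⁅x, y⁆ ≠ 0 := by
  obtain ⟨χ, hχ0, hχ⟩ := exists_weight_of_mem_roots hα
  obtain ⟨ψ, hψ0, hψ⟩ := exists_weight_of_mem_roots hβ
  obtain ⟨φ, -, hφ⟩ := exists_weight_of_mem_roots hαβ
  have hfun : (χ : _ → ℂ) + ψ = φ := by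
    ext y
    obtain ⟨h, rfl⟩ := cartanMap_surjective H y
    rw [Pi.add_apply, hχ, hψ, hφ, LinearMap.add_apply]
  have := LieAlgebra.IsKilling.lie_ne_zero_of_rootSpace_add_ne_bot hχ0 hψ0
    (by rw [hfun]; exact φ.2) (quotCenter_mem_rootSpace hχ hx) (quotCenter_mem_rootSpace hψ hy)
    (fun h => hx0 (eq_zero_of_mem_center_of_mem_rootSpace hα.1 (quotCenter_eq_zero.1 h) hx))
    (fun h => hy0 (eq_zero_of_mem_center_of_mem_rootSpace hβ.1 (quotCenter_eq_zero.1 h) hy))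
  rw [← LieHom.map_lie] at this
  exact fun h => this (by rw [h, map_zero])

theorem neg_mem_roots {α : Module.Dual ℂ H} (hα : α ∈ roots H) : -α ∈ roots H := by
  obtain ⟨h, e, f, -, hf, hef, h2, -⟩ := exists_coroot hα
  refine mem_roots_of_mem_rootSpace (neg_ne_zero.2 hα.1) hf ?_
  rintro rfl
  rw [lie_zero] at hef
  have : h = 0 := Subtype.ext hef.symm
  rw [this, map_zero] at h2
  norm_num at h2

end Transport

/-! ### Root space decomposition of `H`-stable subspaces, coroots, and the Killing form on `H`. -/

section Toolkit

variable {L : Type*} [LieRing L] [LieAlgebra ℂ L] {H : LieSubalgebra ℂ L}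

theorem rootSum_le [LieRing.IsNilpotent H] {S : Set (Module.Dual ℂ H)} {W : Submodule ℂ L} :
    rootSum H S ≤ W ↔ ∀ α ∈ S, (rootSpace H α).toSubmodule ≤ W :=
  iSup₂_le_iff

theorem rootSpace_le_rootSum [LieRing.IsNilpotent H] {S : Set (Module.Dual ℂ H)}
    {α : Module.Dual ℂ H} (hα : α ∈ S) : (rootSpace H α).toSubmodule ≤ rootSum H S :=
  rootSum_le.1 le_rfl α hα

theorem rootSum_mono [LieRing.IsNilpotent H] {S T : Set (Module.Dual ℂ H)} (h : S ⊆ T) :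
    rootSum H S ≤ rootSum H T :=
  rootSum_le.2 fun _ hα => rootSpace_le_rootSum (h hα)

variable [H.IsCartanSubalgebra]

theorem finite_roots [FiniteDimensional ℂ L] : (roots H).Finite := by
  have h := finite_genWeightSpace_ne_bot ℂ H L
  refine Set.Finite.of_finite_image (f := fun α : Module.Dual ℂ H => (α : H → ℂ))
    (h.subset ?_) (DFunLike.coe_injective.injOn)
  rintro _ ⟨α, hα, rfl⟩
  exact hα.2

theorem cartan_le_rootSpace_zero [FiniteDimensional ℂ L] :
    H.toSubmodule = (rootSpace H (0 : H → ℂ)).toSubmodule := by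
  rw [rootSpace_zero_eq]
  rfl

theorem disjoint_rootSpace_sup [FiniteDimensional ℂ L] {α : Module.Dual ℂ H}
    (hα : α ≠ 0) {A : Set (Module.Dual ℂ H)} (hA : α ∉ A) :
    Disjoint (rootSpace H α).toSubmodule (H.toSubmodule ⊔ rootSum H A) := by
  have h := (iSupIndep_genWeightSpace ℂ H L) (α : H → ℂ)
  rw [← LieSubmodule.disjoint_toSubmodule] at h
  refine h.mono_right ?_
  simp only [LieSubmodule.iSup_toSubmodule]
  refine sup_le ?_ (rootSum_le.2 fun β hβ => ?_)
  · rw [cartan_le_rootSpace_zero]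
    refine le_iSup₂_of_le (0 : H → ℂ) ?_ le_rfl
    intro h0
    exact hα (LinearMap.ext fun x => (congrFun h0 x).symm)
  · refine le_iSup₂_of_le (β : H → ℂ) ?_ le_rfl
    intro h0
    exact hA (DFunLike.coe_injective h0 ▸ hβ)

theorem mem_of_rootSpace_le_sup [FiniteDimensional ℂ L] {α : Module.Dual ℂ H}
    (hα : α ∈ roots H) {A : Set (Module.Dual ℂ H)}
    (h : (rootSpace H α).toSubmodule ≤ H.toSubmodule ⊔ rootSum H A) : α ∈ A := by
  by_contra hA
  have := (disjoint_rootSpace_sup hα.1 hA).eq_bot_of_le h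
  exact hα.2 (LieSubmodule.toSubmodule_injective this)

theorem disjoint_cartan_rootSum [FiniteDimensional ℂ L] {A : Set (Module.Dual ℂ H)}
    (hA : A ⊆ roots H) : Disjoint H.toSubmodule (rootSum H A) := by
  have h := (iSupIndep_genWeightSpace ℂ H L) (0 : H → ℂ)
  rw [← LieSubmodule.disjoint_toSubmodule] at h
  rw [cartan_le_rootSpace_zero]
  refine h.mono_right ?_
  simp only [LieSubmodule.iSup_toSubmodule]
  refine rootSum_le.2 fun β hβ => le_iSup₂_of_le (β : H → ℂ) ?_ le_rfl
  intro h0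
  exact (hA hβ).1 (DFunLike.coe_injective h0)

theorem mem_of_mem_cartan_of_mem_sup [FiniteDimensional ℂ L] {A : Set (Module.Dual ℂ H)}
    (hA : A ⊆ roots H) {U : Submodule ℂ L} (hU : U ≤ H.toSubmodule) {x : L} (hx : x ∈ H)
    (h : x ∈ U ⊔ rootSum H A) : x ∈ U := by
  obtain ⟨u, hu, r, hr, rfl⟩ := Submodule.mem_sup.1 h
  have hrH : r ∈ H.toSubmodule := by
    have := H.toSubmodule.sub_mem hx (hU hu)
    simpa using this
  have : r = 0 := (Submodule.disjoint_def.1 (disjoint_cartan_rootSum hA)) r hrH hr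
  rwa [this, add_zero]

theorem lie_mem_rootSpace_add {α β : Module.Dual ℂ H} {x y : L} (hx : x ∈ rootSpace H α)
    (hy : y ∈ rootSpace H β) : ⁅x, y⁆ ∈ rootSpace H (α + β : Module.Dual ℂ H) :=
  LieAlgebra.lie_mem_genWeightSpace_of_mem_genWeightSpace hx hy

theorem lie_mem_cartan [FiniteDimensional ℂ L] {α : Module.Dual ℂ H} {x y : L}
    (hx : x ∈ rootSpace H α) (hy : y ∈ rootSpace H (-α : Module.Dual ℂ H)) : ⁅x, y⁆ ∈ H := by
  have h1 := lie_mem_rootSpace_add hx hy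
  rw [add_neg_cancel] at h1
  change ⁅x, y⁆ ∈ rootSpace H (0 : H → ℂ) at h1
  rwa [rootSpace_zero_eq] at h1

theorem lie_eq_zero_of_notMem_roots {α β : Module.Dual ℂ H} (h : α + β ∉ roots H)
    (h0 : α + β ≠ 0) {x y : L} (hx : x ∈ rootSpace H α) (hy : y ∈ rootSpace H β) :
    ⁅x, y⁆ = 0 := by
  by_contra hne
  exact h (mem_roots_of_mem_rootSpace h0 (lie_mem_rootSpace_add hx hy) hne)

theorem exists_ne_zero_of_mem_roots {α : Module.Dual ℂ H} (hα : α ∈ roots H) :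
    ∃ e ∈ rootSpace H α, e ≠ 0 :=
  Submodule.exists_mem_ne_zero_of_ne_bot
    (fun h => hα.2 (LieSubmodule.toSubmodule_injective h))

theorem killingForm_eq_sum [FiniteDimensional ℂ L] (x y : H) :
    killingForm ℂ L x y = ∑ χ : Weight ℂ H L,
      (Module.finrank ℂ (genWeightSpace L χ) : ℂ) * (χ x * χ y) := by
  have h := LinearMap.congr_fun₂ (traceForm_eq_sum_finrank_nsmul ℂ H L) x y
  simp only [LinearMap.sum_apply, LinearMap.smul_apply, nsmul_eq_mul] at h
  refine Eq.trans ?_ (h.trans ?_)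
  · rfl
  · simp

theorem weight_eq_zero_or_mem_roots [FiniteDimensional ℂ L] (χ : Weight ℂ H L) :
    (χ : Module.Dual ℂ H) = 0 ∨ (χ : Module.Dual ℂ H) ∈ roots H := by
  by_cases h : (χ : Module.Dual ℂ H) = 0
  · exact Or.inl h
  · exact Or.inr ⟨h, χ.2⟩

/-- A substitute for positive definiteness on a real form: if `x'` has the conjugate weight values
of `x`, the Killing form at `(x, x')` is the sum of `dim · |χ(x)|²` over all weights. -/
theorem weight_apply_eq_zero_of_killingForm_conj_eq_zero [FiniteDimensional ℂ L] {x x' : H}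
    (hc : ∀ χ : Weight ℂ H L, χ x' = starRingEnd ℂ (χ x))
    (h : killingForm ℂ L (x : L) x' = 0) (χ : Weight ℂ H L) : χ x = 0 := by
  rw [killingForm_eq_sum] at h
  simp only [hc, Complex.mul_conj] at h
  have h' : ∑ χ : Weight ℂ H L,
      (Module.finrank ℂ (genWeightSpace L χ) : ℝ) * Complex.normSq (χ x) = 0 := by
    exact_mod_cast h
  rw [Finset.sum_eq_zero_iff_of_nonneg
    (fun ψ _ => mul_nonneg (Nat.cast_nonneg _) (Complex.normSq_nonneg _))] at h'
  have h1 := h' χ (Finset.mem_univ _)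
  have h2 : 0 < Module.finrank ℂ (genWeightSpace L χ) := by
    rw [Module.finrank_pos_iff, LieSubmodule.nontrivial_iff_ne_bot]
    exact χ.2
  have h3 : (Module.finrank ℂ (genWeightSpace L χ) : ℝ) ≠ 0 := by exact_mod_cast h2.ne'
  exact Complex.normSq_eq_zero.1 ((mul_eq_zero.1 h1).resolve_left h3)

variable [FiniteDimensional ℂ L] [LieAlgebra.HasCentralRadical ℂ L]

theorem exists_smul_eq_of_mem_rootSpace {α : Module.Dual ℂ H} (hα : α ∈ roots H) {e x : L}
    (he : e ∈ rootSpace H α) (he0 : e ≠ 0) (hx : x ∈ rootSpace H α) : ∃ c : ℂ, c • e = x := by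
  obtain ⟨c, hc⟩ := (finrank_eq_one_iff_of_nonzero' (⟨e, he⟩ : rootSpace H α)
    (fun h => he0 (congrArg Subtype.val h))).mp (finrank_rootSpace_eq_one hα) ⟨x, hx⟩
  exact ⟨c, congrArg Subtype.val hc⟩

theorem rootSpace_le_of_mem {α : Module.Dual ℂ H} (hα : α ≠ 0) {W : Submodule ℂ L} {e : L}
    (he : e ∈ rootSpace H α) (he0 : e ≠ 0) (heW : e ∈ W) :
    (rootSpace H α).toSubmodule ≤ W := by
  intro x hx
  obtain ⟨c, rfl⟩ := exists_smul_eq_of_mem_rootSpace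
    (mem_roots_of_mem_rootSpace hα he he0) he he0 hx
  exact W.smul_mem c heW

/-- A subspace stable under the Cartan subalgebra is the sum of its part in the Cartan subalgebra
and the root spaces that it contains. -/
theorem le_cartan_sup_rootSum {W : Submodule ℂ L} (hW : ∀ h ∈ H, ∀ x ∈ W, ⁅h, x⁆ ∈ W) :
    W ≤ (W ⊓ H.toSubmodule) ⊔ rootSum H {α ∈ roots H | (rootSpace H α).toSubmodule ≤ W} := by
  let N : LieSubmodule ℂ H L := { W with lie_mem := fun {h x} hx => hW h h.2 x hx }
  have hN := eq_iSup_inf_genWeightSpace (K := ℂ) (L := H) (M := L) N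
  have hWN : W = N.toSubmodule := rfl
  conv_lhs => rw [hWN, hN]
  simp only [LieSubmodule.iSup_toSubmodule, LieSubmodule.inf_toSubmodule]
  refine iSup_le fun χ => ?_
  by_cases h0 : (χ : Module.Dual ℂ H) = 0
  · refine le_sup_of_le_left (inf_le_inf_left _ ?_)
    rw [cartan_le_rootSpace_zero]
    have : (χ : H → ℂ) = 0 := by
      ext x
      exact LinearMap.congr_fun h0 x
    rw [this]
  · rintro x ⟨hxW, hx⟩
    by_cases hx0 : x = 0
    · rw [hx0]; exact zero_mem _
    · have hx' : x ∈ rootSpace H (χ : Module.Dual ℂ H) := hx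
      exact Submodule.mem_sup_right (rootSpace_le_rootSum
        (⟨mem_roots_of_mem_rootSpace h0 hx' hx0, rootSpace_le_of_mem h0 hx' hx0 hxW⟩ :
          (χ : Module.Dual ℂ H) ∈ {α ∈ roots H | (rootSpace H α).toSubmodule ≤ W}) hx')

theorem top_le_cartan_sup_rootSum : (⊤ : Submodule ℂ L) ≤ H.toSubmodule ⊔ rootSum H (roots H) := by
  refine (le_cartan_sup_rootSum (H := H) (W := ⊤) (by simp)).trans
    (sup_le_sup inf_le_right (rootSum_mono (Set.sep_subset _ _)))

theorem mem_center_of_forall_roots {x : H} (hx : ∀ α ∈ roots H, α x = 0) :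
    (x : L) ∈ center ℂ L := by
  have key : (⊤ : Submodule ℂ L) ≤ LinearMap.ker (ad ℂ L (x : L)) := by
    refine (top_le_cartan_sup_rootSum (H := H)).trans (sup_le ?_ (rootSum_le.2 fun α hα => ?_))
    · intro y hy
      exact lie_cartan_eq_zero H x.2 hy
    · intro y hy
      change ⁅(x : L), y⁆ = 0
      rw [lie_eq_smul_of_mem_rootSpace hα.1 hy, hx α hα, zero_smul]
  intro y
  have : ⁅(x : L), y⁆ = 0 := key (x := y) trivial
  rw [← lie_skew, this, neg_zero]

open Classical in
/-- The coroot of a root. -/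
noncomputable def coroot (α : Module.Dual ℂ H) : H :=
  if hα : α ∈ roots H then (exists_coroot hα).choose else 0

theorem coroot_spec {α : Module.Dual ℂ H} (hα : α ∈ roots H) :
    ∃ (e f : L), e ∈ rootSpace H α ∧ f ∈ rootSpace H (-α : Module.Dual ℂ H) ∧
      ⁅e, f⁆ = (coroot α : L) ∧ α (coroot α) = 2 ∧
      ∀ β ∈ roots H, ∃ n : ℤ, β (coroot α) = n ∧
        (n < 0 → α + β ≠ 0 → α + β ∈ roots H) := by
  rw [coroot, dif_pos hα]
  exact (exists_coroot hα).choose_spec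

theorem root_apply_coroot {α : Module.Dual ℂ H} (hα : α ∈ roots H) : α (coroot α) = 2 := by
  obtain ⟨e, f, -, -, -, h, -⟩ := coroot_spec hα
  exact h

theorem exists_int_eq_apply_coroot {α β : Module.Dual ℂ H} (hα : α ∈ roots H)
    (hβ : β ∈ roots H) : ∃ n : ℤ, β (coroot α) = n := by
  obtain ⟨e, f, -, -, -, -, h⟩ := coroot_spec hα
  obtain ⟨n, hn, -⟩ := h β hβ
  exact ⟨n, hn⟩

theorem add_mem_roots {α β : Module.Dual ℂ H} (hα : α ∈ roots H) (hβ : β ∈ roots H)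
    (hneg : (β (coroot α)).re < 0) (h0 : α + β ≠ 0) : α + β ∈ roots H := by
  obtain ⟨e, f, -, -, -, -, h⟩ := coroot_spec hα
  obtain ⟨n, hn, h⟩ := h β hβ
  rw [hn] at hneg
  exact h (by exact_mod_cast hneg) h0

theorem exists_isSl2Triple {α : Module.Dual ℂ H} (hα : α ∈ roots H) :
    ∃ (e f : L), e ∈ rootSpace H α ∧ f ∈ rootSpace H (-α : Module.Dual ℂ H) ∧
      ⁅e, f⁆ = (coroot α : L) ∧ IsSl2Triple (coroot α : L) e f := by
  obtain ⟨e, f, he, hf, hef, h2, -⟩ := coroot_spec hα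
  refine ⟨e, f, he, hf, hef, ?_, hef, ?_, ?_⟩
  · intro h0
    have : coroot α = 0 := Subtype.ext h0
    rw [this, map_zero] at h2
    norm_num at h2
  · rw [lie_eq_smul_of_mem_rootSpace hα.1 he, h2, ofNat_smul_eq_nsmul]
  · rw [lie_eq_smul_of_mem_rootSpace (neg_ne_zero.2 hα.1) hf, LinearMap.neg_apply, h2, neg_smul,
      ofNat_smul_eq_nsmul]

theorem coroot_mem_derived {α : Module.Dual ℂ H} (hα : α ∈ roots H) :
    (coroot α : L) ∈ derived (⊤ : Submodule ℂ L) := by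
  obtain ⟨e, f, -, -, hef, -⟩ := coroot_spec hα
  rw [← hef]
  exact lie_mem_derived_top e f

theorem exists_smul_coroot_eq_lie {α : Module.Dual ℂ H} (hα : α ∈ roots H) {x y : L}
    (hx : x ∈ rootSpace H α) (hy : y ∈ rootSpace H (-α : Module.Dual ℂ H)) :
    ∃ c : ℂ, ⁅x, y⁆ = c • (coroot α : L) := by
  obtain ⟨e, f, he, hf, hef, ht⟩ := exists_isSl2Triple hα
  obtain ⟨c, rfl⟩ := exists_smul_eq_of_mem_rootSpace hα he ht.e_ne_zero hx
  obtain ⟨d, rfl⟩ := exists_smul_eq_of_mem_rootSpace (neg_mem_roots hα) hf ht.f_ne_zero hy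
  exact ⟨c * d, by rw [smul_lie, lie_smul, hef, smul_smul]⟩

theorem coroot_mem_of_mem {α : Module.Dual ℂ H} (hα : α ∈ roots H) {s : LieSubalgebra ℂ L}
    (h1 : (rootSpace H α).toSubmodule ≤ s.toSubmodule)
    (h2 : (rootSpace H (-α : Module.Dual ℂ H)).toSubmodule ≤ s.toSubmodule) :
    (coroot α : L) ∈ s := by
  obtain ⟨e, f, he, hf, hef, -⟩ := coroot_spec hα
  rw [← hef]
  exact s.lie_mem (h1 he) (h2 hf)

theorem not_isSolvable_of_rootSpace_le {α : Module.Dual ℂ H} (hα : α ∈ roots H)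
    {s : LieSubalgebra ℂ L} (h1 : (rootSpace H α).toSubmodule ≤ s.toSubmodule)
    (h2 : (rootSpace H (-α : Module.Dual ℂ H)).toSubmodule ≤ s.toSubmodule) :
    ¬ LieAlgebra.IsSolvable s := by
  obtain ⟨e, f, he, hf, hef, ht⟩ := exists_isSl2Triple hα
  have hc := coroot_mem_of_mem hα h1 h2
  have : IsSl2Triple (⟨coroot α, hc⟩ : s) ⟨e, h1 he⟩ ⟨f, h2 hf⟩ :=
    { h_ne_zero := fun h => ht.h_ne_zero (congrArg Subtype.val h)
      lie_e_f := Subtype.ext ht.lie_e_f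
      lie_h_e_nsmul := Subtype.ext ht.lie_h_e_nsmul
      lie_h_f_nsmul := Subtype.ext ht.lie_h_f_nsmul }
  exact not_isSolvable_of_isSl2Triple this

/-! ### Positivity of the trace form -/

theorem exists_real_eq_weight_apply_coroot {α : Module.Dual ℂ H} (hα : α ∈ roots H)
    (χ : Weight ℂ H L) : ∃ r : ℝ, χ (coroot α) = r := by
  rcases weight_eq_zero_or_mem_roots χ with h | h
  · exact ⟨0, by simpa using LinearMap.congr_fun h (coroot α)⟩
  · obtain ⟨n, hn⟩ := exists_int_eq_apply_coroot hα h
    exact ⟨n, by simpa using hn⟩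

/-- By invariance, pairing with `⁅e, f⁆` gives `κ(e, f) α(y)`. At `y = coroot α` this is a sum of
squares of real numbers that includes `α (coroot α) = 2`, so `κ(e, f)` is half of a positive number.
-/
theorem exists_killingForm_coroot {α : Module.Dual ℂ H} (hα : α ∈ roots H) :
    ∃ c : ℝ, 0 < c ∧ ∀ y : H, killingForm ℂ L (coroot α : L) y = c * α y := by
  obtain ⟨e, f, he, hf, hef, ht⟩ := exists_isSl2Triple hα
  have h1 : ∀ y : H, killingForm ℂ L (coroot α : L) y = killingForm ℂ L e f * α y := by
    intro y
    have h2 : ⁅f, (y : L)⁆ = α y • f := by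
      rw [← lie_skew, lie_eq_smul_of_mem_rootSpace (neg_ne_zero.2 hα.1) hf, LinearMap.neg_apply,
        neg_smul, neg_neg]
    rw [← hef]
    exact (LieModule.traceForm_apply_lie_apply ℂ L L e f y).trans
      (by rw [h2, map_smul, smul_eq_mul, mul_comm])
  choose r hr using exists_real_eq_weight_apply_coroot hα
  have h3 := h1 (coroot α)
  rw [killingForm_eq_sum, root_apply_coroot hα] at h3
  simp only [hr] at h3
  set s : ℝ := ∑ χ : Weight ℂ H L, (Module.finrank ℂ (genWeightSpace L χ) : ℝ) * (r χ * r χ)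
    with hs
  have h4 : ((s : ℝ) : ℂ) = killingForm ℂ L e f * 2 := by
    rw [← h3, hs]; push_cast; rfl
  have hpos : 0 < s := by
    let χ : Weight ℂ H L := ⟨α, hα.2⟩
    have hχ : r χ = 2 := by
      have h5 : χ (coroot α) = 2 := root_apply_coroot hα
      rw [hr χ] at h5
      exact_mod_cast h5
    refine Finset.sum_pos' (fun ψ _ => mul_nonneg (Nat.cast_nonneg _) (mul_self_nonneg _))
      ⟨χ, Finset.mem_univ _, ?_⟩
    rw [hχ]
    have : 0 < Module.finrank ℂ (genWeightSpace L χ) := by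
      have := finrank_rootSpace_eq_one hα
      change Module.finrank ℂ (genWeightSpace L χ) = 1 at this
      omega
    positivity
  refine ⟨s / 2, by positivity, fun y => ?_⟩
  rw [h1 y]
  congr 1
  push_cast
  rw [h4]
  ring

/-- The span of the coroots of the roots in `S`. -/
noncomputable def corootSpan (S : Set (Module.Dual ℂ H)) : Submodule ℂ H :=
  Submodule.span ℂ (coroot '' S)

theorem coroot_mem_corootSpan {S : Set (Module.Dual ℂ H)} {α : Module.Dual ℂ H} (hα : α ∈ S) :
    coroot α ∈ corootSpan S :=
  Submodule.subset_span ⟨α, hα, rfl⟩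

theorem exists_conj_mem_corootSpan {S : Set (Module.Dual ℂ H)} (hS : S ⊆ roots H) {x : H}
    (hx : x ∈ corootSpan S) :
    ∃ x' ∈ corootSpan S, ∀ χ : Weight ℂ H L, χ x' = starRingEnd ℂ (χ x) := by
  induction hx using Submodule.span_induction with
  | mem x hx =>
    obtain ⟨α, hα, rfl⟩ := hx
    refine ⟨coroot α, coroot_mem_corootSpan hα, fun χ => ?_⟩
    obtain ⟨r, hr⟩ := exists_real_eq_weight_apply_coroot (hS hα) χ
    rw [hr, Complex.conj_ofReal]
  | zero => exact ⟨0, zero_mem _, fun χ => by simp⟩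
  | add a b _ _ ha hb =>
    obtain ⟨a', ha', ha⟩ := ha
    obtain ⟨b', hb', hb⟩ := hb
    exact ⟨a' + b', add_mem ha' hb', fun χ => by rw [map_add, ha, hb, map_add, map_add]⟩
  | smul c a _ ha =>
    obtain ⟨a', ha', ha⟩ := ha
    exact ⟨starRingEnd ℂ c • a', Submodule.smul_mem _ _ ha', fun χ => by
      rw [map_smul, ha, map_smul, smul_eq_mul, smul_eq_mul, map_mul]⟩

theorem exists_corootSpan_of_mem_span {S : Set (Module.Dual ℂ H)} (hS : S ⊆ roots H)
    {v : Module.Dual ℂ H} (hv : v ∈ Submodule.span ℂ S) :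
    ∃ t ∈ corootSpan S, ∀ y : H, killingForm ℂ L (t : L) y = v y := by
  induction hv using Submodule.span_induction with
  | mem α hα =>
    obtain ⟨c, hc, h⟩ := exists_killingForm_coroot (hS hα)
    refine ⟨(c : ℂ)⁻¹ • coroot α, Submodule.smul_mem _ _ (coroot_mem_corootSpan hα), fun y => ?_⟩
    have hc' : (c : ℂ) ≠ 0 := by exact_mod_cast hc.ne'
    change killingForm ℂ L ((c : ℂ)⁻¹ • (coroot α : L)) y = α y
    rw [map_smul, LinearMap.smul_apply, h, smul_eq_mul, ← mul_assoc, inv_mul_cancel₀ hc', one_mul]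
  | zero => exact ⟨0, zero_mem _, fun y => by simp⟩
  | add a b _ _ ha hb =>
    obtain ⟨a', ha', ha⟩ := ha
    obtain ⟨b', hb', hb⟩ := hb
    refine ⟨a' + b', add_mem ha' hb', fun y => ?_⟩
    change killingForm ℂ L ((a' : L) + b') y = _
    rw [map_add, LinearMap.add_apply, ha, hb, LinearMap.add_apply]
  | smul c a _ ha =>
    obtain ⟨a', ha', ha⟩ := ha
    refine ⟨c • a', Submodule.smul_mem _ _ ha', fun y => ?_⟩
    change killingForm ℂ L (c • (a' : L)) y = _
    rw [map_smul, LinearMap.smul_apply, ha, LinearMap.smul_apply]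

/-- Let `t` in the coroot span represent `v` through the Killing form. Its conjugate `t'` is again
in the coroot span, so `κ(t, t') = v(t') = 0`, and positivity makes every weight vanish on `t`. -/
theorem eq_zero_of_mem_span_of_apply_coroot {S : Set (Module.Dual ℂ H)} (hS : S ⊆ roots H)
    {v : Module.Dual ℂ H} (hv : v ∈ Submodule.span ℂ S) (h0 : ∀ α ∈ S, v (coroot α) = 0) :
    v = 0 := by
  obtain ⟨t, ht, htv⟩ := exists_corootSpan_of_mem_span hS hv
  obtain ⟨t', ht', hc⟩ := exists_conj_mem_corootSpan hS ht
  have hvt' : v t' = 0 := by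
    have : corootSpan S ≤ LinearMap.ker v := Submodule.span_le.2 (by
      rintro _ ⟨α, hα, rfl⟩
      exact h0 α hα)
    exact this ht'
  have hz := weight_apply_eq_zero_of_killingForm_conj_eq_zero hc (by rw [htv, hvt'])
  ext y
  rw [← htv, killingForm_eq_sum]
  simp [hz]

theorem eq_zero_of_mem_corootSpan {S : Set (Module.Dual ℂ H)} (hS : S ⊆ roots H) {x : H}
    (hx : x ∈ corootSpan S) (h0 : ∀ α ∈ S, α x = 0) : x = 0 := by
  obtain ⟨x', hx', hc⟩ := exists_conj_mem_corootSpan hS hx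
  have hk : killingForm ℂ L (x' : L) x = 0 := by
    have : corootSpan S ≤ LinearMap.ker
        ((killingForm ℂ L).flip (x : L) ∘ₗ H.toSubmodule.subtype) := Submodule.span_le.2 (by
      rintro _ ⟨α, hα, rfl⟩
      obtain ⟨c, -, h⟩ := exists_killingForm_coroot (hS hα)
      change killingForm ℂ L (coroot α : L) x = 0
      rw [h, h0 α hα, mul_zero])
    exact this hx'
  have hz := weight_apply_eq_zero_of_killingForm_conj_eq_zero hc
    (by rw [LieModule.traceForm_comm]; exact hk)
  apply Subtype.ext
  refine eq_zero_of_mem_center_of_mem_derived (mem_center_of_forall_roots fun α hα => ?_) ?_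
  · exact hz ⟨α, hα.2⟩
  · have : corootSpan S ≤ (derived (⊤ : Submodule ℂ L)).comap H.toSubmodule.subtype :=
      Submodule.span_le.2 (by
        rintro _ ⟨α, hα, rfl⟩
        exact coroot_mem_derived (hS hα))
    exact this hx

/-- The pairing between the span of `S` and the span of its coroots is non-degenerate on both sides.
The dimensions therefore agree, and every functional on the span of `S`, in particular evaluation at
`x`, comes from a coroot combination. -/
theorem exists_corootSpan_sub_mem_ker {S : Set (Module.Dual ℂ H)} (hS : S ⊆ roots H) (x : H) :
    ∃ u ∈ corootSpan S, ∀ α ∈ S, α (x - u) = 0 := by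
  let U := corootSpan S
  let V := Submodule.span ℂ S
  let Φ : U →ₗ[ℂ] Module.Dual ℂ V :=
    (V.subtype.dualMap ∘ₗ Module.Dual.eval ℂ H) ∘ₗ U.subtype
  let Ψ : V →ₗ[ℂ] Module.Dual ℂ U := U.subtype.dualMap ∘ₗ V.subtype
  have hΦ : Function.Injective Φ := by
    rw [injective_iff_map_eq_zero]
    intro u hu
    apply Subtype.ext
    exact eq_zero_of_mem_corootSpan hS u.2 fun α hα =>
      LinearMap.congr_fun hu ⟨α, Submodule.subset_span hα⟩
  have hΨ : Function.Injective Ψ := by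
    rw [injective_iff_map_eq_zero]
    intro v hv
    apply Subtype.ext
    exact eq_zero_of_mem_span_of_apply_coroot hS v.2 fun α hα =>
      LinearMap.congr_fun hv ⟨coroot α, coroot_mem_corootSpan hα⟩
  have h1 := LinearMap.finrank_le_finrank_of_injective hΦ
  have h2 := LinearMap.finrank_le_finrank_of_injective hΨ
  rw [Subspace.dual_finrank_eq] at h1 h2
  have hs : Function.Surjective Φ := by
    refine (LinearMap.injective_iff_surjective_of_finrank_eq_finrank ?_).1 hΦ
    rw [Subspace.dual_finrank_eq]
    exact le_antisymm h1 h2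
  obtain ⟨u, hu⟩ := hs (V.subtype.dualMap (Module.Dual.eval ℂ H x))
  refine ⟨u, u.2, fun α hα => ?_⟩
  have := LinearMap.congr_fun hu ⟨α, Submodule.subset_span hα⟩
  change α u = α x at this
  rw [map_sub, this, sub_self]

end Toolkit

/-! ### Linear inequalities over the rationals -/

/-- **Farkas' lemma** over the rationals. -/
theorem farkas {V ι : Type*} [AddCommGroup V] [Module ℚ V] (s : Finset ι)
    (a : ι → Module.Dual ℚ V) (b : Module.Dual ℚ V)
    (h : ∀ x, (∀ i ∈ s, a i x ≤ 0) → b x ≤ 0) :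
    ∃ c : ι → ℚ, (∀ i, 0 ≤ c i) ∧ b = ∑ i ∈ s, c i • a i := by
  classical
  induction s using Finset.induction_on generalizing a b with
  | empty =>
    refine ⟨0, fun _ => le_rfl, ?_⟩
    ext x
    have h1 := h x (by simp)
    have h2 := h (-x) (by simp)
    rw [map_neg] at h2
    simp only [Finset.sum_empty, LinearMap.zero_apply]
    linarith
  | insert j s hj ih =>
    -- If the inequality `a j x ≤ 0` is redundant, it gets coefficient zero. Otherwise some `x0`
    -- violates it, and `j` can be eliminated.
    by_cases hb : ∀ x, (∀ i ∈ s, a i x ≤ 0) → b x ≤ 0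
    · obtain ⟨c, hc, hbc⟩ := ih a b hb
      refine ⟨fun i => if i = j then 0 else c i, fun i => ?_, ?_⟩
      · dsimp only
        split_ifs
        · exact le_rfl
        · exact hc i
      · simp only [Finset.sum_insert hj, if_true, zero_smul, zero_add]
        rw [hbc]
        refine Finset.sum_congr rfl fun i hi => ?_
        rw [if_neg (by rintro rfl; exact hj hi)]
    · push Not at hb
      obtain ⟨x0, hx0, hbx0⟩ := hb
      have hj0 : 0 < a j x0 := by
        by_contra! hle
        refine absurd (h x0 fun i hi => ?_) (not_le.2 hbx0)
        rcases Finset.mem_insert.1 hi with rfl | hi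
        · exact hle
        · exact hx0 i hi
      set y : V := (a j x0)⁻¹ • x0 with hy
      have hjy : a j y = 1 := by
        rw [hy, map_smul, smul_eq_mul, inv_mul_cancel₀ hj0.ne']
      have hiy : ∀ i ∈ s, a i y ≤ 0 := fun i hi => by
        rw [hy, map_smul, smul_eq_mul]
        exact mul_nonpos_of_nonneg_of_nonpos (inv_nonneg.2 hj0.le) (hx0 i hi)
      have hby : 0 < b y := by
        rw [hy, map_smul, smul_eq_mul]
        positivity
      -- The induction hypothesis is applied after composing with the projection `x ↦ x - a j x • y`
      -- onto the kernel of `a j`.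
      obtain ⟨c, hc, hbc⟩ := ih (fun i => a i - a i y • a j) (b - b y • a j) (by
        intro x hx
        have h1 := h (x - a j x • y) (by
          intro i hi
          rcases Finset.mem_insert.1 hi with rfl | hi
          · rw [map_sub, map_smul, hjy, smul_eq_mul, mul_one, sub_self]
          · have := hx i hi
            simp only [LinearMap.sub_apply, LinearMap.smul_apply, smul_eq_mul, map_sub,
              map_smul] at this ⊢
            linarith)
        simp only [LinearMap.sub_apply, LinearMap.smul_apply, smul_eq_mul, map_sub,
          map_smul] at h1 ⊢
        linarith)
      have hk : 0 ≤ b y - ∑ i ∈ s, c i * a i y := by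
        have : ∑ i ∈ s, c i * a i y ≤ 0 :=
          Finset.sum_nonpos fun i hi => mul_nonpos_of_nonneg_of_nonpos (hc i) (hiy i hi)
        linarith
      refine ⟨fun i => if i = j then b y - ∑ i ∈ s, c i * a i y else c i, fun i => ?_, ?_⟩
      · dsimp only
        split_ifs
        · exact hk
        · exact hc i
      · simp only [Finset.sum_insert hj, if_true]
        have e1 : ∑ i ∈ s, (if i = j then b y - ∑ i ∈ s, c i * a i y else c i) • a i
            = ∑ i ∈ s, c i • a i :=
          Finset.sum_congr rfl fun i hi => by rw [if_neg (by rintro rfl; exact hj hi)]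
        rw [e1]
        refine (sub_eq_iff_eq_add.1 hbc).trans ?_
        ext x
        simp only [LinearMap.add_apply, LinearMap.sum_apply, LinearMap.smul_apply,
          LinearMap.sub_apply, smul_eq_mul, mul_sub, Finset.sum_sub_distrib, sub_mul,
          Finset.sum_mul, mul_assoc]
        ring

theorem cast_smul_mem_span {V : Type*} [AddCommGroup V] [Module ℂ V] [Module ℚ≥0 V]
    {S : Set V} {α : V} (hα : α ∈ S)
    {q : ℚ} (hq : 0 ≤ q) : (q : ℂ) • α ∈ Submodule.span ℚ≥0 S := by
  lift q to ℚ≥0 using hq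
  have : ((q : ℚ) : ℂ) • α = q • α := by
    rw [← NNRat.cast_smul_eq_nnqsmul ℂ]
    norm_cast
  rw [this]
  exact Submodule.smul_mem _ _ (Submodule.subset_span hα)

/-! ### Pointed cones of roots and their separation. -/

section Pointed

variable {L : Type*} [LieRing L] [LieAlgebra ℂ L] {H : LieSubalgebra ℂ L}
  [H.IsCartanSubalgebra] [FiniteDimensional ℂ L] [LieAlgebra.HasCentralRadical ℂ L]

/-- No non-empty sum of elements of a closed set of roots `P` with `P ∩ -P = ∅` vanishes. -/
theorem multiset_sum_ne_zero {P : Set (Module.Dual ℂ H)} (hP : P ⊆ roots H)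
    (hadd : ∀ α ∈ P, ∀ β ∈ P, α + β ∈ roots H → α + β ∈ P) (hneg : ∀ α ∈ P, -α ∉ P)
    (m : Multiset (Module.Dual ℂ H)) (hm : ∀ α ∈ m, α ∈ P) (h0 : m ≠ 0) : m.sum ≠ 0 := by
  induction hn : m.card using Nat.strong_induction_on generalizing m with
  | _ n ih =>
  intro hsum
  obtain ⟨α, hα⟩ := Multiset.exists_mem_of_ne_zero h0
  obtain ⟨m', rfl⟩ := Multiset.exists_cons_of_mem hα
  rw [Multiset.sum_cons] at hsum
  have hαP := hm α (Multiset.mem_cons_self _ _)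
  -- Evaluate the vanishing sum at `coroot α`. Since `α` contributes `2`, some other summand `β` is
  -- negative there; then `α + β` is a root, and replacing the two summands by it gives a shorter
  -- vanishing sum.
  obtain ⟨β, hβm, hβ⟩ : ∃ β ∈ m', (β (coroot α)).re < 0 := by
    by_contra! hc
    have h1 : (m'.sum (coroot α)).re = (m'.map fun β => (β (coroot α)).re).sum := by
      clear hc hm h0 hα hn hsum
      induction m' using Multiset.induction_on with
      | empty => simp
      | cons β m ih => simp [ih]
    have h2 : 0 ≤ (m'.map fun β => (β (coroot α)).re).sum := by
      refine Multiset.sum_nonneg fun x hx => ?_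
      obtain ⟨β, hβ, rfl⟩ := Multiset.mem_map.1 hx
      exact hc β hβ
    have h3 := congrArg Complex.re (LinearMap.congr_fun hsum (coroot α))
    rw [LinearMap.add_apply, root_apply_coroot (hP hαP), Complex.add_re, h1] at h3
    simp at h3
    linarith
  have hβP := hm β (Multiset.mem_cons_of_mem hβm)
  have hs0 : α + β ≠ 0 := fun h => hneg α hαP (neg_eq_of_add_eq_zero_right h ▸ hβP)
  have hab := hadd α hαP β hβP (add_mem_roots (hP hαP) (hP hβP) hβ hs0)
  obtain ⟨m, rfl⟩ := Multiset.exists_cons_of_mem hβm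
  refine ih _ ?_ ((α + β) ::ₘ m) ?_ (Multiset.cons_ne_zero) rfl ?_
  · rw [← hn]; simp
  · intro γ hγ
    rcases Multiset.mem_cons.1 hγ with rfl | hγ
    · exact hab
    · exact hm γ (Multiset.mem_cons_of_mem (Multiset.mem_cons_of_mem hγ))
  · rw [Multiset.sum_cons, ← hsum, Multiset.sum_cons, add_assoc]

/-- Clearing denominators makes the relation a vanishing sum of a multiset of elements of `P`. -/
theorem eq_zero_of_sum_smul_eq_zero {P : Set (Module.Dual ℂ H)} (hP : P ⊆ roots H)
    (hadd : ∀ α ∈ P, ∀ β ∈ P, α + β ∈ roots H → α + β ∈ P) (hneg : ∀ α ∈ P, -α ∉ P)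
    (F : Finset (Module.Dual ℂ H)) (hF : ∀ α ∈ F, α ∈ P) (c : Module.Dual ℂ H → ℚ)
    (hc : ∀ α, 0 ≤ c α) (hsum : ∑ α ∈ F, (c α : ℂ) • α = 0) : ∀ α ∈ F, c α = 0 := by
  classical
  set D : ℕ := ∏ α ∈ F, (c α).den with hD
  have hD0 : D ≠ 0 := Finset.prod_ne_zero_iff.2 fun α _ => (c α).den_nz
  have hn : ∀ α ∈ F, ∃ n : ℕ, (n : ℚ) = D * c α := by
    intro α hα
    obtain ⟨k, hk⟩ := Finset.dvd_prod_of_mem (fun α => (c α).den) hα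
    refine ⟨k * (c α).num.toNat, ?_⟩
    have h1 : ((c α).num.toNat : ℚ) = (c α).num := by
      exact_mod_cast Int.toNat_of_nonneg (Rat.num_nonneg.2 (hc α))
    have h2 : (D : ℚ) = (c α).den * k := by rw [hD]; exact_mod_cast hk
    rw [Nat.cast_mul, h1, h2, mul_comm ((c α).den : ℚ), mul_assoc, Rat.den_mul_eq_num]
  choose! n hn using hn
  have hms : (∑ α ∈ F, n α • ({α} : Multiset (Module.Dual ℂ H))).sum = 0 := by
    rw [Multiset.sum_sum]
    have : ∀ α ∈ F, (n α • ({α} : Multiset (Module.Dual ℂ H))).sum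
        = (D : ℂ) • ((c α : ℂ) • α) := by
      intro α hα
      rw [Multiset.sum_nsmul, Multiset.sum_singleton, smul_smul, ← Nat.cast_smul_eq_nsmul ℂ]
      congr 1
      exact_mod_cast hn α hα
    rw [Finset.sum_congr rfl this, ← Finset.smul_sum, hsum, smul_zero]
  have hm0 : (∑ α ∈ F, n α • ({α} : Multiset (Module.Dual ℂ H))) = 0 := by
    by_contra hne
    refine multiset_sum_ne_zero hP hadd hneg _ ?_ hne hms
    intro α hα
    obtain ⟨β, hβ, hαβ⟩ := Multiset.mem_sum.1 hα
    have := Multiset.mem_of_mem_nsmul hαβ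
    rw [Multiset.mem_singleton] at this
    exact this ▸ hF β hβ
  intro α hα
  have h1 := Finset.sum_eq_zero_iff.1 hm0 α hα
  have h2 : n α = 0 := by
    have := congrArg Multiset.card h1
    simpa using this
  have h3 := hn α hα
  rw [h2, Nat.cast_zero] at h3
  exact (mul_eq_zero.1 h3.symm).resolve_left (by exact_mod_cast hD0)

/-- The pairing of two roots as an integer. -/
noncomputable def pair (α γ : Module.Dual ℂ H) : ℤ := ⌊(α (coroot γ)).re⌋

theorem pair_cast {α γ : Module.Dual ℂ H} (hα : α ∈ roots H) (hγ : γ ∈ roots H) :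
    (pair α γ : ℂ) = α (coroot γ) := by
  obtain ⟨n, hn⟩ := exists_int_eq_apply_coroot hγ hα
  rw [pair, hn, Complex.intCast_re, Int.floor_intCast]

/-- The rational functional on coefficient vectors of coroots that a root defines. -/
noncomputable def pairFunctional (R : Finset (Module.Dual ℂ H)) (α : Module.Dual ℂ H) :
    Module.Dual ℚ (R → ℚ) where
  toFun c := ∑ γ : R, c γ * pair α (γ : Module.Dual ℂ H)
  map_add' c d := by simp [add_mul, Finset.sum_add_distrib]
  map_smul' q c := by simp [Finset.mul_sum, mul_assoc]

theorem apply_sum_coroot {R : Finset (Module.Dual ℂ H)} (hR : ∀ α ∈ R, α ∈ roots H)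
    {α : Module.Dual ℂ H} (hα : α ∈ roots H) (c : R → ℚ) :
    α (∑ γ : R, (c γ : ℂ) • coroot (γ : Module.Dual ℂ H)) = (pairFunctional R α c : ℂ) := by
  change _ = ((∑ γ : R, c γ * (pair α (γ : Module.Dual ℂ H) : ℚ) : ℚ) : ℂ)
  rw [map_sum, Rat.cast_sum]
  refine Finset.sum_congr rfl fun γ _ => ?_
  rw [map_smul, Rat.cast_mul, Rat.cast_intCast, pair_cast hα (hR γ γ.2), smul_eq_mul]

open Classical in
theorem pairFunctional_single {R : Finset (Module.Dual ℂ H)} (α : Module.Dual ℂ H) (γ : R) :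
    pairFunctional R α (Pi.single γ 1) = pair α (γ : Module.Dual ℂ H) := by
  change ∑ δ : R, (Pi.single γ 1 : R → ℚ) δ * (pair α (δ : Module.Dual ℂ H) : ℚ) = _
  rw [Finset.sum_eq_single γ]
  · simp
  · intro δ _ hδ
    rw [Pi.single_eq_of_ne hδ, zero_mul]
  · simp

/-- Farkas' lemma gives only weak inequalities, so strictness is obtained for one `β` at a time. If
no `c` existed, the functional of `β` would be a non-negative combination of those of `-P` and `S`.
Then `β` plus an element of the cone of `P` lies in both cones and is zero, which contradicts
pointedness of `P`. Coefficient vectors of coroots are used so that the whole argument stays over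
`ℚ`. -/
theorem exists_pairFunctional_pos {R : Finset (Module.Dual ℂ H)}
    (hR : ∀ α, α ∈ R ↔ α ∈ roots H) {P S : Set (Module.Dual ℂ H)}
    (hP : P ⊆ roots H) (hS : S ⊆ roots H)
    (hadd : ∀ α ∈ P, ∀ β ∈ P, α + β ∈ roots H → α + β ∈ P) (hneg : ∀ α ∈ P, -α ∉ P)
    (hcone : Submodule.span ℚ≥0 P ⊓ Submodule.span ℚ≥0 S = ⊥) {β : Module.Dual ℂ H}
    (hβ : β ∈ P) :
    ∃ c : R → ℚ, 0 < pairFunctional R β c ∧ (∀ α ∈ P, 0 ≤ pairFunctional R α c) ∧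
      ∀ α ∈ S, pairFunctional R α c ≤ 0 := by
  classical
  by_contra! hno
  let FP := R.filter (· ∈ P)
  let FS := R.filter (· ∈ S)
  have hFP : ∀ α, α ∈ FP ↔ α ∈ P := fun α =>
    ⟨fun h => (Finset.mem_filter.1 h).2, fun h => Finset.mem_filter.2 ⟨(hR α).2 (hP h), h⟩⟩
  have hFS : ∀ α, α ∈ FS ↔ α ∈ S := fun α =>
    ⟨fun h => (Finset.mem_filter.1 h).2, fun h => Finset.mem_filter.2 ⟨(hR α).2 (hS h), h⟩⟩
  obtain ⟨c, hc, hbc⟩ := farkas (FP.disjSum FS)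
    (Sum.elim (fun α => -pairFunctional R α) (fun α => pairFunctional R α))
    (pairFunctional R β) (by
      intro x hx
      by_contra! hpos
      obtain ⟨σ, hσ, hσx⟩ := hno x hpos fun α hα => by
        have := hx (Sum.inl α) (Finset.inl_mem_disjSum.2 ((hFP α).2 hα))
        simpa using this
      have := hx (Sum.inr σ) (Finset.inr_mem_disjSum.2 ((hFS σ).2 hσ))
      exact absurd this (not_le.2 hσx))
  rw [Finset.sum_disjSum] at hbc
  simp only [Sum.elim_inl, Sum.elim_inr] at hbc
  have hw : β + ∑ α ∈ FP, (c (Sum.inl α) : ℂ) • α = ∑ α ∈ FS, (c (Sum.inr α) : ℂ) • α := by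
    rw [← sub_eq_zero]
    refine eq_zero_of_mem_span_of_apply_coroot (S := roots H) subset_rfl ?_ ?_
    · refine sub_mem (add_mem (Submodule.subset_span (hP hβ)) (sum_mem fun α hα => ?_))
        (sum_mem fun α hα => ?_)
      · exact Submodule.smul_mem _ _ (Submodule.subset_span (hP ((hFP α).1 hα)))
      · exact Submodule.smul_mem _ _ (Submodule.subset_span (hS ((hFS α).1 hα)))
    · intro γ hγ
      -- Testing the identity of functionals on the basis vector at `γ` evaluates both sides at
      -- `coroot γ`, and coroots separate the span of the roots.
      have h1 := LinearMap.congr_fun hbc (Pi.single ⟨γ, (hR γ).2 hγ⟩ 1)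
      simp only [LinearMap.add_apply, LinearMap.sum_apply, LinearMap.smul_apply,
        LinearMap.neg_apply, pairFunctional_single, smul_eq_mul] at h1
      have h3 := congrArg (fun q : ℚ => (q : ℂ)) h1
      simp only [Rat.cast_add, Rat.cast_sum, Rat.cast_mul, Rat.cast_neg, Rat.cast_intCast] at h3
      rw [pair_cast (hP hβ) hγ] at h3
      simp only [LinearMap.add_apply, LinearMap.sum_apply, LinearMap.smul_apply,
        LinearMap.sub_apply, smul_eq_mul, h3]
      rw [Finset.sum_congr rfl fun α hα => by rw [pair_cast (hP ((hFP α).1 hα)) hγ],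
        Finset.sum_congr (s₁ := FS) rfl fun α hα => by rw [pair_cast (hS ((hFS α).1 hα)) hγ]]
      simp only [mul_neg, Finset.sum_neg_distrib]
      ring
  have hz : β + ∑ α ∈ FP, (c (Sum.inl α) : ℂ) • α = 0 := by
    have hmem : β + ∑ α ∈ FP, (c (Sum.inl α) : ℂ) • α ∈
        Submodule.span ℚ≥0 P ⊓ Submodule.span ℚ≥0 S := by
      refine ⟨add_mem (Submodule.subset_span hβ) (sum_mem fun α hα =>
        cast_smul_mem_span ((hFP α).1 hα) (hc _)), ?_⟩
      rw [hw]
      exact sum_mem fun α hα => cast_smul_mem_span ((hFS α).1 hα) (hc _)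
    rw [hcone] at hmem
    exact (Submodule.mem_bot _).1 hmem
  -- The summand `β` is absorbed by raising its own coefficient by `1`, so that coefficient cannot
  -- vanish.
  have := eq_zero_of_sum_smul_eq_zero hP hadd hneg FP (fun α hα => (hFP α).1 hα)
    (fun α => c (Sum.inl α) + if α = β then 1 else 0)
    (fun α => add_nonneg (hc _) (by split_ifs <;> norm_num)) (by
      rw [← hz, add_comm β]
      simp only [Rat.cast_add, add_smul, Finset.sum_add_distrib]
      congr 1
      rw [Finset.sum_eq_single β]
      · simp
      · intro α _ hα
        simp [hα]
      · exact fun h => absurd ((hFP β).2 hβ) h) β ((hFP β).2 hβ)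
  simp only [if_true] at this
  linarith [hc (Sum.inl β)]

/-- Separation of two cones spanned by roots that meet only in `0`, the first one being spanned
by a closed set of roots `P` with `P ∩ -P = ∅`. -/
theorem exists_separating {P S : Set (Module.Dual ℂ H)}
    (hP : P ⊆ roots H) (hS : S ⊆ roots H)
    (hadd : ∀ α ∈ P, ∀ β ∈ P, α + β ∈ roots H → α + β ∈ P) (hneg : ∀ α ∈ P, -α ∉ P)
    (hcone : Submodule.span ℚ≥0 P ⊓ Submodule.span ℚ≥0 S = ⊥) :
    ∃ h : H, (∀ α ∈ roots H, (α h).im = 0) ∧ (∀ α ∈ P, 0 < (α h).re) ∧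
      ∀ α ∈ S, (α h).re ≤ 0 := by
  classical
  let R := (finite_roots (H := H)).toFinset
  have hR : ∀ α, α ∈ R ↔ α ∈ roots H := fun α => Set.Finite.mem_toFinset _
  have hex := fun β hβ =>
    exists_pairFunctional_pos hR hP hS hadd hneg hcone (β := β) hβ
  choose! c hc1 hc2 hc3 using hex
  let FP := R.filter (· ∈ P)
  have hFP : ∀ α, α ∈ FP ↔ α ∈ P := fun α =>
    ⟨fun h => (Finset.mem_filter.1 h).2, fun h => Finset.mem_filter.2 ⟨(hR α).2 (hP h), h⟩⟩
  -- Each `c β` is positive at `β` and weakly of the right sign elsewhere, so their sum is positive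
  -- on all of `P`.
  let d : R → ℚ := ∑ β ∈ FP, c β
  refine ⟨∑ γ : R, (d γ : ℂ) • coroot (γ : Module.Dual ℂ H), fun α hα => ?_, fun α hα => ?_,
    fun α hα => ?_⟩
  · rw [apply_sum_coroot (fun α => (hR α).1) hα]
    exact Complex.ratCast_im _
  · rw [apply_sum_coroot (fun α => (hR α).1) (hP hα), Complex.ratCast_re]
    have : 0 < pairFunctional R α d := by
      rw [map_sum]
      exact Finset.sum_pos' (fun β hβ => hc2 β ((hFP β).1 hβ) α hα)
        ⟨α, (hFP α).2 hα, hc1 α hα⟩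
    exact_mod_cast this
  · rw [apply_sum_coroot (fun α => (hR α).1) (hS hα), Complex.ratCast_re]
    have : pairFunctional R α d ≤ 0 := by
      rw [map_sum]
      exact Finset.sum_nonpos fun β hβ => hc3 β ((hFP β).1 hβ) α hα
    exact_mod_cast this

/-- There is an element of the Cartan subalgebra on which the roots take non-zero real values. -/
theorem exists_regular :
    ∃ h : H, (∀ α ∈ roots H, (α h).im = 0) ∧ ∀ α ∈ roots H, (α h).re ≠ 0 := by
  classical
  let R := (finite_roots (H := H)).toFinset
  have hR : ∀ α, α ∈ R ↔ α ∈ roots H := fun α => Set.Finite.mem_toFinset _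
  obtain ⟨d, hd⟩ := Module.Dual.exists_forall_ne_zero_of_forall_exists
    (fun α : R => pairFunctional R (α : Module.Dual ℂ H)) (fun α => by
      refine ⟨Pi.single α 1, ?_⟩
      rw [pairFunctional_single]
      intro h0
      have h1 := pair_cast ((hR α).1 α.2) ((hR α).1 α.2)
      rw [root_apply_coroot ((hR α).1 α.2)] at h1
      have h2 : pair (α : Module.Dual ℂ H) α = 0 := by exact_mod_cast h0
      rw [h2] at h1
      norm_num at h1)
  refine ⟨∑ γ : R, (d γ : ℂ) • coroot (γ : Module.Dual ℂ H), fun α hα => ?_, fun α hα => ?_⟩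
  · rw [apply_sum_coroot (fun α => (hR α).1) hα]
    exact Complex.ratCast_im _
  · rw [apply_sum_coroot (fun α => (hR α).1) hα, Complex.ratCast_re]
    exact_mod_cast hd ⟨α, (hR α).2 hα⟩

end Pointed

/-! ### The root sets of `l`, `𝔨`, `𝔫` and `C(𝔨_ss)`, and the normalizers. -/

section RootSets

variable {L : Type*} [LieRing L] [LieAlgebra ℂ L] {H : LieSubalgebra ℂ L}

theorem cartan_le_normalizer {W : Submodule ℂ L} (hW : ∀ h ∈ H, ∀ x ∈ W, ⁅h, x⁆ ∈ W) :
    H.toSubmodule ≤ (RootSub.normalizer W).toSubmodule := fun h hh x hx => hW h hh x hx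

theorem lie_mem_normalizer {W : Submodule ℂ L} (hW : ∀ h ∈ H, ∀ x ∈ W, ⁅h, x⁆ ∈ W) {h x : L}
    (hh : h ∈ H) (hx : x ∈ RootSub.normalizer W) : ⁅h, x⁆ ∈ RootSub.normalizer W :=
  (RootSub.normalizer W).lie_mem (fun y hy => hW h hh y hy) hx

variable [H.IsCartanSubalgebra] {l : LieSubalgebra ℂ L}

theorem mem_rootsN_iff {α : Module.Dual ℂ H} :
    α ∈ rootsN H l ↔ α ∈ rootsOf H l ∧ -α ∉ rootsOf H l :=
  ⟨fun h => ⟨h.1, fun h' => h.2 ⟨h.1, h'⟩⟩, fun h => ⟨h.1, fun h' => h.2 h'.2⟩⟩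

theorem neg_mem_rootsK {α : Module.Dual ℂ H} (hα : α ∈ rootsK H l) : -α ∈ rootsK H l :=
  ⟨hα.2, by rw [neg_neg]; exact hα.1⟩

theorem lie_mem_rootSum {S : Set (Module.Dual ℂ H)} {h x : L} (hh : h ∈ H)
    (hx : x ∈ rootSum H S) : ⁅h, x⁆ ∈ rootSum H S := by
  have : rootSum H S ≤ (rootSum H S).comap (ad ℂ L h : L →ₗ[ℂ] L) :=
    rootSum_le.2 fun α hα y hy =>
      rootSpace_le_rootSum hα ((rootSpace H α).lie_mem (x := (⟨h, hh⟩ : H)) hy)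
  exact this hx

theorem mem_h1_iff {x : L} :
    x ∈ h1 H l ↔ ∃ hx : x ∈ H, ∀ γ ∈ rootsK H l, γ ⟨x, hx⟩ = 0 := by
  simp only [h1, Submodule.mem_map, Submodule.mem_iInf, LinearMap.mem_ker]
  constructor
  · rintro ⟨y, hy, rfl⟩
    exact ⟨y.2, hy⟩
  · rintro ⟨hx, h⟩
    exact ⟨⟨x, hx⟩, h, rfl⟩

theorem h1_le_cartan : h1 H l ≤ H.toSubmodule := fun _ hx => (mem_h1_iff.1 hx).1

theorem lie_cartan_mem_rootSpace {γ : Module.Dual ℂ H} {h y : L} (hh : h ∈ H)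
    (hy : y ∈ rootSpace H γ) : ⁅h, y⁆ ∈ rootSpace H γ :=
  (rootSpace H γ).lie_mem (x := (⟨h, hh⟩ : H)) hy

theorem rootsN_subset_roots : rootsN H l ⊆ roots H := fun _ h => h.1.1

theorem notMem_rootsK_of_mem_rootsPerp {α : Module.Dual ℂ H} (hα : α ∈ rootsPerp H l) :
    α ∉ rootsK H l := fun h => (hα.2 α h).2.2 (sub_self α)

theorem rootSpace_le_normalizer_rootSum {S : Set (Module.Dual ℂ H)} {α : Module.Dual ℂ H}
    (h : ∀ β ∈ S, α + β ∈ S ∨ (α + β ∉ roots H ∧ α + β ≠ 0)) :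
    (rootSpace H α).toSubmodule ≤ (RootSub.normalizer (rootSum H S)).toSubmodule := by
  intro x hx
  have : rootSum H S ≤ (rootSum H S).comap (ad ℂ L x : L →ₗ[ℂ] L) :=
    rootSum_le.2 fun β hβ y hy => by
      change ⁅x, y⁆ ∈ rootSum H S
      rcases h β hβ with h | ⟨h, h0⟩
      · exact rootSpace_le_rootSum h (lie_mem_rootSpace_add hx hy)
      · rw [lie_eq_zero_of_notMem_roots h h0 hx hy]
        exact zero_mem _
  exact fun y hy => this hy

variable [FiniteDimensional ℂ L] [LieAlgebra.HasCentralRadical ℂ L]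

theorem lie_ne_zero_of_neg {α : Module.Dual ℂ H} (hα : α ∈ roots H) {x y : L}
    (hx : x ∈ rootSpace H α) (hy : y ∈ rootSpace H (-α : Module.Dual ℂ H)) (hx0 : x ≠ 0)
    (hy0 : y ≠ 0) : ⁅x, y⁆ ≠ 0 := by
  obtain ⟨e, f, he, hf, hef, ht⟩ := exists_isSl2Triple hα
  obtain ⟨c, rfl⟩ := exists_smul_eq_of_mem_rootSpace hα hx hx0 he
  obtain ⟨d, rfl⟩ := exists_smul_eq_of_mem_rootSpace (neg_mem_roots hα) hy hy0 hf
  intro h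
  rw [smul_lie, lie_smul, h, smul_zero, smul_zero] at hef
  exact ht.h_ne_zero hef.symm

theorem rootSpace_add_le {s : LieSubalgebra ℂ L} {α β : Module.Dual ℂ H} (hα : α ∈ roots H)
    (hβ : β ∈ roots H) (hαβ : α + β ∈ roots H)
    (h1 : (rootSpace H α).toSubmodule ≤ s.toSubmodule)
    (h2 : (rootSpace H β).toSubmodule ≤ s.toSubmodule) :
    (rootSpace H (α + β : Module.Dual ℂ H)).toSubmodule ≤ s.toSubmodule := by
  obtain ⟨e, he, he0⟩ := exists_ne_zero_of_mem_roots hα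
  obtain ⟨f, hf, hf0⟩ := exists_ne_zero_of_mem_roots hβ
  exact rootSpace_le_of_mem hαβ.1 (lie_mem_rootSpace_add he hf)
    (lie_ne_zero hα hβ hαβ he hf he0 hf0) (s.lie_mem (h1 he) (h2 hf))

theorem rootsOf_add {α β : Module.Dual ℂ H} (hα : α ∈ rootsOf H l) (hβ : β ∈ rootsOf H l)
    (hαβ : α + β ∈ roots H) : α + β ∈ rootsOf H l :=
  ⟨hαβ, rootSpace_add_le hα.1 hβ.1 hαβ hα.2 hβ.2⟩

theorem rootsN_add {α β : Module.Dual ℂ H} (hα : α ∈ rootsN H l) (hβ : β ∈ rootsN H l)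
    (hαβ : α + β ∈ roots H) : α + β ∈ rootsN H l := by
  rw [mem_rootsN_iff] at *
  refine ⟨rootsOf_add hα.1 hβ.1 hαβ, fun h => hβ.2 ?_⟩
  have h2 : -(α + β) + α = -β := by abel
  have := rootsOf_add h hα.1 (by rw [h2]; exact neg_mem_roots hβ.1.1)
  rwa [h2] at this

theorem rootsK_add_rootsN {δ β : Module.Dual ℂ H} (hδ : δ ∈ rootsK H l) (hβ : β ∈ rootsN H l)
    (h : δ + β ∈ roots H) : δ + β ∈ rootsN H l := by
  rw [mem_rootsN_iff] at *
  refine ⟨rootsOf_add hδ.1 hβ.1 h, fun h' => hβ.2 ?_⟩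
  have h2 : -(δ + β) + δ = -β := by abel
  have := rootsOf_add h' hδ.1 (by rw [h2]; exact neg_mem_roots hβ.1.1)
  rwa [h2] at this

/-- A root vector of `𝔨` is half its bracket with its coroot, hence lies in `[𝔨, 𝔨]`. Conversely,
`H` is abelian, so brackets in `𝔨` involve only root vectors and brackets of two of them, and the
Jacobi identity applies. -/
theorem mem_centK_iff {x : L} :
    x ∈ centK H l ↔ ∀ γ ∈ rootsK H l, ∀ y ∈ rootSpace H γ, ⁅x, y⁆ = 0 := by
  constructor
  · intro hx γ hγ y hy
    have h2 : ⁅(coroot γ : L), y⁆ = (2 : ℂ) • y := by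
      rw [lie_eq_smul_of_mem_rootSpace hγ.1.1.1 hy, root_apply_coroot hγ.1.1]
    have h3 := hx _ (Submodule.subset_span
      ⟨(coroot γ : L), Submodule.mem_sup_left (coroot γ).2, y,
        Submodule.mem_sup_right (rootSpace_le_rootSum hγ hy), rfl⟩)
    rw [h2, lie_smul] at h3
    exact (smul_eq_zero.1 h3).resolve_left two_ne_zero
  · intro hx
    have hr : ∀ r ∈ rootSum H (rootsK H l), ⁅x, r⁆ = 0 := fun r hr => by
      have : rootSum H (rootsK H l) ≤ LinearMap.ker (ad ℂ L x : L →ₗ[ℂ] L) :=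
        rootSum_le.2 fun γ hγ y hy => hx γ hγ y hy
      exact this hr
    have : derived (partK H l) ≤ LinearMap.ker (ad ℂ L x : L →ₗ[ℂ] L) := by
      refine Submodule.span_le.2 ?_
      rintro _ ⟨a, ha, b, hb, rfl⟩
      obtain ⟨u, hu, r, hr1, rfl⟩ := Submodule.mem_sup.1 ha
      obtain ⟨v, hv, s, hs, rfl⟩ := Submodule.mem_sup.1 hb
      change ⁅x, ⁅u + r, v + s⁆⁆ = 0
      have e1 : ⁅r, v⁆ ∈ rootSum H (rootsK H l) := by
        rw [← lie_skew]
        exact neg_mem (lie_mem_rootSum hv hr1)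
      rw [add_lie, lie_add, lie_add, lie_cartan_eq_zero H hu hv, zero_add, lie_add, lie_add,
        hr _ (lie_mem_rootSum hu hs), hr _ e1, lie_lie_eq_zero_of_lie_eq_zero (hr r hr1) (hr s hs)]
      simp
    exact fun y hy => this hy
where
  lie_lie_eq_zero_of_lie_eq_zero {x r s : L} (hr : ⁅x, r⁆ = 0) (hs : ⁅x, s⁆ = 0) :
      ⁅x, ⁅r, s⁆⁆ = 0 := by
    rw [leibniz_lie, hr, hs, zero_lie, lie_zero, add_zero]

theorem lie_mem_centK {h x : L} (hh : h ∈ H) (hx : x ∈ centK H l) : ⁅h, x⁆ ∈ centK H l := by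
  rw [mem_centK_iff] at *
  intro γ hγ y hy
  rw [lie_lie, hx γ hγ y hy, lie_zero,
    hx γ hγ _ (lie_cartan_mem_rootSpace hh hy), sub_zero]

theorem coroot_lie_centK {γ : Module.Dual ℂ H} (hγ : γ ∈ rootsK H l) {x : L}
    (hx : x ∈ centK H l) : ⁅(coroot γ : L), x⁆ = 0 := by
  rw [mem_centK_iff] at hx
  obtain ⟨e, f, he, hf, hef, -⟩ := coroot_spec hγ.1.1
  rw [← hef, ← lie_skew, leibniz_lie, hx γ hγ e he, hx (-γ) (neg_mem_rootsK hγ) f hf]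
  simp

/-- Two root spaces commute exactly when the sum of the roots is neither a root nor zero. Since
`Δ(𝔨)` is symmetric, differences are covered by sums. -/
theorem mem_rootsPerp_iff {α : Module.Dual ℂ H} : α ∈ rootsPerp H l ↔
    α ∈ roots H ∧ (rootSpace H α).toSubmodule ≤ (centK H l).toSubmodule := by
  constructor
  · rintro ⟨hα, h⟩
    refine ⟨hα, fun x hx => mem_centK_iff.2 fun γ hγ y hy => ?_⟩
    exact lie_eq_zero_of_notMem_roots (h γ hγ).1.1 (h γ hγ).1.2 hx hy
  · rintro ⟨hα, h⟩
    have key : ∀ γ ∈ rootsK H l, α + γ ∉ roots H ∧ α + γ ≠ 0 := by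
      intro γ hγ
      obtain ⟨e, he, he0⟩ := exists_ne_zero_of_mem_roots hα
      obtain ⟨f, hf, hf0⟩ := exists_ne_zero_of_mem_roots hγ.1.1
      have h0 := mem_centK_iff.1 (h he) γ hγ f hf
      refine ⟨fun hr => lie_ne_zero hα hγ.1.1 hr he hf he0 hf0 h0, fun hz => ?_⟩
      obtain rfl : γ = -α := (neg_eq_of_add_eq_zero_right hz).symm
      exact lie_ne_zero_of_neg hα he hf he0 hf0 h0
    exact ⟨hα, fun γ hγ => ⟨key γ hγ, by
      have := key (-γ) (neg_mem_rootsK hγ)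
      rwa [← sub_eq_add_neg] at this⟩⟩

theorem neg_mem_rootsPerp {α : Module.Dual ℂ H} (hα : α ∈ rootsPerp H l) :
    -α ∈ rootsPerp H l := by
  refine ⟨neg_mem_roots hα.1, fun γ hγ => ?_⟩
  obtain ⟨⟨h1, h2⟩, h3, h4⟩ := hα.2 γ hγ
  have e1 : -α + γ = -(α - γ) := by abel
  have e2 : -α - γ = -(α + γ) := by abel
  refine ⟨⟨fun h => h3 ?_, fun h => h4 ?_⟩, fun h => h1 ?_, fun h => h2 ?_⟩
  · rw [e1] at h; simpa using neg_mem_roots h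
  · rw [e1] at h; exact neg_eq_zero.1 h
  · rw [e2] at h; simpa using neg_mem_roots h
  · rw [e2] at h; exact neg_eq_zero.1 h

theorem rootsPerp_add {α β : Module.Dual ℂ H} (hα : α ∈ rootsPerp H l)
    (hβ : β ∈ rootsPerp H l) (h : α + β ∈ roots H) : α + β ∈ rootsPerp H l := by
  rw [mem_rootsPerp_iff] at *
  exact ⟨h, rootSpace_add_le hα.1 hβ.1 h hα.2 hβ.2⟩

theorem cartan_inf_centK : (centK H l).toSubmodule ⊓ H.toSubmodule = h1 H l := by
  ext x
  rw [mem_h1_iff]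
  constructor
  · rintro ⟨hx, hxH⟩
    refine ⟨hxH, fun γ hγ => ?_⟩
    obtain ⟨e, he, he0⟩ := exists_ne_zero_of_mem_roots hγ.1.1
    have h0 := mem_centK_iff.1 hx γ hγ e he
    have h1 := lie_eq_smul_of_mem_rootSpace hγ.1.1.1 he ⟨x, hxH⟩
    rw [h0] at h1
    exact (smul_eq_zero.1 h1.symm).resolve_right he0
  · rintro ⟨hxH, h⟩
    refine ⟨mem_centK_iff.2 fun γ hγ y hy => ?_, hxH⟩
    have h1 := lie_eq_smul_of_mem_rootSpace hγ.1.1.1 hy ⟨x, hxH⟩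
    rwa [h γ hγ, zero_smul] at h1

/-- A subalgebra of the centralizer of `𝔨_ss` that is stable under the Cartan subalgebra. -/
theorem le_h1_sup_rootSum {W : Submodule ℂ L} (hW : ∀ h ∈ H, ∀ x ∈ W, ⁅h, x⁆ ∈ W)
    (hc : W ≤ (centK H l).toSubmodule) :
    W ≤ h1 H l ⊔ rootSum H {α ∈ rootsPerp H l | (rootSpace H α).toSubmodule ≤ W} := by
  refine (le_cartan_sup_rootSum hW).trans (sup_le_sup ?_ (rootSum_mono ?_))
  · rw [← cartan_inf_centK]
    exact inf_le_inf_right _ hc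
  · rintro α ⟨hα, hαW⟩
    exact ⟨mem_rootsPerp_iff.2 ⟨hα, hαW.trans hc⟩, hαW⟩

theorem centK_eq : (centK H l).toSubmodule = h1 H l ⊔ rootSum H (rootsPerp H l) := by
  refine le_antisymm ?_ (sup_le ?_ (rootSum_le.2 fun α hα => (mem_rootsPerp_iff.1 hα).2))
  · exact (le_h1_sup_rootSum (fun h hh x hx => lie_mem_centK hh hx) le_rfl).trans
      (sup_le_sup le_rfl (rootSum_mono (Set.sep_subset _ _)))
  · rw [← cartan_inf_centK]
    exact inf_le_left

theorem centK_inf_partN :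
    (centK H l).toSubmodule ⊓ partN H l = rootSum H (rootsN H l ∩ rootsPerp H l) := by
  refine le_antisymm ?_ (rootSum_le.2 fun α hα =>
    le_inf (mem_rootsPerp_iff.1 hα.2).2 (rootSpace_le_rootSum hα.1))
  refine (le_cartan_sup_rootSum (H := H) fun h hh x hx => Submodule.mem_inf.2
    ⟨lie_mem_centK hh hx.1, lie_mem_rootSum hh hx.2⟩).trans (sup_le ?_ (rootSum_mono ?_))
  · rintro x ⟨⟨-, hx⟩, hxH⟩
    rw [Submodule.disjoint_def.1 (disjoint_cartan_rootSum rootsN_subset_roots) x hxH hx]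
    exact zero_mem _
  · rintro α ⟨hα, hαW⟩
    exact ⟨mem_of_rootSpace_le_sup hα ((hαW.trans inf_le_right).trans le_sup_right),
      mem_rootsPerp_iff.2 ⟨hα, hαW.trans inf_le_left⟩⟩

theorem h1_le_centK : h1 H l ≤ (centK H l).toSubmodule := by
  rw [← cartan_inf_centK]
  exact inf_le_left

/-- No cone condition enters here: the subspace is `H`-stable, and brackets of root vectors vanish
only when they must, so membership of a root space is the combinatorial condition defining `setQ`. A
bracket landing in `H` is excluded because `𝔫` meets `H` trivially. -/
theorem centK_inf_normalizer_eq :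
    (centK H l ⊓ RootSub.normalizer ((centK H l).toSubmodule ⊓ partN H l)).toSubmodule =
      h1 H l ⊔ rootSum H (setQ H l) := by
  have hst : ∀ h ∈ H, ∀ x ∈ (centK H l).toSubmodule ⊓ partN H l,
      ⁅h, x⁆ ∈ (centK H l).toSubmodule ⊓ partN H l := fun h hh x hx =>
    ⟨lie_mem_centK hh hx.1, lie_mem_rootSum hh hx.2⟩
  apply le_antisymm
  · refine (le_h1_sup_rootSum (H := H) (l := l) (fun h hh x hx => Submodule.mem_inf.2
      ⟨lie_mem_centK hh hx.1, lie_mem_normalizer hst hh hx.2⟩) inf_le_left).trans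
      (sup_le_sup le_rfl (rootSum_mono ?_))
    rintro α ⟨hα, hαW⟩
    refine ⟨hα, fun β hβ => ?_⟩
    by_contra! hno
    obtain ⟨hN, hno⟩ := hno
    obtain ⟨e, he, he0⟩ := exists_ne_zero_of_mem_roots hα.1
    obtain ⟨f, hf, hf0⟩ := exists_ne_zero_of_mem_roots hβ.2.1
    have hef : ⁅e, f⁆ ∈ rootSum H (rootsN H l) :=
      ((hαW he).2 f ⟨(mem_rootsPerp_iff.1 hβ.2).2 hf, rootSpace_le_rootSum hβ.1 hf⟩).2
    by_cases hr : α + β ∈ roots H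
    · exact hN (mem_of_rootSpace_le_sup hr ((rootSpace_le_of_mem hr.1
        (lie_mem_rootSpace_add he hf) (lie_ne_zero hα.1 hβ.2.1 hr he hf he0 hf0) hef).trans
        le_sup_right))
    · obtain rfl : β = -α := (neg_eq_of_add_eq_zero_right (hno hr)).symm
      exact lie_ne_zero_of_neg hα.1 he hf he0 hf0 (Submodule.disjoint_def.1
        (disjoint_cartan_rootSum rootsN_subset_roots) _ (lie_mem_cartan he hf) hef)
  · refine sup_le (le_inf h1_le_centK (h1_le_cartan.trans (cartan_le_normalizer hst)))
      (rootSum_le.2 fun α hα => le_inf (mem_rootsPerp_iff.1 hα.1).2 ?_)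
    rw [centK_inf_partN]
    refine rootSpace_le_normalizer_rootSum fun β hβ => ?_
    rcases hα.2 β hβ with h | h
    · exact Or.inl ⟨h, rootsPerp_add hα.1 hβ.2 h.1.1⟩
    · exact Or.inr h

/-! ### Consequences of the cone condition -/

variable {b : LieSubalgebra ℂ L}

theorem exists_cone_separating (hcone : ConeCondition H b l) :
    ∃ h : H, (∀ α ∈ roots H, (α h).im = 0) ∧ (∀ α ∈ rootsN H l, 0 < (α h).re) ∧
      ∀ α ∈ sing H b l, (α h).re ≤ 0 :=
  exists_separating rootsN_subset_roots (fun _ h => h.1.1)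
    (fun _ hα _ hβ h => rootsN_add hα hβ h)
    (fun _ hα hα' => (mem_rootsN_iff.1 hα).2 hα'.1) hcone

theorem neg_notMem_rootsOf_of_isSolvable (hb : LieAlgebra.IsSolvable b) {α : Module.Dual ℂ H}
    (hα : α ∈ rootsOf H b) : -α ∉ rootsOf H b :=
  fun h => not_isSolvable_of_rootSpace_le hα.1 hα.2 h.2 hb

/-- Separation with `S = ∅`. Solvability of `b` gives pointedness, since a pair of opposite roots
would generate an `sl₂` in `b`. -/
theorem exists_pos_on_rootsK (hb : LieAlgebra.IsSolvable b) :
    ∃ h : H, ∀ α ∈ rootsOf H b ∩ rootsK H l, 0 < (α h).re := by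
  obtain ⟨h, -, hpos, -⟩ := exists_separating (H := H) (P := rootsOf H b ∩ rootsK H l) (S := ∅)
    (fun _ h => h.1.1) (Set.empty_subset _)
    (fun α hα β hβ h => ⟨rootsOf_add hα.1 hβ.1 h, rootsOf_add hα.2.1 hβ.2.1 h, by
      have h2 : -α + -β = -(α + β) := by abel
      have := rootsOf_add hα.2.2 hβ.2.2 (by rw [h2]; exact neg_mem_roots h)
      rwa [h2] at this⟩)
    (fun α hα hα' => neg_notMem_rootsOf_of_isSolvable hb hα.1 hα'.1) (by simp)
  exact ⟨h, hpos⟩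

/-- Choose `β'` as high as possible for an element positive on `Δ(𝔟) ∩ Δ(𝔨)`. If `α + β' + δ` were a
root, then, because the root vector of `α` commutes with that of `δ`, already `δ + β'` would be a
root, and a higher admissible choice. -/
theorem add_mem_sing_of_maximal (hb : LieAlgebra.IsSolvable b) {α β : Module.Dual ℂ H}
    (hα : α ∈ rootsPerp H l) (hβ : β ∈ rootsN H l) (hr : α + β ∈ roots H)
    (hl : α + β ∉ rootsOf H l) : ∃ β' ∈ rootsN H l, α + β' ∈ sing H b l := by
  obtain ⟨hb', hpos⟩ := exists_pos_on_rootsK (H := H) (l := l) hb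
  let X : Set (Module.Dual ℂ H) :=
    {β' ∈ rootsN H l | α + β' ∈ roots H ∧ α + β' ∉ rootsOf H l}
  have hX : X.Finite := finite_roots.subset fun β' h => h.1.1.1
  obtain ⟨β', hβ', hmax⟩ := Set.exists_max_image X (fun β' => (β' hb').re) hX ⟨β, hβ, hr, hl⟩
  refine ⟨β', hβ'.1, ⟨hβ'.2.1, hβ'.2.2⟩, fun δ hδ hδr => ?_⟩
  obtain ⟨e, he, he0⟩ := exists_ne_zero_of_mem_roots hα.1
  obtain ⟨f, hf, hf0⟩ := exists_ne_zero_of_mem_roots hβ'.1.1.1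
  obtain ⟨g, hg, hg0⟩ := exists_ne_zero_of_mem_roots hδ.1.1
  have hne : ⁅⁅e, f⁆, g⁆ ≠ 0 := lie_ne_zero hβ'.2.1 hδ.1.1 hδr (lie_mem_rootSpace_add he hf) hg
    (lie_ne_zero hα.1 hβ'.1.1.1 hβ'.2.1 he hf he0 hf0) hg0
  have heg : ⁅e, g⁆ = 0 := mem_centK_iff.1 ((mem_rootsPerp_iff.1 hα).2 he) δ hδ.2 g hg
  have hfg : ⁅g, f⁆ ≠ 0 := by
    intro h0
    apply hne
    rw [lie_lie, heg, lie_zero, sub_zero, ← lie_skew f g, h0, neg_zero, lie_zero]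
  have hδβ0 : δ + β' ≠ 0 := by
    intro h0
    obtain rfl : β' = -δ := (neg_eq_of_add_eq_zero_right h0).symm
    exact hβ'.1.2 (neg_mem_rootsK hδ.2)
  have hδβ : δ + β' ∈ roots H :=
    mem_roots_of_mem_rootSpace hδβ0 (lie_mem_rootSpace_add hg hf) hfg
  have hXm : δ + β' ∈ X := by
    have e1 : α + (δ + β') = α + β' + δ := by abel
    refine ⟨rootsK_add_rootsN hδ.2 hβ'.1 hδβ, ?_, fun h => hβ'.2.2 ?_⟩
    · rw [e1]; exact hδr
    -- As `-δ` is also a root of `l`, adding `δ` cannot bring a root from outside `Δ(l)` into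
    -- `Δ(l)`.
    · have e2 : α + (δ + β') + -δ = α + β' := by abel
      have := rootsOf_add h hδ.2.2 (by rw [e2]; exact hβ'.2.1)
      rwa [e2] at this
  have h1 := hmax _ hXm
  have h2 := hpos δ hδ
  simp only [LinearMap.add_apply, Complex.add_re] at h1
  linarith

/-- Three ways to fail must be excluded. If `α + β ∈ Δ(𝔨)`, strong orthogonality breaks because `α -
(α + β) = -β` is a root. If `α + β` is a root outside `Δ(l)`, some `α + β'` in `sing` is positive at
`h`. If `α + β = 0`, then `β = -α` is not positive at `h`. -/
theorem add_mem_rootsN_or (hb : LieAlgebra.IsSolvable b) {h : H}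
    (hN : ∀ α ∈ rootsN H l, 0 < (α h).re) (hS : ∀ α ∈ sing H b l, (α h).re ≤ 0)
    {α β : Module.Dual ℂ H} (hα : α ∈ rootsPerp H l) (hα0 : 0 ≤ (α h).re)
    (hβ : β ∈ rootsN H l) :
    α + β ∈ rootsN H l ∨ (α + β ∉ roots H ∧ α + β ≠ 0) := by
  by_contra! hno
  obtain ⟨hno1, hno2⟩ := hno
  by_cases hr : α + β ∈ roots H
  · by_cases hl : α + β ∈ rootsOf H l
    · have hK : α + β ∈ rootsK H l := by
        by_contra hK
        exact hno1 ⟨hl, hK⟩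
      have h1 := (hα.2 _ hK).2.1
      have h2 : α - (α + β) = -β := by abel
      rw [h2] at h1
      exact h1 (neg_mem_roots hβ.1.1)
    · obtain ⟨β', hβ', hs⟩ := add_mem_sing_of_maximal hb hα hβ hr hl
      have h1 := hS _ hs
      have h2 := hN _ hβ'
      simp only [LinearMap.add_apply, Complex.add_re] at h1
      linarith
  · obtain rfl : β = -α := (neg_eq_of_add_eq_zero_right (hno2 hr)).symm
    have h2 := hN _ hβ
    simp only [LinearMap.neg_apply, Complex.neg_re] at h2
    linarith

theorem setQ_eq (hb : LieAlgebra.IsSolvable b) {h : H}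
    (hN : ∀ α ∈ rootsN H l, 0 < (α h).re) (hS : ∀ α ∈ sing H b l, (α h).re ≤ 0) :
    setQ H l = {α ∈ rootsPerp H l | 0 ≤ (α h).re} := by
  ext α
  constructor
  · rintro ⟨hα, h1⟩
    refine ⟨hα, ?_⟩
    by_contra! hneg
    have hα' := neg_mem_rootsPerp hα
    have hl : -α ∈ rootsOf H l := by
      by_contra hl
      have h2 := hS (-α) ⟨⟨hα'.1, hl⟩, fun δ hδ => (hα'.2 δ hδ.2).1.1⟩
      simp only [LinearMap.neg_apply, Complex.neg_re] at h2
      linarith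
    rcases h1 (-α) ⟨⟨hl, notMem_rootsK_of_mem_rootsPerp hα'⟩, hα'⟩ with h2 | h2
    · rw [add_neg_cancel] at h2
      exact h2.1.1.1 rfl
    · exact h2.2 (add_neg_cancel α)
  · rintro ⟨hα, h1⟩
    exact ⟨hα, fun β hβ => add_mem_rootsN_or hb hN hS hα h1 hβ.1⟩

theorem centK_inf_normalizer_partN_eq (hb : LieAlgebra.IsSolvable b) {h : H}
    (hN : ∀ α ∈ rootsN H l, 0 < (α h).re) (hS : ∀ α ∈ sing H b l, (α h).re ≤ 0) :
    centK H l ⊓ RootSub.normalizer (partN H l) =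
      centK H l ⊓ RootSub.normalizer ((centK H l).toSubmodule ⊓ partN H l) := by
  apply le_antisymm
  · rintro x ⟨hx1, hx2⟩
    exact ⟨hx1, fun y hy => ⟨(centK H l).lie_mem hx1 hy.1, hx2 y hy.2⟩⟩
  · rw [← LieSubalgebra.toSubmodule_le_toSubmodule, centK_inf_normalizer_eq]
    refine sup_le (le_inf h1_le_centK (h1_le_cartan.trans (cartan_le_normalizer
      fun h hh x hx => lie_mem_rootSum hh hx)))
      (rootSum_le.2 fun α hα => le_inf (mem_rootsPerp_iff.1 hα.1).2 ?_)
    rw [setQ_eq hb hN hS] at hα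
    exact rootSpace_le_normalizer_rootSum fun β hβ => add_mem_rootsN_or hb hN hS hα.1 hα.2 hβ

end RootSets

/-! ### Solvability from positivity, and Borel subalgebras of `C(𝔨_ss)`. -/

section Solvable

variable {L : Type*} [LieRing L] [LieAlgebra ℂ L] {H : LieSubalgebra ℂ L}
  [H.IsCartanSubalgebra] [FiniteDimensional ℂ L] [LieAlgebra.HasCentralRadical ℂ L]

/-- The one closure criterion behind the Borel subalgebra, the Levi complement, the radical and the
ideals attached to components. `h1` handles brackets of `U` with root spaces, `h2` sums that are
roots, and `h3` opposite roots, whose bracket is a multiple of the coroot. -/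
theorem lie_mem_sup_rootSum {U U' : Submodule ℂ L} (hU : U ≤ H.toSubmodule)
    (hU' : U' ≤ H.toSubmodule) {A A' : Set (Module.Dual ℂ H)} (hA : A ⊆ roots H)
    (hA' : A' ⊆ roots H)
    (h1 : ∀ β ∈ A', β ∈ A ∨ ∀ u : H, (u : L) ∈ U → β u = 0)
    (h2 : ∀ α ∈ A, ∀ β ∈ A', α + β ∈ roots H → α + β ∈ A)
    (h3 : ∀ α ∈ A, -α ∈ A' → (coroot α : L) ∈ U) {x y : L}
    (hx : x ∈ U ⊔ rootSum H A) (hy : y ∈ U' ⊔ rootSum H A') : ⁅x, y⁆ ∈ U ⊔ rootSum H A := by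
  have key : ∀ u ∈ U' ⊔ rootSum H A', ∀ v ∈ U ⊔ rootSum H A, ⁅v, u⁆ ∈ U ⊔ rootSum H A := by
    intro u hu v hv
    have hv1 : U' ≤ (U ⊔ rootSum H A).comap (ad ℂ L v : L →ₗ[ℂ] L) := by
      intro w hw
      change ⁅v, w⁆ ∈ U ⊔ rootSum H A
      obtain ⟨a, ha, r, hr, rfl⟩ := Submodule.mem_sup.1 hv
      rw [add_lie, lie_cartan_eq_zero H (hU ha) (hU' hw), zero_add, ← lie_skew]
      exact neg_mem (Submodule.mem_sup_right (lie_mem_rootSum (hU' hw) hr))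
    have hv2 : rootSum H A' ≤ (U ⊔ rootSum H A).comap (ad ℂ L v : L →ₗ[ℂ] L) := by
      refine rootSum_le.2 fun β hβ w hw => ?_
      have : U ⊔ rootSum H A ≤ (U ⊔ rootSum H A).comap (ad ℂ L w : L →ₗ[ℂ] L) := by
        refine sup_le ?_ (rootSum_le.2 fun α hα z hz => ?_)
        · intro a ha
          change ⁅w, a⁆ ∈ U ⊔ rootSum H A
          rw [← lie_skew, lie_eq_smul_of_mem_rootSpace (hA' hβ).1 hw ⟨a, hU ha⟩]
          refine neg_mem ?_
          rcases h1 β hβ with h | h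
          · exact Submodule.mem_sup_right (Submodule.smul_mem _ _ (rootSpace_le_rootSum h hw))
          · rw [h ⟨a, hU ha⟩ ha, zero_smul]
            exact zero_mem _
        · change ⁅w, z⁆ ∈ U ⊔ rootSum H A
          rw [← lie_skew]
          refine neg_mem ?_
          by_cases hr : α + β ∈ roots H
          · exact Submodule.mem_sup_right
              (rootSpace_le_rootSum (h2 α hα β hβ hr) (lie_mem_rootSpace_add hz hw))
          · by_cases h0 : α + β = 0
            · obtain rfl : β = -α := (neg_eq_of_add_eq_zero_right h0).symm
              obtain ⟨c, hc⟩ := exists_smul_coroot_eq_lie (hA hα) hz hw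
              rw [hc]
              exact Submodule.mem_sup_left (Submodule.smul_mem _ _ (h3 α hα hβ))
            · rw [lie_eq_zero_of_notMem_roots hr h0 hz hw]
              exact zero_mem _
      have h4 : ⁅w, v⁆ ∈ U ⊔ rootSum H A := this hv
      change ⁅v, w⁆ ∈ U ⊔ rootSum H A
      rw [← lie_skew]
      exact neg_mem h4
    exact sup_le hv1 hv2 hu
  exact key y hy x hx

/-- A Lie algebra that embeds into the sum of the Cartan subalgebra and of root spaces for roots
that are positive at some element is solvable. -/
theorem isSolvable_of_pos {M : Type*} [LieRing M] [LieAlgebra ℂ M] (f : M →ₗ⁅ℂ⁆ L)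
    (hf : Function.Injective f) {A : Set (Module.Dual ℂ H)} (hA : A ⊆ roots H) (h : H)
    (hpos : ∀ α ∈ A, 0 < (α h).re) (hfA : ∀ x, f x ∈ H.toSubmodule ⊔ rootSum H A) :
    LieAlgebra.IsSolvable M := by
  obtain ⟨ε, hε, hεA⟩ : ∃ ε : ℝ, 0 < ε ∧ ∀ α ∈ A, ε ≤ (α h).re := by
    rcases A.eq_empty_or_nonempty with rfl | hne
    · exact ⟨1, one_pos, by simp⟩
    · obtain ⟨α, hα, hmin⟩ := Set.exists_min_image A (fun α => (α h).re)
        (finite_roots.subset hA) hne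
      exact ⟨(α h).re, hpos α hα, hmin⟩
  obtain ⟨K, hK⟩ : ∃ K : ℕ, ∀ α ∈ roots H, (α h).re < K * ε := by
    rcases (roots H).eq_empty_or_nonempty with he | hne
    · exact ⟨1, by simp [he]⟩
    · obtain ⟨α, hα, hmax⟩ := Set.exists_max_image (roots H) (fun α => (α h).re)
        finite_roots hne
      obtain ⟨K, hK⟩ := exists_nat_gt ((α h).re / ε)
      rw [div_lt_iff₀ hε] at hK
      exact ⟨K, fun β hβ => (hmax β hβ).trans_lt hK⟩
  -- Filter by the value at `h`, in steps of the least value `ε` on `A`. Brackets add degrees, and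
  -- `K` is chosen so that no root reaches `K * ε`.
  let V : ℕ → Submodule ℂ L := fun n => rootSum H {α ∈ roots H | n * ε ≤ (α h).re}
  have hmono : ∀ m n : ℕ, m ≤ n → V n ≤ V m := by
    intro m n hmn
    refine rootSum_mono fun α hα => ⟨hα.1, le_trans ?_ hα.2⟩
    have : (m : ℝ) ≤ n := by exact_mod_cast hmn
    exact mul_le_mul_of_nonneg_right this hε.le
  have hVlie : ∀ m n : ℕ, 0 < m → ∀ x ∈ V m, ∀ y ∈ V n, ⁅x, y⁆ ∈ V (m + n) := by
    intro m n hm x hx y hy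
    have h1 : V n ≤ (V (m + n)).comap (ad ℂ L x : L →ₗ[ℂ] L) := by
      refine rootSum_le.2 fun β hβ w hw => ?_
      have h2 : V m ≤ (V (m + n)).comap (ad ℂ L w : L →ₗ[ℂ] L) := by
        refine rootSum_le.2 fun α hα z hz => ?_
        change ⁅w, z⁆ ∈ V (m + n)
        rw [← lie_skew]
        refine neg_mem ?_
        have h3 : ((m + n : ℕ) : ℝ) * ε ≤ ((α + β) h).re := by
          rw [LinearMap.add_apply, Complex.add_re, Nat.cast_add, add_mul]
          exact add_le_add hα.2 hβ.2
        have h0 : α + β ≠ 0 := by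
          intro h0
          rw [h0] at h3
          have : 0 < ((m + n : ℕ) : ℝ) * ε := by
            have : (0 : ℝ) < (m + n : ℕ) := by exact_mod_cast Nat.add_pos_left hm n
            positivity
          simp only [LinearMap.zero_apply, Complex.zero_re] at h3
          linarith
        by_cases hr : α + β ∈ roots H
        · exact rootSpace_le_rootSum
            (⟨hr, h3⟩ : α + β ∈ {α ∈ roots H | ((m + n : ℕ) : ℝ) * ε ≤ (α h).re})
            (lie_mem_rootSpace_add hz hw)
        · rw [lie_eq_zero_of_notMem_roots hr h0 hz hw]
          exact zero_mem _
      have h4 : ⁅w, x⁆ ∈ V (m + n) := h2 hx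
      change ⁅x, w⁆ ∈ V (m + n)
      rw [← lie_skew]
      exact neg_mem h4
    exact h1 hy
  have hAV : rootSum H A ≤ V 1 := rootSum_mono fun α hα => ⟨hA hα, by
    simpa using hεA α hα⟩
  have hD : ∀ k : ℕ, ∀ x ∈ derivedSeries ℂ M (k + 1), f x ∈ V (k + 1) := by
    intro k
    have hstep : ∀ (k n : ℕ), (∀ x ∈ derivedSeries ℂ M k, ∀ y ∈ derivedSeries ℂ M k,
        f ⁅x, y⁆ ∈ V n) → ∀ x ∈ derivedSeries ℂ M (k + 1), f x ∈ V n := by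
      intro k n hk x hx
      rw [derivedSeries_def, derivedSeriesOfIdeal_succ, ← LieSubmodule.mem_toSubmodule,
        LieSubmodule.lieIdeal_oper_eq_linear_span'] at hx
      have : Submodule.span ℂ {⁅x, y⁆ | (x ∈ derivedSeries ℂ M k) (y ∈ derivedSeries ℂ M k)}
          ≤ (V n).comap (f : M →ₗ[ℂ] L) := by
        rw [Submodule.span_le]
        rintro _ ⟨a, ha, b, hb, rfl⟩
        exact hk a ha b hb
      exact this hx
    induction k with
    | zero =>
      refine hstep 0 1 fun x _ y _ => ?_
      rw [LieHom.map_lie]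
      obtain ⟨u, hu, r, hr, hx⟩ := Submodule.mem_sup.1 (hfA x)
      obtain ⟨v, hv, s, hs, hy⟩ := Submodule.mem_sup.1 (hfA y)
      rw [← hx, ← hy, add_lie, lie_add, lie_add, lie_cartan_eq_zero H hu hv, zero_add]
      refine add_mem (lie_mem_rootSum hu (hAV hs)) (add_mem ?_ ?_)
      · rw [← lie_skew]
        exact neg_mem (lie_mem_rootSum hv (hAV hr))
      · exact hmono 1 (1 + 1) (by omega) (hVlie 1 1 one_pos r (hAV hr) s (hAV hs))
    | succ k ih =>
      refine hstep (k + 1) (k + 1 + 1) fun x hx y hy => ?_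
      rw [LieHom.map_lie]
      exact hmono _ _ (by omega) (hVlie (k + 1) (k + 1) (by omega) _ (ih x hx) _ (ih y hy))
  refine LieAlgebra.IsSolvable.mk (R := ℂ) (k := K + 1) ?_
  rw [LieSubmodule.eq_bot_iff]
  intro x hx
  have hx1 := hmono K (K + 1) (by omega) (hD K x hx)
  have hV0 : V K = ⊥ := by
    rw [eq_bot_iff]
    refine rootSum_le.2 fun α hα => ?_
    exact absurd hα.2 (not_le.2 (hK α hα.1))
  rw [hV0, Submodule.mem_bot] at hx1
  exact hf (by rw [hx1, map_zero])

/-- A lexicographic order: take `N • h + g` with `g` regular and `N` so large that `h` decides the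
sign wherever it is non-zero. The roots positive at `h'` then have root spaces inside `𝔮_h` whenever
they are strongly orthogonal to `Δ(𝔨)`. -/
theorem exists_regular_refining (h : H) :
    ∃ h' : H, (∀ α ∈ roots H, (α h').re ≠ 0) ∧
      ∀ α ∈ roots H, 0 < (α h').re → 0 ≤ (α h).re := by
  obtain ⟨g, -, hg⟩ := exists_regular (H := H)
  have hex : ∀ α ∈ roots H, ∃ n : ℕ, 0 < (α h).re → -(α g).re < n * (α h).re := by
    intro α _
    by_cases hp : 0 < (α h).re
    · obtain ⟨n, hn⟩ := exists_nat_gt (-(α g).re / (α h).re)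
      exact ⟨n, fun _ => (div_lt_iff₀ hp).1 hn⟩
    · exact ⟨0, fun h => absurd h hp⟩
  choose! n hn using hex
  let N : ℕ := (finite_roots (H := H)).toFinset.sup n
  have hval : ∀ α : Module.Dual ℂ H,
      (α ((N : ℂ) • h + g)).re = N * (α h).re + (α g).re := by
    intro α
    rw [map_add, map_smul, smul_eq_mul, Complex.add_re, ← Complex.ofReal_natCast,
      Complex.re_ofReal_mul]
  have hpos : ∀ α ∈ roots H, 0 < (α h).re → 0 < (α ((N : ℂ) • h + g)).re := by
    intro α hα hp
    have h1 : n α ≤ N := Finset.le_sup (f := n) ((Set.Finite.mem_toFinset _).2 hα)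
    have h2 : (n α : ℝ) ≤ N := by exact_mod_cast h1
    have h3 := hn α hα hp
    have h4 := mul_le_mul_of_nonneg_right h2 hp.le
    rw [hval]
    linarith
  have hneg : ∀ α ∈ roots H, (α h).re < 0 → (α ((N : ℂ) • h + g)).re < 0 := by
    intro α hα hp
    have := hpos (-α) (neg_mem_roots hα) (by simpa using hp)
    simpa only [LinearMap.neg_apply, Complex.neg_re, neg_pos] using this
  refine ⟨(N : ℂ) • h + g, fun α hα => ?_, fun α hα hp => ?_⟩
  · rcases lt_trichotomy (α h).re 0 with h1 | h1 | h1
    · exact (hneg α hα h1).ne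
    · rw [hval, h1, mul_zero, zero_add]
      exact hg α hα
    · exact (hpos α hα h1).ne'
  · by_contra! h1
    exact absurd hp (not_lt.2 (hneg α hα h1).le)

variable {l : LieSubalgebra ℂ L}

/-- The Cartan subalgebra acts on `C(𝔨_ss)` through `𝔥₁`. -/
theorem exists_h1_lie_eq {x : L} (hx : x ∈ H) :
    ∃ u ∈ h1 H l, ∀ y ∈ centK H l, ⁅x, y⁆ = ⁅u, y⁆ := by
  have hK : rootsK H l ⊆ roots H := fun _ h => h.1.1
  -- The removed part `u` is a combination of coroots of `𝔨`; these lie in `[𝔨, 𝔨]` and act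
  -- trivially on `C(𝔨_ss)`.
  obtain ⟨u, hu, h⟩ := exists_corootSpan_sub_mem_ker hK ⟨x, hx⟩
  refine ⟨x - u, mem_h1_iff.2 ⟨H.sub_mem hx u.2, h⟩, fun y hy => ?_⟩
  have : corootSpan (rootsK H l) ≤
      LinearMap.ker ((ad ℂ L y : L →ₗ[ℂ] L) ∘ₗ H.toSubmodule.subtype) := by
    refine Submodule.span_le.2 ?_
    rintro _ ⟨γ, hγ, rfl⟩
    change ⁅y, (coroot γ : L)⁆ = 0
    rw [← lie_skew, coroot_lie_centK hγ hy, neg_zero]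
  have h2 : ⁅y, (u : L)⁆ = 0 := this hu
  rw [sub_lie, ← lie_skew (u : L), h2, neg_zero, sub_zero]

theorem lie_mem_of_h1_le {s : LieSubalgebra ℂ L} (hs : s ≤ centK H l)
    (h1s : h1 H l ≤ s.toSubmodule) {x y : L} (hx : x ∈ H) (hy : y ∈ s) : ⁅x, y⁆ ∈ s := by
  obtain ⟨u, hu, h⟩ := exists_h1_lie_eq (l := l) hx
  rw [h y (hs hy)]
  exact s.lie_mem (h1s hu) hy

/-- The Borel subalgebra is `𝔥₁` plus the root spaces positive at a regular `h'`. A solvable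
subalgebra containing it contains `𝔥₁`, hence is `H`-stable and a sum of root spaces and a part of
`𝔥₁`; a further root would be opposite to one already present and produce an `sl₂`. -/
theorem isParabolicOf_of_eq {q : LieSubalgebra ℂ L} {h : H}
    (hq : q.toSubmodule = h1 H l ⊔ rootSum H {α ∈ rootsPerp H l | 0 ≤ (α h).re}) :
    IsParabolicOf (centK H l) q := by
  obtain ⟨h', hreg, hpos⟩ := exists_regular_refining h
  have hsub : rootsPerp H l ⊆ roots H := fun _ h => h.1
  let A : Set (Module.Dual ℂ H) := {α ∈ rootsPerp H l | 0 < (α h').re}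
  have hA : A ⊆ roots H := fun _ h => h.1.1
  have hqc : q ≤ centK H l := by
    rw [← LieSubalgebra.toSubmodule_le_toSubmodule, hq, centK_eq]
    exact sup_le_sup le_rfl (rootSum_mono (Set.sep_subset _ _))
  let B : LieSubalgebra ℂ L :=
    { h1 H l ⊔ rootSum H A with
      lie_mem' := fun {x y} hx hy => by
        refine lie_mem_sup_rootSum h1_le_cartan h1_le_cartan hA hA
          (fun β hβ => Or.inl hβ) (fun α hα β hβ hr => ⟨rootsPerp_add hα.1 hβ.1 hr, ?_⟩)
          (fun α hα hα' => ?_) hx hy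
        · rw [LinearMap.add_apply, Complex.add_re]
          exact add_pos hα.2 hβ.2
        · have h1 := hα.2
          have h2 := hα'.2
          rw [LinearMap.neg_apply, Complex.neg_re] at h2
          linarith }
  have hB : B.toSubmodule = h1 H l ⊔ rootSum H A := rfl
  have hBq : B ≤ q := by
    rw [← LieSubalgebra.toSubmodule_le_toSubmodule, hq, hB]
    exact sup_le_sup le_rfl (rootSum_mono fun α hα => ⟨hα.1, hpos α hα.1.1 hα.2⟩)
  refine ⟨hqc, B, ⟨⟨hBq.trans hqc, ?_⟩, ?_⟩, hBq⟩
  · refine isSolvable_of_pos B.incl Subtype.val_injective hA h' (fun α hα => hα.2) fun x => ?_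
    exact (sup_le_sup h1_le_cartan le_rfl :
      h1 H l ⊔ rootSum H A ≤ H.toSubmodule ⊔ rootSum H A) x.2
  · rintro s ⟨hsc, hss⟩ hBs
    have h1s : h1 H l ≤ s.toSubmodule :=
      le_trans (le_trans le_sup_left hB.ge) (LieSubalgebra.toSubmodule_le_toSubmodule _ _ |>.2 hBs)
    rw [← LieSubalgebra.toSubmodule_le_toSubmodule, hB]
    refine (le_h1_sup_rootSum (H := H) (fun x hx y hy => lie_mem_of_h1_le hsc h1s hx hy)
      hsc).trans (sup_le_sup le_rfl (rootSum_mono ?_))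
    rintro α ⟨hα, hαs⟩
    refine ⟨hα, ?_⟩
    by_contra hn
    have hlt : (α h').re < 0 := lt_of_le_of_ne (not_lt.1 hn) (hreg α hα.1)
    have hmem : -α ∈ A := ⟨neg_mem_rootsPerp hα, by simpa using hlt⟩
    refine not_isSolvable_of_rootSpace_le hα.1 hαs ?_ hss
    exact ((rootSpace_le_rootSum hmem).trans le_sup_right).trans
      (LieSubalgebra.toSubmodule_le_toSubmodule _ _ |>.2 hBs)

end Solvable

theorem isSl2Triple_of_injective {M N : Type*} [LieRing M] [LieAlgebra ℂ M] [LieRing N]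
    [LieAlgebra ℂ N] (f : M →ₗ⁅ℂ⁆ N) (hf : Function.Injective f) {h e e' : M}
    (t : IsSl2Triple (f h) (f e) (f e')) : IsSl2Triple h e e' where
  h_ne_zero h0 := t.h_ne_zero (by rw [h0, map_zero])
  lie_e_f := hf (by rw [LieHom.map_lie, t.lie_e_f])
  lie_h_e_nsmul := hf (by rw [LieHom.map_lie, t.lie_h_e_nsmul, map_nsmul])
  lie_h_f_nsmul := hf (by rw [LieHom.map_lie, t.lie_h_f_nsmul, map_neg, map_nsmul])

/-- The projection to a subalgebra along a complementary ideal is a homomorphism. -/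
theorem exists_projection {M : Type*} [LieRing M] [LieAlgebra ℂ M] (m : LieSubalgebra ℂ M)
    (R : LieIdeal ℂ M) (h : IsCompl m.toSubmodule R.toSubmodule) :
    ∃ π : M →ₗ⁅ℂ⁆ M, (∀ x, π x ∈ m) ∧ (∀ x, x - π x ∈ R) ∧
      ∀ x, ∀ a ∈ m, x - a ∈ R → π x = a := by
  let p : M →ₗ[ℂ] M := m.toSubmodule.subtype ∘ₗ Submodule.projectionOnto _ _ h
  have hp1 : ∀ x, p x ∈ m := fun x => (Submodule.projectionOnto _ _ h x).2
  have hp2 : ∀ x, x - p x ∈ R := by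
    intro x
    have : Submodule.projectionOnto _ _ h (x - p x) = 0 := by
      rw [map_sub, sub_eq_zero]
      exact (Submodule.projectionOnto_apply_left h
        (Submodule.projectionOnto _ _ h x)).symm
    exact (Submodule.projectionOnto_apply_eq_zero_iff h).1 this
  have hp3 : ∀ x, ∀ a ∈ m, x - a ∈ R → p x = a := by
    intro x a ha hxa
    have h1 : p x - a ∈ R := by
      have := R.toSubmodule.sub_mem hxa (hp2 x)
      rwa [sub_sub_sub_cancel_left] at this
    exact sub_eq_zero.1 (Submodule.disjoint_def.1 h.disjoint _ (m.sub_mem (hp1 x) ha) h1)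
  refine ⟨{ p with map_lie' := fun {x y} => hp3 _ _ (m.lie_mem (hp1 x) (hp1 y)) ?_ },
    hp1, hp2, hp3⟩
  have h1 : ⁅x, y⁆ - ⁅p x, p y⁆ = ⁅x - p x, y⁆ + ⁅p x, y - p y⁆ := by
    rw [sub_lie, lie_sub]
    abel
  change ⁅x, y⁆ - ⁅p x, p y⁆ ∈ R
  rw [h1]
  exact R.toSubmodule.add_mem (lie_mem_left ℂ M R _ _ (hp2 x)) (lie_mem_right ℂ M R _ _ (hp2 y))

/-! ### The radical and the Levi subalgebras of `𝔮_h`. -/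

section Levi

variable {L : Type*} [LieRing L] [LieAlgebra ℂ L] {H : LieSubalgebra ℂ L}
  [H.IsCartanSubalgebra]

variable (H) in
/-- The roots strongly orthogonal to `Δ(𝔨)` that vanish at `h`. -/
def zeroRoots (l : LieSubalgebra ℂ L) (h : H) : Set (Module.Dual ℂ H) :=
  {α ∈ rootsPerp H l | (α h).re = 0}

variable (H) in
/-- The roots strongly orthogonal to `Δ(𝔨)` that are positive at `h`. -/
def posRoots (l : LieSubalgebra ℂ L) (h : H) : Set (Module.Dual ℂ H) :=
  {α ∈ rootsPerp H l | 0 < (α h).re}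

variable (H) in
/-- The radical of `𝔮_h`. -/
def radSub (l : LieSubalgebra ℂ L) (h : H) : Submodule ℂ L :=
  (h1 H l ⊓ (⨅ α ∈ zeroRoots H l h, LinearMap.ker α).map H.toSubmodule.subtype) ⊔
    rootSum H (posRoots H l h)

variable {l : LieSubalgebra ℂ L} {h : H} {q : LieSubalgebra ℂ L}

theorem zeroRoots_subset : zeroRoots H l h ⊆ roots H := fun _ h => h.1.1

theorem posRoots_subset : posRoots H l h ⊆ roots H := fun _ h => h.1.1

theorem mem_h1_inf_iff {x : L} :
    x ∈ h1 H l ⊓ (⨅ α ∈ zeroRoots H l h, LinearMap.ker α).map H.toSubmodule.subtype ↔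
      x ∈ h1 H l ∧ ∃ hx : x ∈ H, ∀ α ∈ zeroRoots H l h, α ⟨x, hx⟩ = 0 := by
  rw [Submodule.mem_inf]
  refine and_congr_right fun _ => ?_
  simp only [Submodule.mem_map, Submodule.mem_iInf, LinearMap.mem_ker]
  constructor
  · rintro ⟨y, hy, rfl⟩
    exact ⟨y.2, hy⟩
  · rintro ⟨hx, h⟩
    exact ⟨⟨x, hx⟩, h, rfl⟩

theorem radSub_le
    (hq : q.toSubmodule = h1 H l ⊔ rootSum H {α ∈ rootsPerp H l | 0 ≤ (α h).re}) :
    radSub H l h ≤ q.toSubmodule := by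
  rw [hq]
  exact sup_le_sup inf_le_left (rootSum_mono fun α hα => ⟨hα.1, hα.2.le⟩)

variable [FiniteDimensional ℂ L] [LieAlgebra.HasCentralRadical ℂ L]

section Embedding

variable {M : Type*} [LieRing M] [LieAlgebra ℂ M] {f : M →ₗ⁅ℂ⁆ L}

/-- An ideal containing `e` contains `⁅e, f⁆`, then `f`, hence a whole `sl₂`. The formulation
through an embedding serves both `𝔮_h` and abstract Levi subalgebras. -/
theorem not_rootSpace_le_map_of_isSolvable (hf : Function.Injective f)
    {α : Module.Dual ℂ H} (hα : α ∈ roots H)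
    (h2 : (rootSpace H (-α : Module.Dual ℂ H)).toSubmodule ≤ (f : M →ₗ[ℂ] L).range)
    {J : LieIdeal ℂ M} (hJ : LieAlgebra.IsSolvable J) :
    ¬ (rootSpace H α).toSubmodule ≤ J.toSubmodule.map (f : M →ₗ[ℂ] L) := by
  intro h1
  obtain ⟨e, e', he, he', hee, ht⟩ := exists_isSl2Triple hα
  obtain ⟨x, hxJ, hx⟩ := h1 he
  obtain ⟨y, hy⟩ := h2 he'
  change f x = e at hx
  change f y = e' at hy
  have h3 : ⁅x, y⁆ ∈ J := lie_mem_left ℂ M J _ _ hxJ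
  have h4 : IsSl2Triple ⁅x, y⁆ x y := by
    refine isSl2Triple_of_injective f hf ?_
    rw [LieHom.map_lie, hx, hy, hee]
    exact ht
  have h5 : y ∈ J := by
    have h6 : ⁅⁅x, y⁆, y⁆ ∈ J := lie_mem_left ℂ M J _ _ h3
    rw [h4.lie_h_f_nsmul, ← Nat.cast_smul_eq_nsmul ℂ, ← smul_neg] at h6
    have h7 := J.smul_mem ((2 : ℂ)⁻¹) h6
    rw [smul_smul] at h7
    simpa using h7
  exact not_isSolvable_of_isSl2Triple
    (isSl2Triple_of_injective J.incl Subtype.val_injective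
      (h := (⟨⁅x, y⁆, h3⟩ : J)) (e := ⟨x, hxJ⟩) (e' := ⟨y, h5⟩) h4) hJ

theorem apply_eq_zero_of_mem_isSolvable (hf : Function.Injective f)
    {α : Module.Dual ℂ H} (hα : α ∈ roots H)
    (h1 : (rootSpace H α).toSubmodule ≤ (f : M →ₗ[ℂ] L).range)
    (h2 : (rootSpace H (-α : Module.Dual ℂ H)).toSubmodule ≤ (f : M →ₗ[ℂ] L).range)
    {J : LieIdeal ℂ M} (hJ : LieAlgebra.IsSolvable J) {x : M} (hxJ : x ∈ J) (hx : f x ∈ H) :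
    α ⟨f x, hx⟩ = 0 := by
  by_contra h0
  obtain ⟨e, he, he0⟩ := exists_ne_zero_of_mem_roots hα
  obtain ⟨y, hy⟩ := h1 he
  change f y = e at hy
  refine not_rootSpace_le_map_of_isSolvable hf hα h2 hJ
    (rootSpace_le_of_mem hα.1 he he0 ?_)
  refine ⟨(α ⟨f x, hx⟩)⁻¹ • ⁅x, y⁆, J.smul_mem _ (lie_mem_left ℂ M J _ _ hxJ), ?_⟩
  change f _ = e
  rw [map_smul, LieHom.map_lie, hy, lie_eq_smul_of_mem_rootSpace hα.1 he ⟨f x, hx⟩, smul_smul,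
    inv_mul_cancel₀ h0, one_smul]

end Embedding

theorem neg_mem_zeroRoots {α : Module.Dual ℂ H} (hα : α ∈ zeroRoots H l h) :
    -α ∈ zeroRoots H l h := by
  refine ⟨neg_mem_rootsPerp hα.1, ?_⟩
  rw [LinearMap.neg_apply, Complex.neg_re, hα.2, neg_zero]

theorem zeroRoots_add {α β : Module.Dual ℂ H} (hα : α ∈ zeroRoots H l h)
    (hβ : β ∈ zeroRoots H l h) (hr : α + β ∈ roots H) : α + β ∈ zeroRoots H l h := by
  refine ⟨rootsPerp_add hα.1 hβ.1 hr, ?_⟩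
  rw [LinearMap.add_apply, Complex.add_re, hα.2, hβ.2, add_zero]

theorem coroot_mem_h1 {α : Module.Dual ℂ H} (hα : α ∈ rootsPerp H l) :
    (coroot α : L) ∈ h1 H l := by
  rw [← cartan_inf_centK]
  exact ⟨coroot_mem_of_mem hα.1 (mem_rootsPerp_iff.1 hα).2
    (mem_rootsPerp_iff.1 (neg_mem_rootsPerp hα)).2, (coroot α).2⟩

variable (H) in
/-- The semisimple part of the Levi decomposition of `𝔮_h`. -/
noncomputable def leviSub (l : LieSubalgebra ℂ L) (h : H) : LieSubalgebra ℂ L :=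
  { (corootSpan (zeroRoots H l h)).map H.toSubmodule.subtype ⊔
      rootSum H (zeroRoots H l h) with
    lie_mem' := fun {x y} hx hy => by
      refine lie_mem_sup_rootSum ?_ ?_ zeroRoots_subset zeroRoots_subset
        (fun β hβ => Or.inl hβ) (fun α hα β hβ hr => zeroRoots_add hα hβ hr)
        (fun α hα _ => Submodule.mem_map_of_mem (f := H.toSubmodule.subtype)
          (coroot_mem_corootSpan hα)) hx hy
      all_goals exact Submodule.map_subtype_le _ _ }

theorem map_corootSpan_le : (corootSpan (zeroRoots H l h)).map H.toSubmodule.subtype ≤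
    h1 H l := by
  rw [corootSpan, Submodule.map_span, Submodule.span_le]
  rintro _ ⟨_, ⟨α, hα, rfl⟩, rfl⟩
  exact coroot_mem_h1 hα.1

theorem leviSub_le_cartan_sup :
    (leviSub H l h).toSubmodule ≤ H.toSubmodule ⊔ rootSum H (zeroRoots H l h) :=
  sup_le_sup (Submodule.map_subtype_le _ _) le_rfl

theorem rootSpace_le_leviSub {α : Module.Dual ℂ H} (hα : α ∈ zeroRoots H l h) :
    (rootSpace H α).toSubmodule ≤ (leviSub H l h).toSubmodule :=
  (rootSpace_le_rootSum hα).trans le_sup_right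

/-- The Cartan subalgebra acts on the semisimple part by inner derivations. -/
theorem exists_leviSub_lie_eq {x : L} (hx : x ∈ H) :
    ∃ u ∈ leviSub H l h, ∀ y ∈ leviSub H l h, ⁅x, y⁆ = ⁅u, y⁆ := by
  obtain ⟨u, hu, h0⟩ := exists_corootSpan_sub_mem_ker (zeroRoots_subset (l := l) (h := h)) ⟨x, hx⟩
  refine ⟨u, Submodule.mem_sup_left ⟨u, hu, rfl⟩, fun y hy => ?_⟩
  have : (leviSub H l h).toSubmodule ≤
      LinearMap.ker (ad ℂ L (x - u) : L →ₗ[ℂ] L) := by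
    refine sup_le ?_ (rootSum_le.2 fun α hα z hz => ?_)
    · rintro _ ⟨v, -, rfl⟩
      exact lie_cartan_eq_zero H (H.sub_mem hx u.2) v.2
    · change ⁅x - (u : L), z⁆ = 0
      have := lie_eq_smul_of_mem_rootSpace hα.1.1.1 hz (⟨x, hx⟩ - u)
      rw [h0 α hα, zero_smul] at this
      exact this
  have h2 : ⁅x - (u : L), y⁆ = 0 := this hy
  rwa [sub_lie, sub_eq_zero] at h2

theorem eq_zero_of_mem_leviSub {x : L} (hx : x ∈ leviSub H l h) (hxH : x ∈ H)
    (h0 : ∀ α ∈ zeroRoots H l h, α ⟨x, hxH⟩ = 0) : x = 0 := by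
  obtain ⟨u, hu, hux⟩ := mem_of_mem_cartan_of_mem_sup zeroRoots_subset
    (Submodule.map_subtype_le _ _) hxH hx
  obtain rfl : u = ⟨x, hxH⟩ := Subtype.ext hux
  exact congrArg Subtype.val (eq_zero_of_mem_corootSpan zeroRoots_subset hu h0)

theorem lie_cartan_mem_sup_rootSum {U : Submodule ℂ L} (hU : U ≤ H.toSubmodule)
    {A : Set (Module.Dual ℂ H)} {x y : L} (hx : x ∈ H) (hy : y ∈ U ⊔ rootSum H A) :
    ⁅x, y⁆ ∈ U ⊔ rootSum H A := by
  obtain ⟨u, hu, r, hr, rfl⟩ := Submodule.mem_sup.1 hy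
  rw [lie_add, lie_cartan_eq_zero H hx (hU hu), zero_add]
  exact Submodule.mem_sup_right (lie_mem_rootSum hx hr)

theorem le_centK_of_eq
    (hq : q.toSubmodule = h1 H l ⊔ rootSum H {α ∈ rootsPerp H l | 0 ≤ (α h).re}) :
    q ≤ centK H l := by
  rw [← LieSubalgebra.toSubmodule_le_toSubmodule, hq, centK_eq]
  exact sup_le_sup le_rfl (rootSum_mono (Set.sep_subset _ _))

theorem leviSub_le
    (hq : q.toSubmodule = h1 H l ⊔ rootSum H {α ∈ rootsPerp H l | 0 ≤ (α h).re}) :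
    leviSub H l h ≤ q := by
  rw [← LieSubalgebra.toSubmodule_le_toSubmodule, hq]
  exact sup_le_sup map_corootSpan_le (rootSum_mono fun α hα => ⟨hα.1, hα.2.ge⟩)

/-- Roots of `𝔮_h` that vanish at `h` also vanish on the Cartan part of `radSub`, which makes it an
ideal. It is solvable because its roots are positive at `h`. -/
theorem mem_radical_of_mem_radSub
    (hq : q.toSubmodule = h1 H l ⊔ rootSum H {α ∈ rootsPerp H l | 0 ≤ (α h).re})
    {x : q} (hx : (x : L) ∈ radSub H l h) :
    x ∈ radical ℂ q := by
  let J : LieIdeal ℂ q :=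
    { (radSub H l h).comap (q.toSubmodule.subtype) with
      lie_mem := fun {y z} hz => by
        change ⁅(y : L), (z : L)⁆ ∈ radSub H l h
        rw [← lie_skew]
        refine neg_mem (lie_mem_sup_rootSum (inf_le_left.trans h1_le_cartan) h1_le_cartan
          posRoots_subset (fun _ h => h.1.1) ?_ ?_ ?_ hz (hq.le y.2))
        · rintro β ⟨hβ, hβ0⟩
          rcases hβ0.lt_or_eq with h0 | h0
          · exact Or.inl ⟨hβ, h0⟩
          · refine Or.inr fun u hu => ?_
            obtain ⟨-, _, h4⟩ := mem_h1_inf_iff.1 hu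
            exact h4 β ⟨hβ, h0.symm⟩
        · intro α hα β hβ hr
          refine ⟨rootsPerp_add hα.1 hβ.1 hr, ?_⟩
          rw [LinearMap.add_apply, Complex.add_re]
          exact add_pos_of_pos_of_nonneg hα.2 hβ.2
        · intro α hα hα'
          have h1 := hα.2
          have h2 := hα'.2
          rw [LinearMap.neg_apply, Complex.neg_re] at h2
          linarith }
  have hJ : LieAlgebra.IsSolvable J := by
    refine isSolvable_of_pos (q.incl.comp J.incl)
      (Subtype.val_injective.comp Subtype.val_injective) (posRoots_subset (l := l)) h
      (fun α hα => hα.2) fun z => ?_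
    exact (sup_le_sup (inf_le_left.trans h1_le_cartan) le_rfl :
      radSub H l h ≤ H.toSubmodule ⊔ rootSum H (posRoots H l h)) z.2
  exact (LieIdeal.solvable_iff_le_radical ℂ q J).1 hJ hx

/-- The radical is stable under `H`, which acts through `𝔥₁`, so it splits into root spaces and a
Cartan part. It contains no root space of a root vanishing at `h`, whose negative is also present,
and its Cartan part is killed by those roots. -/
theorem mem_radSub_of_mem_radical
    (hq : q.toSubmodule = h1 H l ⊔ rootSum H {α ∈ rootsPerp H l | 0 ≤ (α h).re})
    {x : q} (hx : x ∈ radical ℂ q) : (x : L) ∈ radSub H l h := by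
  have hr : LieAlgebra.IsSolvable (radical ℂ q) := inferInstance
  have hle : ∀ α ∈ zeroRoots H l h,
      (rootSpace H α).toSubmodule ≤ (q.incl : q →ₗ[ℂ] L).range := fun α hα z hz =>
    ⟨⟨z, leviSub_le hq (rootSpace_le_leviSub hα hz)⟩, rfl⟩
  let W : Submodule ℂ L := (radical ℂ q).toSubmodule.map (q.incl : q →ₗ[ℂ] L)
  have hWq : W ≤ q.toSubmodule := by
    rintro _ ⟨z, -, rfl⟩
    exact z.2
  have hW : ∀ h ∈ H, ∀ x ∈ W, ⁅h, x⁆ ∈ W := by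
    rintro y hy _ ⟨z, hz, rfl⟩
    obtain ⟨u, hu, h0⟩ := exists_h1_lie_eq (l := l) hy
    refine ⟨⁅(⟨u, hq.ge (Submodule.mem_sup_left hu)⟩ : q), z⁆,
      lie_mem_right ℂ q _ _ _ hz, ?_⟩
    exact (h0 z (le_centK_of_eq hq z.2)).symm
  have hxW : (x : L) ∈ W := ⟨x, hx, rfl⟩
  refine (?_ : W ≤ radSub H l h) hxW
  refine (le_cartan_sup_rootSum hW).trans (sup_le_sup ?_ (rootSum_mono ?_))
  · rintro _ ⟨⟨z, hz, rfl⟩, hzH⟩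
    refine mem_h1_inf_iff.2 ⟨?_, hzH, fun α hα => ?_⟩
    · rw [← cartan_inf_centK]
      exact ⟨le_centK_of_eq hq z.2, hzH⟩
    · exact apply_eq_zero_of_mem_isSolvable (f := q.incl) Subtype.val_injective hα.1.1
        (hle α hα) (hle _ (neg_mem_zeroRoots hα)) hr hz hzH
  · rintro α ⟨hα, hαW⟩
    have hαQ := mem_of_rootSpace_le_sup hα
      ((hαW.trans hWq).trans (hq.le.trans (sup_le_sup h1_le_cartan le_rfl)))
    refine ⟨hαQ.1, lt_of_le_of_ne hαQ.2 fun h0 => ?_⟩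
    exact not_rootSpace_le_map_of_isSolvable (f := q.incl) Subtype.val_injective hα
      (hle _ (neg_mem_zeroRoots ⟨hαQ.1, h0.symm⟩)) hr hαW

theorem exists_mem_leviSub_of_mem_h1 {x : L} (hx : x ∈ h1 H l) :
    ∃ a ∈ leviSub H l h, a ∈ H ∧ x - a ∈ radSub H l h := by
  obtain ⟨u, hu, h0⟩ := exists_corootSpan_sub_mem_ker (zeroRoots_subset (l := l) (h := h))
    ⟨x, h1_le_cartan hx⟩
  have hu1 : (u : L) ∈ (corootSpan (zeroRoots H l h)).map H.toSubmodule.subtype := ⟨u, hu, rfl⟩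
  refine ⟨u, Submodule.mem_sup_left hu1, u.2, Submodule.mem_sup_left (mem_h1_inf_iff.2
    ⟨Submodule.sub_mem _ hx (map_corootSpan_le hu1), H.sub_mem (h1_le_cartan hx) u.2, h0⟩)⟩

theorem le_leviSub_sup_radSub
    (hq : q.toSubmodule = h1 H l ⊔ rootSum H {α ∈ rootsPerp H l | 0 ≤ (α h).re}) :
    q.toSubmodule ≤ (leviSub H l h).toSubmodule ⊔ radSub H l h := by
  rw [hq]
  refine sup_le ?_ (rootSum_le.2 fun α hα => ?_)
  · intro x hx
    obtain ⟨a, ha, -, hxa⟩ := exists_mem_leviSub_of_mem_h1 (h := h) hx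
    exact Submodule.mem_sup.2 ⟨a, ha, _, hxa, by abel⟩
  · rcases hα.2.lt_or_eq with h0 | h0
    · exact ((rootSpace_le_rootSum (⟨hα.1, h0⟩ : α ∈ posRoots H l h)).trans
        le_sup_right).trans le_sup_right
    · exact (rootSpace_le_leviSub ⟨hα.1, h0.symm⟩).trans le_sup_left

theorem disjoint_leviSub_radSub : Disjoint (leviSub H l h).toSubmodule (radSub H l h) := by
  let U := h1 H l ⊓ (⨅ α ∈ zeroRoots H l h, LinearMap.ker α).map H.toSubmodule.subtype
  have hU : U ≤ H.toSubmodule := inf_le_left.trans h1_le_cartan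
  let W := (leviSub H l h).toSubmodule ⊓ radSub H l h
  have hWH : W ≤ H.toSubmodule := by
    refine (le_cartan_sup_rootSum (H := H) (W := W) fun y hy w hw =>
      ⟨lie_cartan_mem_sup_rootSum (Submodule.map_subtype_le _ _) hy hw.1,
        lie_cartan_mem_sup_rootSum hU hy hw.2⟩).trans
      (sup_le inf_le_right (rootSum_le.2 ?_))
    rintro α ⟨hα, hαW⟩
    have h1 := mem_of_rootSpace_le_sup hα ((hαW.trans inf_le_left).trans leviSub_le_cartan_sup)
    have h2 := mem_of_rootSpace_le_sup hα ((hαW.trans inf_le_right).trans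
      (sup_le_sup hU le_rfl))
    exact absurd h1.2 h2.2.ne'
  rw [Submodule.disjoint_def]
  intro x hx hxr
  have hxH : x ∈ H := hWH ⟨hx, hxr⟩
  obtain ⟨-, _, h3⟩ := mem_h1_inf_iff.1 (mem_of_mem_cartan_of_mem_sup posRoots_subset hU hxH hxr)
  exact eq_zero_of_mem_leviSub hx hxH h3

theorem isCompl_leviSub_radical
    (hq : q.toSubmodule = h1 H l ⊔ rootSum H {α ∈ rootsPerp H l | 0 ≤ (α h).re}) :
    IsCompl ((leviSub H l h).comap q.incl).toSubmodule (radical ℂ q).toSubmodule := by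
  constructor
  · rw [Submodule.disjoint_def]
    intro x hx hxr
    exact Subtype.ext (Submodule.disjoint_def.1 (disjoint_leviSub_radSub (l := l) (h := h)) _ hx
      (mem_radSub_of_mem_radical hq hxr))
  · rw [codisjoint_iff, eq_top_iff]
    rintro x -
    obtain ⟨a, ha, r, hr, har⟩ := Submodule.mem_sup.1 (le_leviSub_sup_radSub hq x.2)
    exact Submodule.mem_sup.2 ⟨⟨a, leviSub_le hq ha⟩, ha, ⟨r, radSub_le hq hr⟩,
      mem_radical_of_mem_radSub hq hr, Subtype.ext har⟩

/-- Every Levi subalgebra is isomorphic to the standard one, in a way that is compatible with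
the Cartan subalgebra. -/
theorem exists_levi_hom
    (hq : q.toSubmodule = h1 H l ⊔ rootSum H {α ∈ rootsPerp H l | 0 ≤ (α h).re})
    {m : LieSubalgebra ℂ q} (hm : IsLevi m) :
    ∃ f : m →ₗ⁅ℂ⁆ L, Function.Injective f ∧
      (f : m →ₗ[ℂ] L).range = (leviSub H l h).toSubmodule ∧
      ∀ t : m, ((t : q) : L) ∈ H → f t ∈ H := by
  -- Project along the radical onto the standard complement: two complements of the same ideal are
  -- thereby identified.
  obtain ⟨π, h1, h2, h3⟩ := exists_projection _ _ (isCompl_leviSub_radical hq)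
  refine ⟨(q.incl.comp π).comp m.incl, ?_, ?_, ?_⟩
  · rw [injective_iff_map_eq_zero]
    intro x hx
    have hx0 : π x = 0 := Subtype.ext hx
    have hxr := h2 x
    rw [hx0, sub_zero] at hxr
    exact Subtype.ext (Submodule.disjoint_def.1 hm.disjoint _ x.2 hxr)
  · apply le_antisymm
    · rintro _ ⟨x, rfl⟩
      exact h1 x
    · intro y hy
      let z : q := ⟨y, leviSub_le hq hy⟩
      obtain ⟨a, ha, r, hr, har⟩ := Submodule.mem_sup.1
        (show z ∈ m.toSubmodule ⊔ (radical ℂ q).toSubmodule from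
          hm.codisjoint.eq_top ▸ Submodule.mem_top)
      refine ⟨⟨a, ha⟩, ?_⟩
      have : π a = z := h3 a z hy (by
        rw [← har, sub_add_cancel_left]
        exact neg_mem hr)
      exact congrArg Subtype.val this
  · intro t ht
    have ht1 : ((t : q) : L) ∈ RootSub.h1 H l := by
      rw [← cartan_inf_centK]
      exact ⟨le_centK_of_eq hq (t : q).2, ht⟩
    obtain ⟨a, ha, haH, har⟩ := exists_mem_leviSub_of_mem_h1 (h := h) ht1
    have : π t = ⟨a, leviSub_le hq ha⟩ := h3 t _ ha (mem_radical_of_mem_radSub hq har)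
    change ((π t : q) : L) ∈ H
    rw [this]
    exact haH

/-- The image of a solvable ideal is `H`-stable and contains no root space, so it lies in `H` and is
killed by all roots of the Levi part. Such an element of the coroot span is zero. -/
theorem hasTrivialRadical_of_range_eq_leviSub {M : Type*} [LieRing M] [LieAlgebra ℂ M]
    {f : M →ₗ⁅ℂ⁆ L} (hf : Function.Injective f)
    (hr : (f : M →ₗ[ℂ] L).range = (leviSub H l h).toSubmodule) :
    LieAlgebra.HasTrivialRadical ℂ M := by
  rw [hasTrivialRadical_iff_no_solvable_ideals]
  intro J hJ
  have hle : ∀ α ∈ zeroRoots H l h, (rootSpace H α).toSubmodule ≤ (f : M →ₗ[ℂ] L).range :=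
    fun α hα => hr ▸ rootSpace_le_leviSub hα
  let W : Submodule ℂ L := J.toSubmodule.map (f : M →ₗ[ℂ] L)
  have hWr : W ≤ (leviSub H l h).toSubmodule := hr ▸ LinearMap.map_le_range
  have hWH : W ≤ H.toSubmodule := by
    refine (le_cartan_sup_rootSum (H := H) (W := W) ?_).trans
      (sup_le inf_le_right (rootSum_le.2 ?_))
    · rintro y hy _ ⟨z, hz, rfl⟩
      obtain ⟨u, hu, h0⟩ := exists_leviSub_lie_eq (l := l) (h := h) hy
      obtain ⟨t, rfl⟩ := hr.ge hu
      refine ⟨⁅t, z⁆, lie_mem_right ℂ M J _ _ hz, ?_⟩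
      change f ⁅t, z⁆ = ⁅y, f z⁆
      rw [LieHom.map_lie]
      exact (h0 _ (hr.le ⟨z, rfl⟩)).symm
    · rintro α ⟨hα, hαW⟩
      have hα0 := mem_of_rootSpace_le_sup hα ((hαW.trans hWr).trans leviSub_le_cartan_sup)
      exact absurd hαW
        (not_rootSpace_le_map_of_isSolvable hf hα (hle _ (neg_mem_zeroRoots hα0)) hJ)
  rw [LieSubmodule.eq_bot_iff]
  intro x hx
  have hxH : f x ∈ H := hWH ⟨x, hx, rfl⟩
  refine hf ?_
  rw [map_zero]
  exact eq_zero_of_mem_leviSub (hWr ⟨x, hx, rfl⟩) hxH fun α hα =>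
    apply_eq_zero_of_mem_isSolvable hf hα.1.1 (hle α hα) (hle _ (neg_mem_zeroRoots hα)) hJ hx hxH

end Levi

/-! ### Types `A` and `C`: invariance under linear embeddings, and irreducibility. -/

section Types

variable {V W : Type*} [AddCommGroup V] [Module ℂ V] [AddCommGroup W] [Module ℂ W]

theorem IsTypeA.image {Φ : Set V} (h : IsTypeA Φ) (r : V →ₗ[ℂ] W)
    (hr : Set.InjOn r (Submodule.span ℂ Φ)) : IsTypeA (r '' Φ) := by
  obtain ⟨n, hn, ε, hε, rfl⟩ := h
  refine ⟨n, hn, fun i => r (ε i), ?_, ?_⟩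
  · rw [affineIndependent_iff_linearIndependent_vsub ℂ _ 0] at hε ⊢
    have h1 := hε.map_injOn r (hr.mono (Submodule.span_mono ?_))
    · convert h1 using 2
      exact (map_sub r _ _).symm
    · rintro _ ⟨i, rfl⟩
      exact ⟨i, 0, i.2, rfl⟩
  · ext w
    constructor
    · rintro ⟨_, ⟨i, j, hij, rfl⟩, rfl⟩
      exact ⟨i, j, hij, map_sub r _ _⟩
    · rintro ⟨i, j, hij, rfl⟩
      exact ⟨_, ⟨i, j, hij, rfl⟩, map_sub r _ _⟩

theorem IsTypeC.image {Φ : Set V} (h : IsTypeC Φ) (r : V →ₗ[ℂ] W)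
    (hr : Set.InjOn r (Submodule.span ℂ Φ)) : IsTypeC (r '' Φ) := by
  obtain ⟨n, hn, ε, hε, rfl⟩ := h
  set Φ := {v | v ≠ 0 ∧ ∃ i j, v = ε i + ε j ∨ v = ε i - ε j ∨ v = -(ε i + ε j)} with hΦ
  have hz : ∀ v ∈ Φ,
      r v ≠ 0 := fun v hv h0 =>
    hv.1 (hr (Submodule.subset_span hv) (zero_mem _) (by rw [h0, map_zero]))
  refine ⟨n, hn, fun i => r (ε i), ?_, ?_⟩
  · refine hε.map_injOn r (hr.mono (Submodule.span_le.2 ?_))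
    rintro _ ⟨i, rfl⟩
    have h2 : ε i + ε i ≠ 0 := by
      rw [← two_smul ℂ]
      exact smul_ne_zero two_ne_zero (hε.ne_zero i)
    have h3 := Submodule.smul_mem _ (2 : ℂ)⁻¹ (Submodule.subset_span (R := ℂ)
      (show ε i + ε i ∈ Φ from ⟨h2, i, i, Or.inl rfl⟩))
    rw [← two_smul ℂ, smul_smul] at h3
    simpa using h3
  · ext w
    constructor
    · rintro ⟨v, hv, rfl⟩
      refine ⟨hz v hv, ?_⟩
      obtain ⟨-, i, j, h | h | h⟩ := hv
      · exact ⟨i, j, Or.inl (by rw [h, map_add])⟩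
      · exact ⟨i, j, Or.inr (Or.inl (by rw [h, map_sub]))⟩
      · exact ⟨i, j, Or.inr (Or.inr (by rw [h, map_neg, map_add]))⟩
    · rintro ⟨h0, i, j, h⟩
      have key : ∀ v, w = r v → (v = ε i + ε j ∨ v = ε i - ε j ∨ v = -(ε i + ε j)) →
          w ∈ r '' Φ := by
        rintro v rfl hv
        exact ⟨v, ⟨fun hv0 => h0 (by rw [hv0, map_zero]), i, j, hv⟩, rfl⟩
      rcases h with h | h | h
      · exact key _ (by rw [h, map_add]) (Or.inl rfl)
      · exact key _ (by rw [h, map_sub]) (Or.inr (Or.inl rfl))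
      · exact key _ (by rw [h, map_neg, map_add]) (Or.inr (Or.inr rfl))

theorem isTypeA_or_isTypeC_image_iff {Φ : Set V} (r : V →ₗ[ℂ] W)
    (hr : Set.InjOn r (Submodule.span ℂ Φ)) :
    (IsTypeA (r '' Φ) ∨ IsTypeC (r '' Φ)) ↔ (IsTypeA Φ ∨ IsTypeC Φ) := by
  refine ⟨fun h => ?_, fun h => h.imp (fun h => h.image r hr) fun h => h.image r hr⟩
  have hker : LinearMap.ker (r.domRestrict (Submodule.span ℂ Φ)) = ⊥ :=
    LinearMap.ker_eq_bot.2 fun x y hxy => Subtype.ext (hr x.2 y.2 hxy)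
  obtain ⟨g, hg⟩ := LinearMap.exists_leftInverse_of_injective _ hker
  let s : W →ₗ[ℂ] V := (Submodule.span ℂ Φ).subtype ∘ₗ g
  have hs : ∀ v ∈ Submodule.span ℂ Φ, s (r v) = v := fun v hv =>
    congrArg Subtype.val (LinearMap.congr_fun hg ⟨v, hv⟩)
  have hΦ : s '' (r '' Φ) = Φ := by
    rw [Set.image_image]
    exact (Set.image_congr fun v hv => hs v (Submodule.subset_span hv)).trans (Set.image_id' Φ)
  have hinj : Set.InjOn s (Submodule.span ℂ (r '' Φ)) := by
    rw [Submodule.span_image]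
    rintro _ ⟨v, hv, rfl⟩ _ ⟨w, hw, rfl⟩ hvw
    rw [hs v hv, hs w hw] at hvw
    rw [hvw]
  rw [← hΦ]
  exact h.imp (fun h => h.image s hinj) fun h => h.image s hinj

/-- Root systems of type `A` are irreducible. -/
theorem IsTypeA.subset_of_closed {Φ Ψ : Set V} (h : IsTypeA Φ) (hne : (Φ ∩ Ψ).Nonempty)
    (hneg : ∀ α ∈ Ψ, -α ∈ Ψ)
    (hadd : ∀ α ∈ Ψ, ∀ β ∈ Φ, α + β ∈ Φ → α + β ∈ Ψ) : Φ ⊆ Ψ := by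
  obtain ⟨n, -, ε, -, rfl⟩ := h
  obtain ⟨_, ⟨i, j, hij, rfl⟩, hα⟩ := hne
  have h1 : ∀ i j k, i ≠ j → i ≠ k → ε i - ε j ∈ Ψ → ε i - ε k ∈ Ψ := by
    intro i j k hij hik h
    by_cases hjk : j = k
    · exact hjk ▸ h
    · have := hadd _ h (ε j - ε k) ⟨j, k, hjk, rfl⟩
        (by rw [sub_add_sub_cancel]; exact ⟨i, k, hik, rfl⟩)
      rwa [sub_add_sub_cancel] at this
  have hneg' : ∀ i j, ε i - ε j ∈ Ψ → ε j - ε i ∈ Ψ := fun i j h => by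
    have := hneg _ h
    rwa [neg_sub] at this
  rintro _ ⟨a, b, hab, rfl⟩
  by_cases haj : a = j
  · subst haj
    exact h1 _ _ _ hij.symm hab (hneg' _ _ hα)
  · by_cases hia : i = a
    · subst hia
      exact h1 _ _ _ hij hab hα
    · exact h1 a i b (Ne.symm hia) hab (hneg' _ _ (h1 i j a hij hia hα))

/-- Root systems of type `C` are irreducible. -/
theorem IsTypeC.subset_of_closed {Φ Ψ : Set V} (h : IsTypeC Φ) (hne : (Φ ∩ Ψ).Nonempty)
    (hneg : ∀ α ∈ Ψ, -α ∈ Ψ)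
    (hadd : ∀ α ∈ Ψ, ∀ β ∈ Φ, α + β ∈ Φ → α + β ∈ Ψ) : Φ ⊆ Ψ := by
  obtain ⟨n, -, ε, hε, rfl⟩ := h
  have h2 : ∀ i, ε i + ε i ≠ 0 := fun i => by
    rw [← two_smul ℂ]
    exact smul_ne_zero two_ne_zero (hε.ne_zero i)
  have hs : ∀ i j, i ≠ j → ε i - ε j ≠ 0 := fun i j hij h =>
    hij (hε.injective (sub_eq_zero.1 h))
  have ha : ∀ i j, ε i + ε j ≠ 0 := by
    intro i j h
    by_cases hij : i = j
    · exact h2 i (by rw [← hij] at h; exact h)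
    · have := (LinearIndepOn.pair_iff ε hij).1 (hε.linearIndepOn _) 1 1 (by simpa using h)
      exact one_ne_zero this.1
  set Φ := {v | v ≠ 0 ∧ ∃ i j, v = ε i + ε j ∨ v = ε i - ε j ∨ v = -(ε i + ε j)} with hΦ
  have hP : ∀ i j, ε i + ε j ∈ Φ := fun i j => ⟨ha i j, i, j, Or.inl rfl⟩
  have hM : ∀ i j, i ≠ j → ε i - ε j ∈ Φ := fun i j hij => ⟨hs i j hij, i, j, Or.inr (Or.inl rfl)⟩
  have hN : ∀ i j, -(ε i + ε j) ∈ Φ := fun i j =>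
    ⟨neg_ne_zero.2 (ha i j), i, j, Or.inr (Or.inr rfl)⟩
  have hadd' : ∀ α ∈ Ψ, ∀ β ∈ Φ, ∀ γ ∈ Φ, α + β = γ → γ ∈ Ψ := by
    rintro α hα β hβ γ hγ rfl
    exact hadd α hα β hβ hγ
  have hplus : ∀ i j, ε i + ε j ∈ Ψ → ε i + ε i ∈ Ψ := by
    intro i j h
    by_cases hij : i = j
    · subst hij
      exact h
    · exact hadd' _ h _ (hM i j hij) _ (hP i i) (by abel)
  -- From any root of type `C` a long root `2 ε i` is reached, and from it every other root.
  obtain ⟨i, hi⟩ : ∃ i, ε i + ε i ∈ Ψ := by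
    obtain ⟨v, ⟨hv0, i, j, rfl | rfl | rfl⟩, hv⟩ := hne
    · exact ⟨i, hplus i j hv⟩
    · exact ⟨i, hadd' _ hv _ (hP i j) _ (hP i i) (by abel)⟩
    · exact ⟨i, hplus i j (by simpa only [neg_neg] using hneg _ hv)⟩
  have hstep : ∀ i j, ε i + ε i ∈ Ψ → ε i + ε j ∈ Ψ := by
    intro i j h
    by_cases hij : i = j
    · subst hij
      exact h
    · exact hadd' _ h _ (hM j i (Ne.symm hij)) _ (hP i j) (by abel)
  have hall : ∀ a b, ε a + ε b ∈ Ψ := fun a b =>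
    hstep a b (hplus a i (by rw [add_comm]; exact hstep i a hi))
  rintro v ⟨hv0, a, b, rfl | rfl | rfl⟩
  · exact hall a b
  · exact hadd' _ (hall a a) _ (hN a b) _ ⟨hv0, a, b, Or.inr (Or.inl rfl)⟩ (by abel)
  · exact hneg _ (hall a b)

end Types

/-! ### Cartan subalgebras and roots of an embedded `H`-stable subalgebra. -/

section Embedding

variable {L : Type*} [LieRing L] [LieAlgebra ℂ L] (H : LieSubalgebra ℂ L)
  [H.IsCartanSubalgebra]
  {M : Type*} [LieRing M] [LieAlgebra ℂ M]

/-- The roots whose root spaces are contained in the image of `f`. -/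
def imageRoots (f : M →ₗ⁅ℂ⁆ L) : Set (Module.Dual ℂ H) :=
  {α ∈ roots H | (rootSpace H α).toSubmodule ≤ (f : M →ₗ[ℂ] L).range}

variable {H}

theorem imageRoots_subset {f : M →ₗ⁅ℂ⁆ L} : imageRoots H f ⊆ roots H := Set.sep_subset _ _

theorem mem_range_comp_incl {f : M →ₗ⁅ℂ⁆ L} {I : LieIdeal ℂ M} {y : L} :
    y ∈ (f.comp I.incl : I →ₗ[ℂ] L).range ↔ ∃ x ∈ I, f x = y := by
  constructor
  · rintro ⟨x, rfl⟩
    exact ⟨x, x.2, rfl⟩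
  · rintro ⟨x, hx, rfl⟩
    exact ⟨⟨x, hx⟩, rfl⟩

variable [FiniteDimensional ℂ L] [LieAlgebra.HasCentralRadical ℂ L]

theorem range_le_cartan_sup {f : M →ₗ⁅ℂ⁆ L}
    (hst : ∀ x ∈ H, ∀ y ∈ (f : M →ₗ[ℂ] L).range, ⁅x, y⁆ ∈ (f : M →ₗ[ℂ] L).range) :
    (f : M →ₗ[ℂ] L).range ≤
      ((f : M →ₗ[ℂ] L).range ⊓ H.toSubmodule) ⊔ rootSum H (imageRoots H f) :=
  le_cartan_sup_rootSum hst

/-- The preimage of a Cartan subalgebra under an embedding with stable image is a Cartan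
subalgebra. -/
theorem isCartanSubalgebra_comap {f : M →ₗ⁅ℂ⁆ L} (hf : Function.Injective f)
    (hst : ∀ x ∈ H, ∀ y ∈ (f : M →ₗ[ℂ] L).range, ⁅x, y⁆ ∈ (f : M →ₗ[ℂ] L).range)
    (hco : ∀ α ∈ imageRoots H f, (coroot α : L) ∈ (f : M →ₗ[ℂ] L).range) :
    (H.comap f).IsCartanSubalgebra where
  nilpotent := by
    have : IsLieAbelian (H.comap f) := ⟨fun x y => by
      refine Subtype.ext (hf ?_)
      change f ⁅(x : M), (y : M)⁆ = f 0
      rw [map_zero, LieHom.map_lie]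
      exact lie_cartan_eq_zero H x.2 y.2⟩
    infer_instance
  self_normalizing := by
    refine le_antisymm ?_ (LieSubalgebra.le_normalizer _)
    let W : Submodule ℂ L := (H.comap f).normalizer.toSubmodule.map (f : M →ₗ[ℂ] L)
    have hmem : ∀ x, x ∈ (H.comap f).normalizer ↔ ∀ y, f y ∈ H → ⁅f x, f y⁆ ∈ H := by
      intro x
      rw [LieSubalgebra.mem_normalizer_iff]
      refine forall_congr' fun y => imp_congr Iff.rfl ?_
      rw [← LieHom.map_lie]
      exact Iff.rfl
    have hW : ∀ x ∈ H, ∀ y ∈ W, ⁅x, y⁆ ∈ W := by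
      rintro x hx _ ⟨y, hy, rfl⟩
      obtain ⟨z, hz⟩ := hst x hx (f y) ⟨y, rfl⟩
      change f z = ⁅x, f y⁆ at hz
      refine ⟨z, (hmem z).2 fun t ht => ?_, hz⟩
      rw [hz, lie_lie, lie_cartan_eq_zero H hx ht, lie_zero, sub_zero,
        lie_cartan_eq_zero H hx ((hmem y).1 hy t ht)]
      exact H.zero_mem
    -- If a root vector `f x` normalized the preimage of `H`, its bracket with the coroot, a
    -- non-zero multiple of `f x`, would lie in `H` and commute with the coroot, which forces `f x =
    -- 0`.
    have hWH : W ≤ H.toSubmodule := by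
      refine (le_cartan_sup_rootSum hW).trans (sup_le inf_le_right (rootSum_le.2 ?_))
      rintro α ⟨hα, hαW⟩
      exfalso
      have hα' : α ∈ imageRoots H f := ⟨hα, hαW.trans LinearMap.map_le_range⟩
      obtain ⟨t, ht⟩ := hco α hα'
      change f t = coroot α at ht
      obtain ⟨e, he, he0⟩ := exists_ne_zero_of_mem_roots hα
      obtain ⟨x, hx, rfl⟩ := hαW he
      have h1 : ⁅f x, f t⁆ ∈ H := (hmem x).1 hx t (ht ▸ (coroot α).2)
      have h2 : ⁅f t, f x⁆ = (2 : ℂ) • f x := by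
        rw [ht, ← root_apply_coroot hα]
        exact lie_eq_smul_of_mem_rootSpace hα.1 he _
      have h3 : ⁅f t, ⁅f x, f t⁆⁆ = 0 := lie_cartan_eq_zero H (ht ▸ (coroot α).2) h1
      rw [← lie_skew (f x) (f t), h2, lie_neg, lie_smul, h2, neg_eq_zero, smul_smul] at h3
      exact he0 ((smul_eq_zero.1 h3).resolve_left (by norm_num))
    intro x hx
    exact hWH ⟨x, hx, rfl⟩

/-- The roots of a subalgebra with stable image are the restrictions of the roots of the
ambient algebra. -/
theorem exists_roots_eq_image [FiniteDimensional ℂ M] [LieAlgebra.HasCentralRadical ℂ M]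
    {f : M →ₗ⁅ℂ⁆ L} (hf : Function.Injective f)
    (hst : ∀ x ∈ H, ∀ y ∈ (f : M →ₗ[ℂ] L).range, ⁅x, y⁆ ∈ (f : M →ₗ[ℂ] L).range)
    (hco : ∀ α ∈ imageRoots H f, (coroot α : L) ∈ (f : M →ₗ[ℂ] L).range)
    (T : LieSubalgebra ℂ M) [T.IsCartanSubalgebra] (hT : ∀ t ∈ T, f t ∈ H) :
    ∃ r : Module.Dual ℂ H →ₗ[ℂ] Module.Dual ℂ T,
      Set.InjOn r (Submodule.span ℂ (imageRoots H f)) ∧ roots T = r '' imageRoots H f := by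
  let j : T →ₗ[ℂ] H := ((f : M →ₗ[ℂ] L) ∘ₗ T.toSubmodule.subtype).codRestrict H.toSubmodule
    fun t => hT t t.2
  have hj : ∀ t : T, (j t : L) = f t := fun t => rfl
  -- Since `T` is self-normalizing and is mapped into the abelian `H`, it is the full preimage of
  -- `H`. It thus contains preimages of the relevant coroots.
  have hmem : ∀ x, f x ∈ H → x ∈ T := by
    intro x hx
    rw [← LieSubalgebra.IsCartanSubalgebra.self_normalizing (H := T),
      LieSubalgebra.mem_normalizer_iff]
    intro t ht
    have : ⁅x, t⁆ = 0 := hf (by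
      rw [LieHom.map_lie, map_zero]
      exact lie_cartan_eq_zero H hx (hT t ht))
    rw [this]
    exact T.zero_mem
  have hcoT : ∀ α ∈ imageRoots H f, ∃ t : T, j t = coroot α := by
    intro α hα
    obtain ⟨t, ht⟩ := hco α hα
    have ht' : f t = coroot α := ht
    exact ⟨⟨t, hmem t (ht' ▸ (coroot α).2)⟩, Subtype.ext ht'⟩
  have hroot : ∀ α ∈ imageRoots H f, ∀ x, f x ∈ rootSpace H α →
      x ∈ rootSpace T (j.dualMap α) := by
    intro α hα x hx
    refine weightSpace_le_genWeightSpace M _ ((mem_weightSpace _ _).2 fun t => hf ?_)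
    change f ⁅(t : M), x⁆ = f (α (j t) • x)
    rw [LieHom.map_lie, map_smul]
    exact lie_eq_smul_of_mem_rootSpace hα.1.1 hx (j t)
  have hsub : j.dualMap '' imageRoots H f ⊆ roots T := by
    rintro _ ⟨α, hα, rfl⟩
    obtain ⟨t, ht⟩ := hcoT α hα
    obtain ⟨e, he, he0⟩ := exists_ne_zero_of_mem_roots hα.1
    obtain ⟨x, rfl⟩ := hα.2 he
    refine mem_roots_of_mem_rootSpace (fun h0 => ?_) (hroot α hα x he)
      (fun h0 => he0 (by rw [h0, map_zero]))
    have h1 : α (j t) = 0 := LinearMap.congr_fun h0 t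
    rw [ht, root_apply_coroot hα.1] at h1
    exact two_ne_zero h1
  refine ⟨j.dualMap, ?_, (Set.Subset.antisymm ?_ hsub)⟩
  · intro v hv w hw hvw
    rw [← sub_eq_zero]
    refine eq_zero_of_mem_span_of_apply_coroot imageRoots_subset (Submodule.sub_mem _ hv hw)
      fun α hα => ?_
    obtain ⟨t, ht⟩ := hcoT α hα
    rw [← ht, LinearMap.sub_apply, sub_eq_zero]
    exact LinearMap.congr_fun hvw t
  -- The restricted root spaces and `T` already span `M`, so no other root can occur.
  · intro β hβ
    refine mem_of_rootSpace_le_sup hβ (le_trans le_top ?_)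
    rintro x -
    have h1 : (f : M →ₗ[ℂ] L).range ⊓ H.toSubmodule ⊔ rootSum H (imageRoots H f) ≤
        (T.toSubmodule ⊔ rootSum T (j.dualMap '' imageRoots H f)).map (f : M →ₗ[ℂ] L) := by
      refine sup_le ?_ (rootSum_le.2 fun α hα y hy => ?_)
      · rintro _ ⟨⟨y, rfl⟩, hy⟩
        exact ⟨y, Submodule.mem_sup_left (hmem y hy), rfl⟩
      · obtain ⟨z, rfl⟩ := hα.2 hy
        exact ⟨z, Submodule.mem_sup_right (rootSpace_le_rootSum (Set.mem_image_of_mem _ hα)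
          (hroot α hα z hy)), rfl⟩
    obtain ⟨y, hy, hyx⟩ := h1 (range_le_cartan_sup hst ⟨x, rfl⟩)
    rwa [← hf hyx]

theorem isTypeA_or_isTypeC_roots_iff [FiniteDimensional ℂ M] [LieAlgebra.HasCentralRadical ℂ M]
    {f : M →ₗ⁅ℂ⁆ L} (hf : Function.Injective f)
    (hst : ∀ x ∈ H, ∀ y ∈ (f : M →ₗ[ℂ] L).range, ⁅x, y⁆ ∈ (f : M →ₗ[ℂ] L).range)
    (hco : ∀ α ∈ imageRoots H f, (coroot α : L) ∈ (f : M →ₗ[ℂ] L).range)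
    (T : LieSubalgebra ℂ M) [T.IsCartanSubalgebra] (hT : ∀ t ∈ T, f t ∈ H) :
    (IsTypeA (roots T) ∨ IsTypeC (roots T)) ↔
      (IsTypeA (imageRoots H f) ∨ IsTypeC (imageRoots H f)) := by
  obtain ⟨r, hr, hroots⟩ := exists_roots_eq_image hf hst hco T hT
  rw [hroots]
  exact isTypeA_or_isTypeC_image_iff r hr

end Embedding

/-! ### Ideals of the Levi subalgebra and their roots. -/

section Ideals

variable {L : Type*} [LieRing L] [LieAlgebra ℂ L] {H : LieSubalgebra ℂ L}
  [H.IsCartanSubalgebra] [FiniteDimensional ℂ L] [LieAlgebra.HasCentralRadical ℂ L]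
  {l : LieSubalgebra ℂ L} {h : H} {M : Type*} [LieRing M] [LieAlgebra ℂ M] {f : M →ₗ⁅ℂ⁆ L}

/-- `H` acts on the Levi part by inner derivations, so it preserves every ideal. -/
theorem lie_mem_range_comp_incl (hr : (f : M →ₗ[ℂ] L).range = (leviSub H l h).toSubmodule)
    {I : LieIdeal ℂ M} {x y : L} (hx : x ∈ H)
    (hy : y ∈ (f.comp I.incl : I →ₗ[ℂ] L).range) :
    ⁅x, y⁆ ∈ (f.comp I.incl : I →ₗ[ℂ] L).range := by
  rw [mem_range_comp_incl] at *
  obtain ⟨z, hz, rfl⟩ := hy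
  obtain ⟨u, hu, h0⟩ := exists_leviSub_lie_eq (l := l) (h := h) hx
  obtain ⟨t, rfl⟩ := hr.ge hu
  refine ⟨⁅t, z⁆, lie_mem_right ℂ M I _ _ hz, ?_⟩
  rw [LieHom.map_lie]
  exact (h0 _ (hr.le ⟨z, rfl⟩)).symm

theorem lie_mem_range_comp_incl_left (hr : (f : M →ₗ[ℂ] L).range = (leviSub H l h).toSubmodule)
    {I : LieIdeal ℂ M} {x y : L} (hx : x ∈ (f.comp I.incl : I →ₗ[ℂ] L).range)
    (hy : y ∈ leviSub H l h) : ⁅x, y⁆ ∈ (f.comp I.incl : I →ₗ[ℂ] L).range := by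
  rw [mem_range_comp_incl] at *
  obtain ⟨z, hz, rfl⟩ := hx
  obtain ⟨t, rfl⟩ := hr.ge hy
  exact ⟨⁅z, t⁆, lie_mem_left ℂ M I _ _ hz, LieHom.map_lie f z t⟩

theorem range_comp_incl_le (hr : (f : M →ₗ[ℂ] L).range = (leviSub H l h).toSubmodule)
    (I : LieIdeal ℂ M) : (f.comp I.incl : I →ₗ[ℂ] L).range ≤ (leviSub H l h).toSubmodule := by
  rw [← hr]
  rintro _ ⟨x, rfl⟩
  exact ⟨x, rfl⟩

theorem mem_imageRoots_of_mem {I : LieIdeal ℂ M} {α : Module.Dual ℂ H} (hα : α ∈ roots H) {e : L}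
    (he : e ∈ rootSpace H α) (he0 : e ≠ 0) (hI : e ∈ (f.comp I.incl : I →ₗ[ℂ] L).range) :
    α ∈ imageRoots H (f.comp I.incl) :=
  ⟨hα, rootSpace_le_of_mem hα.1 he he0 hI⟩

theorem imageRoots_subset_zeroRoots
    (hr : (f : M →ₗ[ℂ] L).range = (leviSub H l h).toSubmodule) (I : LieIdeal ℂ M) :
    imageRoots H (f.comp I.incl) ⊆ zeroRoots H l h := fun _ hα =>
  mem_of_rootSpace_le_sup hα.1 ((hα.2.trans (range_comp_incl_le hr I)).trans leviSub_le_cartan_sup)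

theorem coroot_mem_range (hr : (f : M →ₗ[ℂ] L).range = (leviSub H l h).toSubmodule)
    {I : LieIdeal ℂ M} {α : Module.Dual ℂ H} (hα : α ∈ imageRoots H (f.comp I.incl)) :
    (coroot α : L) ∈ (f.comp I.incl : I →ₗ[ℂ] L).range := by
  obtain ⟨e, e', he, he', hee, -⟩ := exists_isSl2Triple hα.1
  rw [← hee]
  exact lie_mem_range_comp_incl_left hr (hα.2 he)
    (rootSpace_le_leviSub (neg_mem_zeroRoots (imageRoots_subset_zeroRoots hr I hα)) he')

theorem neg_mem_imageRoots (hr : (f : M →ₗ[ℂ] L).range = (leviSub H l h).toSubmodule)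
    {I : LieIdeal ℂ M} {α : Module.Dual ℂ H} (hα : α ∈ imageRoots H (f.comp I.incl)) :
    -α ∈ imageRoots H (f.comp I.incl) := by
  have hα' := neg_mem_zeroRoots (imageRoots_subset_zeroRoots hr I hα)
  obtain ⟨e, he, he0⟩ := exists_ne_zero_of_mem_roots hα'.1.1
  have h1 : ⁅(coroot α : L), e⁆ ∈ (f.comp I.incl : I →ₗ[ℂ] L).range :=
    lie_mem_range_comp_incl_left hr (coroot_mem_range hr hα) (rootSpace_le_leviSub hα' he)
  rw [lie_eq_smul_of_mem_rootSpace hα'.1.1.1 he, LinearMap.neg_apply,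
    root_apply_coroot hα.1] at h1
  exact mem_imageRoots_of_mem hα'.1.1 (e := (-2 : ℂ) • e) ((rootSpace H _).smul_mem _ he)
    (smul_ne_zero (by norm_num) he0) h1

theorem imageRoots_add (hr : (f : M →ₗ[ℂ] L).range = (leviSub H l h).toSubmodule)
    {I : LieIdeal ℂ M} {α β : Module.Dual ℂ H} (hα : α ∈ imageRoots H (f.comp I.incl))
    (hβ : β ∈ zeroRoots H l h) (hαβ : α + β ∈ roots H) :
    α + β ∈ imageRoots H (f.comp I.incl) := by
  obtain ⟨e, he, he0⟩ := exists_ne_zero_of_mem_roots hα.1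
  obtain ⟨e', he', he0'⟩ := exists_ne_zero_of_mem_roots hβ.1.1
  exact mem_imageRoots_of_mem hαβ (lie_mem_rootSpace_add he he')
    (lie_ne_zero hα.1 hβ.1.1 hαβ he he' he0 he0')
    (lie_mem_range_comp_incl_left hr (hα.2 he) (rootSpace_le_leviSub hβ he'))

theorem isTypeA_or_isTypeC_ideal_iff [FiniteDimensional ℂ M] (hf : Function.Injective f)
    (hr : (f : M →ₗ[ℂ] L).range = (leviSub H l h).toSubmodule)
    {I : LieIdeal ℂ M} (hI : LieAlgebra.IsSimple ℂ I)
    (T : LieSubalgebra ℂ I) [T.IsCartanSubalgebra] (hT : ∀ t ∈ T, f t ∈ H) :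
    (IsTypeA (roots T) ∨ IsTypeC (roots T)) ↔
      (IsTypeA (imageRoots H (f.comp I.incl)) ∨ IsTypeC (imageRoots H (f.comp I.incl))) :=
  have : LieAlgebra.HasCentralRadical ℂ I := hasCentralRadical_of_radical_le ℂ I
    ((HasTrivialRadical.radical_eq_bot (R := ℂ) (L := I)).trans_le bot_le)
  isTypeA_or_isTypeC_roots_iff (f := f.comp I.incl) (hf.comp Subtype.val_injective)
    (fun _ hx _ hy => lie_mem_range_comp_incl hr hx hy) (fun _ hα => coroot_mem_range hr hα) T hT

end Ideals

/-- A sum of elements of components that stays in the union stays in one component. -/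
theorem add_mem_component {V ι : Type*} [AddCommGroup V] [Module ℂ V] {S : Set V}
    {Ψ : ι → Set V} (hS : S = ⋃ i, Ψ i) (hind : iSupIndep fun i => Submodule.span ℂ (Ψ i))
    (h0 : (0 : V) ∉ S) {i j : ι} {α β : V} (hα : α ∈ Ψ i) (hβ : β ∈ Ψ j) (hαβ : α + β ∈ S) :
    i = j ∧ α + β ∈ Ψ i := by
  have hmem : ∀ {i v}, v ∈ Ψ i → v ∈ Submodule.span ℂ (Ψ i) := fun hv => Submodule.subset_span hv
  have hne : ∀ {i v}, v ∈ Ψ i → v ≠ 0 := by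
    rintro i v hv rfl
    exact h0 (hS ▸ Set.mem_iUnion_of_mem i hv)
  have hdis : ∀ {i j}, i ≠ j → ∀ {v}, v ∈ Submodule.span ℂ (Ψ i) →
      v ∈ Submodule.span ℂ (Ψ j) → v = 0 := fun hij _ h1 h2 =>
    Submodule.disjoint_def.1 (hind.pairwiseDisjoint hij) _ h1 h2
  obtain ⟨k, hk⟩ := Set.mem_iUnion.1 (hS ▸ hαβ)
  have hij : i = j := by
    by_contra hij
    by_cases hki : k = i
    · subst hki
      have := Submodule.sub_mem _ (hmem hk) (hmem hα)
      rw [add_sub_cancel_left] at this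
      exact hne hβ (hdis hij this (hmem hβ))
    · refine hne hα (Submodule.disjoint_def.1 (hind i) α (hmem hα) ?_)
      have h1 : ∀ k, k ≠ i → Submodule.span ℂ (Ψ k) ≤
          ⨆ (j : ι) (_ : j ≠ i), Submodule.span ℂ (Ψ j) := fun k hk =>
        le_iSup₂ (f := fun (j : ι) (_ : j ≠ i) => Submodule.span ℂ (Ψ j)) k hk
      have := Submodule.sub_mem _ (h1 k hki (hmem hk)) (h1 j (Ne.symm hij) (hmem hβ))
      rwa [add_sub_cancel_right] at this
  subst hij
  refine ⟨rfl, ?_⟩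
  by_cases hki : k = i
  · exact hki ▸ hk
  · exact absurd (hdis hki (hmem hk) (Submodule.add_mem _ (hmem hα) (hmem hβ))) (hne hk)

/-- The set of minimal ideals. -/
def atomIdeals (M : Type*) [LieRing M] [LieAlgebra ℂ M] : Set (LieIdeal ℂ M) := {I | IsAtom I}

theorem sSup_atomIdeals (M : Type*) [LieRing M] [LieAlgebra ℂ M]
    [h : LieAlgebra.IsSemisimple ℂ M] : (sSup (atomIdeals M)).toSubmodule = ⊤ :=
  congrArg LieSubmodule.toSubmodule h.sSup_atoms_eq_top

theorem finite_atomIdeals (M : Type*) [LieRing M] [LieAlgebra ℂ M] [FiniteDimensional ℂ M]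
    [h : LieAlgebra.IsSemisimple ℂ M] : Finite (atomIdeals M) :=
  WellFoundedGT.finite_of_sSupIndep h.sSupIndep_isAtom

/-! ### Simple ideals correspond to irreducible components. -/

section Components

variable {L : Type*} [LieRing L] [LieAlgebra ℂ L] {H : LieSubalgebra ℂ L}
  [H.IsCartanSubalgebra] [FiniteDimensional ℂ L] [LieAlgebra.HasCentralRadical ℂ L]
  {l : LieSubalgebra ℂ L} {h : H} {M : Type*} [LieRing M] [LieAlgebra ℂ M] {f : M →ₗ⁅ℂ⁆ L}

/-- A negative pairing would make `α + β` a root, which cannot happen across independent components.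
The same applied to `-β` excludes a positive pairing. -/
theorem apply_coroot_eq_zero_of_components {ι : Type*} {Ψ : ι → Set (Module.Dual ℂ H)}
    (hS : zeroRoots H l h = ⋃ i, Ψ i) (hind : iSupIndep fun i => Submodule.span ℂ (Ψ i))
    {i j : ι} (hij : i ≠ j) {α β : Module.Dual ℂ H} (hα : α ∈ Ψ i) (hβ : β ∈ Ψ j) :
    β (coroot α) = 0 := by
  have h0 : (0 : Module.Dual ℂ H) ∉ zeroRoots H l h := fun h => h.1.1.1 rfl
  have hdis : ∀ {i j}, i ≠ j → ∀ {v}, v ∈ Submodule.span ℂ (Ψ i) →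
      v ∈ Submodule.span ℂ (Ψ j) → v = 0 := fun hij _ h1 h2 =>
    Submodule.disjoint_def.1 (hind.pairwiseDisjoint hij) _ h1 h2
  have hmemS : ∀ {i v}, v ∈ Ψ i → v ∈ zeroRoots H l h := fun hv =>
    hS ▸ Set.mem_iUnion_of_mem _ hv
  have key : ∀ β ∈ Ψ j, ¬ (β (coroot α)).re < 0 := by
    intro β hβ hlt
    have hαβ : α + β ≠ 0 := by
      intro hz
      have hα' : α ∈ Submodule.span ℂ (Ψ j) := by
        rw [eq_neg_of_add_eq_zero_left hz]
        exact neg_mem (Submodule.subset_span hβ)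
      exact (hmemS hα).1.1.1 (hdis hij (Submodule.subset_span hα) hα')
    have hr := add_mem_roots (hmemS hα).1.1 (hmemS hβ).1.1 hlt hαβ
    exact hij (add_mem_component hS hind h0 hα hβ
      (zeroRoots_add (hmemS hα) (hmemS hβ) hr)).1
  have hneg : -β ∈ Ψ j := by
    have hβ' := neg_mem_zeroRoots (hmemS hβ)
    obtain ⟨k, hk⟩ := Set.mem_iUnion.1 (hS ▸ hβ')
    by_cases hkj : k = j
    · exact hkj ▸ hk
    · exact absurd (hdis hkj (Submodule.subset_span hk)
        (neg_mem (Submodule.subset_span hβ))) hβ'.1.1.1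
  obtain ⟨n, hn⟩ := exists_int_eq_apply_coroot (hmemS hα).1.1 (hmemS hβ).1.1
  have h1 := key β hβ
  have h2 := key (-β) hneg
  rw [LinearMap.neg_apply, Complex.neg_re] at h2
  rw [hn, Complex.intCast_re] at h1 h2
  have h3 : (n : ℝ) = 0 := by linarith
  rw [hn, Int.cast_eq_zero.1 h3, Int.cast_zero]

theorem range_comp_incl_le_cartan_sup
    (hr : (f : M →ₗ[ℂ] L).range = (leviSub H l h).toSubmodule) (I : LieIdeal ℂ M) :
    (f.comp I.incl : I →ₗ[ℂ] L).range ≤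
      H.toSubmodule ⊔ rootSum H (imageRoots H (f.comp I.incl)) :=
  (range_le_cartan_sup fun _ hx _ hy => lie_mem_range_comp_incl hr hx hy).trans
    (sup_le_sup inf_le_right le_rfl)

/-- The roots of a simple ideal of the Levi subalgebra form an irreducible component. -/
theorem exists_imageRoots_eq_component (hf : Function.Injective f)
    (hr : (f : M →ₗ[ℂ] L).range = (leviSub H l h).toSubmodule)
    {ι : Type*} {Ψ : ι → Set (Module.Dual ℂ H)}
    (hS : zeroRoots H l h = ⋃ i, Ψ i) (hind : iSupIndep fun i => Submodule.span ℂ (Ψ i))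
    (htype : ∀ i, IsTypeA (Ψ i) ∨ IsTypeC (Ψ i))
    {I : LieIdeal ℂ M} (hI : LieAlgebra.IsSimple ℂ I) :
    ∃ i, imageRoots H (f.comp I.incl) = Ψ i := by
  have h0 : (0 : Module.Dual ℂ H) ∉ zeroRoots H l h := fun h => h.1.1.1 rfl
  have hmemS : ∀ {i v}, v ∈ Ψ i → v ∈ zeroRoots H l h := fun hv =>
    hS ▸ Set.mem_iUnion_of_mem _ hv
  have hsub := imageRoots_subset_zeroRoots (H := H) hr I
  have hle := range_comp_incl_le_cartan_sup (H := H) hr I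
  have hinj : Function.Injective (f.comp I.incl) := hf.comp Subtype.val_injective
  -- Without roots the ideal would embed into the abelian `H`.
  obtain ⟨α, hα⟩ : (imageRoots H (f.comp I.incl)).Nonempty := by
    rw [Set.nonempty_iff_ne_empty]
    intro he
    refine hI.non_abelian ⟨fun x y => hinj ?_⟩
    have hH : ∀ x, f.comp I.incl x ∈ H := by
      intro x
      have h1 := hle ⟨x, rfl⟩
      rw [he] at h1
      exact (sup_le le_rfl (rootSum_le.2 fun _ h => h.elim) :
        H.toSubmodule ⊔ rootSum H ∅ ≤ H.toSubmodule) h1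
    rw [LieHom.map_lie, map_zero]
    exact lie_cartan_eq_zero H (hH x) (hH y)
  obtain ⟨i, hi⟩ := Set.mem_iUnion.1 (hS ▸ hsub hα)
  -- The roots of an ideal are closed under negation and under adding roots of the Levi part, so
  -- irreducibility of `Ψ i` gives all of it.
  have hsup : Ψ i ⊆ imageRoots H (f.comp I.incl) := by
    have hneg : ∀ α ∈ imageRoots H (f.comp I.incl), -α ∈ imageRoots H (f.comp I.incl) :=
      fun α hα => neg_mem_imageRoots hr hα
    have hadd : ∀ α ∈ imageRoots H (f.comp I.incl), ∀ β ∈ Ψ i, α + β ∈ Ψ i →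
        α + β ∈ imageRoots H (f.comp I.incl) := fun α hα β hβ hαβ =>
      imageRoots_add hr hα (hmemS hβ) (hmemS hαβ).1.1
    rcases htype i with ht | ht
    · exact ht.subset_of_closed ⟨α, hi, hα⟩ hneg hadd
    · exact ht.subset_of_closed ⟨α, hi, hα⟩ hneg hadd
  refine ⟨i, Set.Subset.antisymm ?_ hsup⟩
  let U : Submodule ℂ L := (corootSpan (Ψ i)).map H.toSubmodule.subtype
  have hU : U ≤ H.toSubmodule := Submodule.map_subtype_le _ _
  -- Conversely, the coroots and root spaces of `Ψ i` cut out a non-zero ideal of `I`, which is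
  -- everything by simplicity.
  let J : LieIdeal ℂ I :=
    { (U ⊔ rootSum H (Ψ i)).comap (f.comp I.incl : I →ₗ[ℂ] L) with
      lie_mem := fun {x y} hy => by
        change f.comp I.incl ⁅x, y⁆ ∈ U ⊔ rootSum H (Ψ i)
        rw [LieHom.map_lie, ← lie_skew]
        refine neg_mem (lie_mem_sup_rootSum hU le_rfl (fun _ hα => (hmemS hα).1.1)
          imageRoots_subset ?_ ?_ ?_ hy (hle ⟨x, rfl⟩))
        · intro β hβ
          obtain ⟨j, hj⟩ := Set.mem_iUnion.1 (hS ▸ hsub hβ)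
          by_cases hij : i = j
          · exact Or.inl (hij ▸ hj)
          · refine Or.inr ?_
            rintro _ ⟨u, hu, huu⟩
            obtain rfl := Subtype.ext huu
            have : corootSpan (Ψ i) ≤ LinearMap.ker β := by
              refine Submodule.span_le.2 ?_
              rintro _ ⟨γ, hγ, rfl⟩
              exact apply_coroot_eq_zero_of_components hS hind hij hγ hj
            exact this hu
        · intro α hα β hβ hαβ
          obtain ⟨j, hj⟩ := Set.mem_iUnion.1 (hS ▸ hsub hβ)
          exact (add_mem_component hS hind h0 hα hj
            (zeroRoots_add (hmemS hα) (hsub hβ) hαβ)).2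
        · intro α hα _
          exact Submodule.mem_map_of_mem (f := H.toSubmodule.subtype)
            (coroot_mem_corootSpan hα) }
  have hJ : J = ⊤ := by
    refine (hI.eq_bot_or_eq_top J).resolve_left fun hb => ?_
    obtain ⟨e, he, he0⟩ := exists_ne_zero_of_mem_roots hα.1
    obtain ⟨x, rfl⟩ := hα.2 he
    have hx : x ∈ J := Submodule.mem_sup_right (rootSpace_le_rootSum hi he)
    rw [hb, LieSubmodule.mem_bot] at hx
    exact he0 (by rw [hx, map_zero])
  intro β hβ
  refine mem_of_rootSpace_le_sup hβ.1 (hβ.2.trans ?_)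
  rintro _ ⟨x, rfl⟩
  have hx : x ∈ J := hJ ▸ LieSubmodule.mem_top x
  exact (sup_le_sup hU le_rfl : U ⊔ rootSum H (Ψ i) ≤ H.toSubmodule ⊔ rootSum H (Ψ i)) hx

/-- Ideals with zero intersection commute, so the coroot of one annihilates the root vectors of the
other. -/
theorem apply_coroot_eq_zero_of_inf_eq_bot
    (hr : (f : M →ₗ[ℂ] L).range = (leviSub H l h).toSubmodule)
    {I J : LieIdeal ℂ M} (hIJ : I ⊓ J = ⊥) {α β : Module.Dual ℂ H}
    (hα : α ∈ imageRoots H (f.comp I.incl)) (hβ : β ∈ imageRoots H (f.comp J.incl)) :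
    β (coroot α) = 0 := by
  obtain ⟨x, hx, hxα⟩ := mem_range_comp_incl.1 (coroot_mem_range hr hα)
  obtain ⟨e, he, he0⟩ := exists_ne_zero_of_mem_roots hβ.1
  obtain ⟨y, hy, rfl⟩ := mem_range_comp_incl.1 (hβ.2 he)
  have hxy : ⁅x, y⁆ ∈ I ⊓ J := (LieSubmodule.mem_inf ..).2
    ⟨lie_mem_left ℂ M I _ _ hx, lie_mem_right ℂ M J _ _ hy⟩
  rw [hIJ, LieSubmodule.mem_bot] at hxy
  have h1 : ⁅f x, f y⁆ = 0 := by rw [← LieHom.map_lie, hxy, map_zero]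
  rw [hxα, lie_eq_smul_of_mem_rootSpace hβ.1.1 he] at h1
  exact (smul_eq_zero.1 h1).resolve_right he0

theorem map_toSubmodule_le_cartan_sup
    (hr : (f : M →ₗ[ℂ] L).range = (leviSub H l h).toSubmodule) {I : LieIdeal ℂ M}
    {A : Set (Module.Dual ℂ H)} (hA : imageRoots H (f.comp I.incl) ⊆ A) :
    I.toSubmodule.map (f : M →ₗ[ℂ] L) ≤ H.toSubmodule ⊔ rootSum H A := by
  refine le_trans ?_ ((range_comp_incl_le_cartan_sup (H := H) hr I).trans
    (sup_le_sup le_rfl (rootSum_mono hA)))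
  rintro _ ⟨y, hy, rfl⟩
  exact ⟨⟨y, hy⟩, rfl⟩

theorem zeroRoots_eq_iUnion [LieAlgebra.IsSemisimple ℂ M]
    (hr : (f : M →ₗ[ℂ] L).range = (leviSub H l h).toSubmodule) :
    zeroRoots H l h = ⋃ I : atomIdeals M, imageRoots H (f.comp I.1.incl) := by
  refine Set.Subset.antisymm (fun α hα => ?_)
    (Set.iUnion_subset fun I => imageRoots_subset_zeroRoots hr I.1)
  refine mem_of_rootSpace_le_sup hα.1.1 ((rootSpace_le_leviSub hα).trans ?_)
  rw [← hr, LinearMap.range_eq_map, ← sSup_atomIdeals, Submodule.map_le_iff_le_comap,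
    LieSubmodule.sSup_toSubmodule]
  refine sSup_le ?_
  rintro _ ⟨I, hI, rfl⟩
  rw [← Submodule.map_le_iff_le_comap]
  exact map_toSubmodule_le_cartan_sup hr
    (Set.subset_iUnion (fun I : atomIdeals M => imageRoots H (f.comp I.1.incl)) ⟨I, hI⟩)

/-- A vector in one span and in the sum of the others vanishes on all coroots of its own ideal,
hence is zero. -/
theorem iSupIndep_span_imageRoots (hr : (f : M →ₗ[ℂ] L).range = (leviSub H l h).toSubmodule) :
    iSupIndep fun I : atomIdeals M =>
      Submodule.span ℂ (imageRoots H (f.comp I.1.incl)) := by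
  have horth : ∀ I J : atomIdeals M, I ≠ J →
      ∀ α ∈ imageRoots H (f.comp I.1.incl),
      ∀ v ∈ Submodule.span ℂ (imageRoots H (f.comp J.1.incl)), v (coroot α) = 0 := by
    intro I J hIJ α hα v hv
    have hIJ' : I.1 ⊓ J.1 = ⊥ :=
      (I.2.disjoint_of_ne J.2 fun h => hIJ (Subtype.ext h)).eq_bot
    have : Submodule.span ℂ (imageRoots H (f.comp J.1.incl)) ≤
        LinearMap.ker (Module.Dual.eval ℂ H (coroot α)) :=
      Submodule.span_le.2 fun β hβ => apply_coroot_eq_zero_of_inf_eq_bot hr hIJ' hα hβ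
    exact this hv
  intro I
  rw [Submodule.disjoint_def]
  intro v hv hv'
  refine eq_zero_of_mem_span_of_apply_coroot imageRoots_subset hv fun α hα => ?_
  have : ⨆ (J : atomIdeals M) (_ : J ≠ I),
      Submodule.span ℂ (imageRoots H (f.comp J.1.incl)) ≤
        LinearMap.ker (Module.Dual.eval ℂ H (coroot α)) :=
    iSup₂_le fun J hJ w hw => horth I J (Ne.symm hJ) α hα w hw
  exact this hv'

theorem hasComponentsAC_zeroRoots [FiniteDimensional ℂ M] [LieAlgebra.IsSemisimple ℂ M]
    (hr : (f : M →ₗ[ℂ] L).range = (leviSub H l h).toSubmodule)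
    (htype : ∀ I ∈ atomIdeals M,
      IsTypeA (imageRoots H (f.comp I.incl)) ∨ IsTypeC (imageRoots H (f.comp I.incl))) :
    HasComponentsAC (zeroRoots H l h) := by
  have := finite_atomIdeals M
  obtain ⟨N, ⟨e⟩⟩ := Finite.exists_equiv_fin (atomIdeals M)
  refine ⟨N, fun i => imageRoots H (f.comp (e.symm i).1.incl), ?_, ?_, fun i =>
    htype _ (e.symm i).2⟩
  · rw [zeroRoots_eq_iUnion hr]
    exact (e.symm.surjective.iUnion_comp
      fun I : atomIdeals M => imageRoots H (f.comp I.1.incl)).symm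
  · exact (iSupIndep_span_imageRoots hr).comp e.symm.injective

end Components

/-! ### The centralizer condition. -/

section Main

variable {L : Type*} [LieRing L] [LieAlgebra ℂ L] {H : LieSubalgebra ℂ L}
  [H.IsCartanSubalgebra] [FiniteDimensional ℂ L] [LieAlgebra.HasCentralRadical ℂ L]
  {l : LieSubalgebra ℂ L} {h : H}

theorem symQ_eq_zeroRoots (hQ : setQ H l = {α ∈ rootsPerp H l | 0 ≤ (α h).re}) :
    symQ H l = zeroRoots H l h := by
  ext α
  constructor
  · rintro ⟨h1, h2⟩
    rw [hQ] at h1 h2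
    have h3 := h2.2
    rw [LinearMap.neg_apply, Complex.neg_re] at h3
    exact ⟨h1.1, le_antisymm (by linarith) h1.2⟩
  · intro hα
    have hα' := neg_mem_zeroRoots hα
    refine ⟨?_, ?_⟩
    · rw [hQ]
      exact ⟨hα.1, hα.2.ge⟩
    · rw [hQ]
      exact ⟨hα'.1, hα'.2.ge⟩

/-- From left to right an arbitrary Levi subalgebra is carried to the standard one, and its minimal
ideals give the components. From right to left the standard Levi subalgebra is the witness, and the
preimage of `H` in each simple ideal is the required Cartan subalgebra. -/
theorem centralizerCondition_iff
    (hq : (centK H l ⊓ RootSub.normalizer (partN H l)).toSubmodule =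
      h1 H l ⊔ rootSum H {α ∈ rootsPerp H l | 0 ≤ (α h).re}) :
    CentralizerCondition H l ↔ HasComponentsAC (zeroRoots H l h) := by
  constructor
  · rintro ⟨m, hm, htype⟩
    obtain ⟨f, hf, hr, hfH⟩ := exists_levi_hom hq hm
    have := hasTrivialRadical_of_range_eq_leviSub hf hr
    refine hasComponentsAC_zeroRoots hr fun I hI => ?_
    have hsim : LieAlgebra.IsSimple ℂ I := IsSemisimple.isSimple_of_isAtom I hI
    obtain ⟨T, hT, hTH, h⟩ := htype I hsim
    exact (isTypeA_or_isTypeC_ideal_iff hf hr hsim T fun t ht => hfH _ (hTH t ht)).1 h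
  · rintro ⟨N, Ψ, hS, hind, htype⟩
    refine ⟨_, isCompl_leviSub_radical hq, fun I hI => ?_⟩
    let m := (leviSub H l h).comap
      (centK H l ⊓ RootSub.normalizer (partN H l) : LieSubalgebra ℂ L).incl
    let f : m →ₗ⁅ℂ⁆ L := LieHom.comp (LieSubalgebra.incl _) m.incl
    have hf : Function.Injective f := Subtype.val_injective.comp Subtype.val_injective
    have hr : (f : m →ₗ[ℂ] L).range = (leviSub H l h).toSubmodule := by
      apply le_antisymm
      · rintro _ ⟨x, rfl⟩
        exact x.2
      · intro x hx
        exact ⟨⟨⟨x, leviSub_le hq hx⟩, hx⟩, rfl⟩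
    have hT : (H.comap (f.comp I.incl)).IsCartanSubalgebra :=
      isCartanSubalgebra_comap (hf.comp Subtype.val_injective)
        (fun _ hx _ hy => lie_mem_range_comp_incl hr hx hy) fun _ hα => coroot_mem_range hr hα
    refine ⟨H.comap (f.comp I.incl), hT, fun x hx => hx, ?_⟩
    rw [isTypeA_or_isTypeC_ideal_iff hf hr hI _ fun t ht => ht]
    obtain ⟨i, hi⟩ := exists_imageRoots_eq_component hf hr hS hind htype hI
    rw [hi]
    exact htype i

end Main

end RootSub

theorem mainTheorem5 {L : Type*} [LieRing L] [LieAlgebra ℂ L] [FiniteDimensional ℂ L]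
    [LieAlgebra.HasCentralRadical ℂ L]
    (H : LieSubalgebra ℂ L) [H.IsCartanSubalgebra]
    (b : LieSubalgebra ℂ L) (hb : IsBorelOf ⊤ b) (hHb : H ≤ b)
    (l : LieSubalgebra ℂ L) (hHl : H ≤ l)
    (hcone : ConeCondition H b l) :
    IsParabolicOf (centK H l)
        (centK H l ⊓ RootSub.normalizer ((centK H l).toSubmodule ⊓ partN H l)) ∧
      (∃ h : H, (∀ α ∈ roots H, (α h).im = 0) ∧
        (centK H l ⊓
          RootSub.normalizer ((centK H l).toSubmodule ⊓ partN H l)).toSubmodule = qSub H l h) ∧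
      centK H l ⊓ RootSub.normalizer (partN H l) =
        centK H l ⊓ RootSub.normalizer ((centK H l).toSubmodule ⊓ partN H l) ∧
      (centK H l ⊓ RootSub.normalizer (partN H l)).toSubmodule =
        h1 H l ⊔ rootSum H (setQ H l) ∧
      (CentralizerCondition H l ↔ HasComponentsAC (symQ H l)) := by
  obtain ⟨h, him, hN, hS⟩ := exists_cone_separating hcone
  have hQ := setQ_eq hb.prop.2 hN hS
  have h3 := centK_inf_normalizer_partN_eq hb.prop.2 hN hS
  have hq := centK_inf_normalizer_eq (H := H) (l := l)
  have hq' := hq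
  rw [hQ] at hq'
  refine ⟨isParabolicOf_of_eq hq', ⟨h, him, hq'⟩, h3, ?_, ?_⟩
  · rw [h3, hq]
  · rw [symQ_eq_zeroRoots hQ]
    exact centralizerCondition_iff (by rw [h3, hq'])
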